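/- Let $G=(V,E)$ be a directed graph with $n=|V|\ge 1$ vertices and arbitrary rational edge weights $w\colon E\to\mathbb Q$. For $S\subseteq V$ let $\partial S$ be the set of edges from $S$ to $V\setminus S$, and for $M\subseteq E$ let $\alpha(M)=\sum_{e\in M}w(e)$. Let $f\colon\mathbb N_0\times\mathbb Q\to\mathbb Q\cup\{\pm\infty\}$ be such that either $s\mapsto f(\nu,s)$ is monotone for every $\nu$, or $s\mapsto f(\nu,s)$ is antitone for every $\nu$, and let $\mathrm{valid}\colon\mathbb N_0\to\{\mathrm{true},\mathrm{false}\}$. Order pairs by $(\nu,s)\sqsubseteq(\nu',s')\iff f(\nu,s)\le f(\nu',s')$, and let $\bot$ be an additional smallest element. A supremum $\bigsqcup M$ of a finite set $M$ of pairs is an element of $M$ with the largest value of $f$, or $\bot$ if $M=\emptyset$. Put $$\Phi=\bigsqcup_{S\subseteq V,\ \mathrm{valid}(|S|)}\big(|S|,\alpha(\partial S)\big).$$ A tree decomposition of (the underlying graph of) $G$ is a rooted tree with node set $I$ and root $r$, together with bags $X_i\subseteq V$ ($i\in I$) that cover $V$, such that both ends of every edge lie in a common bag and, for every $v\in V$,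 the nodes whose bags contain $v$ induce a connected subgraph. Its width is $t=\max_i|X_i|-1$. It is small if $|I|\le 4(n+1)$. It is nice if every node $i$ is a leaf (no child), a forget node (one child $j$, and $X_j=X_i\uplus\{v\}$), an introduce node (one child $j$, and $X_i=X_j\uplus\{v\}$), or a join node (two children $j\ne k$, and $X_i=X_j=X_k$). **(1) Running time.** There are a single program for a unit-cost random access machine and a constant $C$ such that the following holds for all such $G$, $f$ and $\mathrm{valid}$, and for every small nice tree decomposition of $G$ of width $t$. Given $G$, $w$ and the decomposition as lists, the program halts after at most $C\cdot 2^t n^2$ steps and outputs (a representative of) $\Phi$. Here exact addition, subtraction and comparison of rationals have unit cost; natural numbers can be added, subtracted, halved, compared and used as addresses at unit cost (there is no multiplication); and $f$ (evaluated and compared) and $\mathrm{valid}$ are oracles of unit cost. **(2) Dynamic program.** Let a nice tree decomposition of $G$ be given (here it need not be small, and $n=0$ is allowed). For a node $i$ let $Y_i$ be the union of the bags of the nodes below $i$ (including $i$), and let $F_i=Y_i\setminus X_i$. For $S\subseteq X_i$ and $0\le\ell\le|F_i|$ let $$\Gamma_i(\ell,S)=\bigsqcup_{\hat S\subseteq F_i,\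 |\hat S|=\ell}\Big(\ell+|S|,\ \alpha\big(\partial(S\uplus\hat S)\cap Y_i^2\big)\Big).$$ In this formula and in the recurrences below, ties in $\bigsqcup$ between pairs with the same first component are broken towards the larger second component if $f$ is monotone in its second argument, and towards the smaller one if it is antitone. For $A,B\subseteq V$ write $\alpha(A,B)$ for the total weight of the edges from $A$ to $B$. Then these tables exist, and a family of tables consists of these suprema if and only if it satisfies the following recurrences at all nodes, for all $S\subseteq X_i$ and $0\le\ell\le|F_i|$. * Leaf $i$: $\Gamma_i(0,\emptyset)=(0,0)$; $\Gamma_i(0,\{v\})=(1,\alpha(\{v\},X_i\setminus\{v\}))$ for $v\in X_i$; and for $S=S'\uplus\{v\}$ with $S'\neq\emptyset$, $\Gamma_i(0,S)=\Gamma_i(0,S')+\big(1,\alpha(\{v\},X_i\setminus S)-\alpha(S',\{v\})\big)$. * Forget node $i$ with child $j$ and $X_j=X_i\uplus\{v\}$: $\Gamma_i(0,S)=\Gamma_j(0,S)$, and for $\ell\ge1$, $\Gamma_i(\ell,S)=\Gamma_j(\ell-1,S\uplus\{v\})\sqcup\Gamma_j(\ell,S)$, where the second term is omitted if $\ell>|F_j|$.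 * Introduce node $i$ with child $j$ and $X_i=X_j\uplus\{v\}$: $\Gamma_i(\ell,S)=(1,\alpha(\{v\},X_i\setminus S))+\Gamma_j(\ell,S\setminus\{v\})$ if $v\in S$, and $\Gamma_i(\ell,S)=(0,\alpha(S,\{v\}))+\Gamma_j(\ell,S)$ if $v\notin S$. * Join node $i$ with children $j,k$: $$\Gamma_i(\ell,S)=\Big(\bigsqcup_{\substack{0\le\ell_1\le|F_j|,\ 0\le\ell_2\le|F_k|\\ \ell_1+\ell_2=\ell}}\big(\Gamma_j(\ell_1,S)+\Gamma_k(\ell_2,S)\big)\Big)-\big(|S|,\alpha(\partial S\cap X_i^2)\big).$$ Moreover, every supremum of $\{\Gamma_r(\ell,S) : S\subseteq X_r,\ 0\le\ell\le|F_r|,\ \mathrm{valid}(\ell+|S|)\}$ is a supremum $\Phi$ as defined above. -/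

import Mathlib

namespace CutFramework

/-! ## Weighted directed graphs and cuts -/

/-- A directed graph with rational edge weights. Only the weights of members of `edges` matter. -/
structure WDigraph (V : Type*) where
  edges : Finset (V × V)
  weight : V × V → ℚ

section Graph

variable {V : Type*} [DecidableEq V]

/-- `α(M)`, the total weight of a set of edges. -/
def WDigraph.alpha (G : WDigraph V) (M : Finset (V × V)) : ℚ := ∑ e ∈ M, G.weight e

/-- `∂S`, the set of edges from `S` to its complement. -/
def WDigraph.cut (G : WDigraph V) (S : Finset V) : Finset (V × V) :=
  G.edges.filter fun e => e.1 ∈ S ∧ e.2 ∉ S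

/-- Total weight of the edges from `A` to `B`. -/
def WDigraph.between (G : WDigraph V) (A B : Finset V) : ℚ := G.alpha (G.edges ∩ (A ×ˢ B))

end Graph

/-! ## Rooted trees and (nice) tree decompositions -/

/-- A rooted tree with node set `I`. -/
structure RootedTree (I : Type*) where
  graph : SimpleGraph I
  isTree : graph.IsTree
  root : I

/-- `j` is a child of `i`: a neighbour of `i` that is one step farther from the root. -/
def RootedTree.IsChild {I : Type*} (T : RootedTree I) (j i : I) : Prop :=
  T.graph.Adj i j ∧ T.graph.dist T.root j = T.graph.dist T.root i + 1

/-- `k` is below `i` (every node is below itself). -/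
def RootedTree.Below {I : Type*} (T : RootedTree I) (k i : I) : Prop :=
  Relation.ReflTransGen T.IsChild k i

/-- A tree decomposition of (the underlying graph of) the directed graph `G`. -/
structure TreeDecomposition {V : Type*} (G : WDigraph V) (I : Type*) where
  tree : RootedTree I
  bag : I → Finset V
  node_coverage : ∀ v : V, ∃ i, v ∈ bag i
  edge_coverage : ∀ e ∈ G.edges, ∃ i, e.1 ∈ bag i ∧ e.2 ∈ bag i
  coherence : ∀ v : V, (tree.graph.induce {i | v ∈ bag i}).Connected

namespace TreeDecomposition

variable {V I : Type*} {G : WDigraph V}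

/-- The largest cardinality of a bag, minus one (for a graph with at least one vertex there is a
nonempty bag, so that the subtraction is not truncated). -/
def width [Fintype I] (D : TreeDecomposition G I) : ℕ :=
  (Finset.univ.sup fun i => (D.bag i).card) - 1

def IsSmall [Fintype V] [Fintype I] (_D : TreeDecomposition G I) : Prop :=
  Fintype.card I ≤ 4 * (Fintype.card V + 1)

def IsLeaf (D : TreeDecomposition G I) (i : I) : Prop := ∀ j, ¬ D.tree.IsChild j i

/-- `i` forgets the vertex `v` of its only child `j`. -/
def IsForget [DecidableEq V] (D : TreeDecomposition G I) (i j : I) (v : V) : Prop :=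
  (∀ k, D.tree.IsChild k i ↔ k = j) ∧ v ∉ D.bag i ∧ D.bag j = insert v (D.bag i)

/-- `i` introduces the vertex `v`, which is not in the bag of its only child `j`. -/
def IsIntroduce [DecidableEq V] (D : TreeDecomposition G I) (i j : I) (v : V) : Prop :=
  (∀ k, D.tree.IsChild k i ↔ k = j) ∧ v ∉ D.bag j ∧ D.bag i = insert v (D.bag j)

/-- `i` joins its two children `j` and `k`. -/
def IsJoin (D : TreeDecomposition G I) (i j k : I) : Prop :=
  j ≠ k ∧ (∀ l, D.tree.IsChild l i ↔ l = j ∨ l = k) ∧ D.bag i = D.bag j ∧ D.bag i = D.bag k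

def IsNice [DecidableEq V] (D : TreeDecomposition G I) : Prop :=
  ∀ i, D.IsLeaf i ∨ (∃ j v, D.IsForget i j v) ∨ (∃ j v, D.IsIntroduce i j v) ∨
    (∃ j k, D.IsJoin i j k)

open Classical in
/-- `Y_i`: the vertices in bags of nodes below `i`. -/
noncomputable def vertsBelow [Fintype V] (D : TreeDecomposition G I) (i : I) : Finset V :=
  Finset.univ.filter fun v => ∃ k, D.tree.Below k i ∧ v ∈ D.bag k

/-- `F_i = Y_i \ X_i`: the vertices forgotten below `i`. -/
noncomputable def forgotten [Fintype V] [DecidableEq V] (D : TreeDecomposition G I) (i : I) :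
    Finset V :=
  D.vertsBelow i \ D.bag i

end TreeDecomposition

/-! ## The objective function, the order `⊑` and its suprema -/

/-- The rational numbers with `-∞` and `∞`. -/
abbrev ExtRat : Type := WithBot (WithTop ℚ)

abbrev Objective : Type := ℕ → ℚ → ExtRat

/-- The order `⊑` on pairs (number of vertices, size of the cut) and the extra element `⊥`
(`none`): `⊥` is smallest, and pairs are compared by their value under `f`. -/
def Sqle (f : Objective) (a b : Option (ℕ × ℚ)) : Prop :=
  a = none ∨ ∃ p q, a = some p ∧ b = some q ∧ f p.1 p.2 ≤ f q.1 q.2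

/-- `x` is (a representative of) the `⊑`-supremum of the finite set `M` of pairs: it is an upper
bound that is an element of `M`, or `⊥` (which is an upper bound only of the empty set). -/
def IsSup (f : Objective) (M : Set (ℕ × ℚ)) (x : Option (ℕ × ℚ)) : Prop :=
  (x = none ∨ ∃ p ∈ M, x = some p) ∧ ∀ q ∈ M, Sqle f (some q) x

/-- `f` is monotone (`up = true`) or antitone (`up = false`) in its second argument. -/
def MonotoneDir (up : Bool) (f : Objective) : Prop :=
  if up then ∀ a, Monotone (f a) else ∀ a, Antitone (f a)

/-- `p` is the representative of the `⊑`-supremum of `M` in which ties between pairs with the same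
first component are broken by the second component: towards the larger one if `f` is monotone
(`up = true`), towards the smaller one if `f` is antitone (`up = false`). -/
def IsTieSup (up : Bool) (f : Objective) (M : Set (ℕ × ℚ)) (p : ℕ × ℚ) : Prop :=
  IsSup f M (some p) ∧
    ∀ q ∈ M, Sqle f (some p) (some q) → q.1 = p.1 → if up then q.2 ≤ p.2 else p.2 ≤ q.2

/-- The pairs `(|S|, α(∂S))` of all sets `S` of vertices with `valid |S|`; their supremum is `Φ`. -/
def feasible {V : Type*} [DecidableEq V] (G : WDigraph V) (valid : ℕ → Bool) : Set (ℕ × ℚ) :=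
  {p | ∃ S : Finset V, valid S.card = true ∧ p = (S.card, G.alpha (G.cut S))}

/-! ## The tables of the dynamic program -/

section Tables

variable {V I : Type*} [Fintype V] [DecidableEq V] {G : WDigraph V}

/-- The pairs whose supremum is `Γ_i(ℓ, S)`: the cuts within `Y_i` given by `S` and `ℓ` further
vertices of `F_i`. -/
def tableSet (D : TreeDecomposition G I) (i : I) (l : ℕ) (S : Finset V) : Set (ℕ × ℚ) :=
  {p | ∃ R ⊆ D.forgotten i, R.card = l ∧
    p = (l + S.card, G.alpha (G.cut (S ∪ R) ∩ (D.vertsBelow i ×ˢ D.vertsBelow i)))}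

/-- All entries `Γ_i(ℓ, S)`, where `0 ≤ ℓ ≤ |F_i|` and `S ⊆ X_i`, are the suprema they have to be. -/
def IsTable (up : Bool) (f : Objective) (D : TreeDecomposition G I)
    (Γ : I → ℕ → Finset V → ℕ × ℚ) : Prop :=
  ∀ i, ∀ l ≤ (D.forgotten i).card, ∀ S ⊆ D.bag i, IsTieSup up f (tableSet D i l S) (Γ i l S)

def LeafRec (D : TreeDecomposition G I) (Γ : I → ℕ → Finset V → ℕ × ℚ) : Prop :=
  ∀ i, D.IsLeaf i →
    Γ i 0 ∅ = (0, 0) ∧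
    (∀ v ∈ D.bag i, Γ i 0 {v} = (1, G.between {v} (D.bag i \ {v}))) ∧
    ∀ S v, S.Nonempty → v ∉ S → insert v S ⊆ D.bag i →
      Γ i 0 (insert v S) =
        Γ i 0 S + (1, G.between {v} (D.bag i \ insert v S) - G.between S {v})

/-- The entry `Γ_j(ℓ, S)` takes part in the supremum only if it exists, that is if `ℓ ≤ |F_j|`. -/
def ForgetRec (up : Bool) (f : Objective) (D : TreeDecomposition G I)
    (Γ : I → ℕ → Finset V → ℕ × ℚ) : Prop :=
  ∀ i j v, D.IsForget i j v → ∀ S ⊆ D.bag i,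
    Γ i 0 S = Γ j 0 S ∧
    ∀ l, 1 ≤ l → l ≤ (D.forgotten i).card →
      IsTieSup up f
        {p | p = Γ j (l - 1) (insert v S) ∨ (l ≤ (D.forgotten j).card ∧ p = Γ j l S)} (Γ i l S)

def IntroduceRec (D : TreeDecomposition G I) (Γ : I → ℕ → Finset V → ℕ × ℚ) : Prop :=
  ∀ i j v, D.IsIntroduce i j v → ∀ S ⊆ D.bag i, ∀ l ≤ (D.forgotten i).card,
    (v ∈ S → Γ i l S = (1, G.between {v} (D.bag i \ S)) + Γ j l (S.erase v)) ∧
    (v ∉ S → Γ i l S = (0, G.between S {v}) + Γ j l S)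

/-- What is subtracted are the vertices of `S` and the cut edges inside the bag, which have been
counted twice. -/
def JoinRec (up : Bool) (f : Objective) (D : TreeDecomposition G I)
    (Γ : I → ℕ → Finset V → ℕ × ℚ) : Prop :=
  ∀ i j k, D.IsJoin i j k → ∀ S ⊆ D.bag i, ∀ l ≤ (D.forgotten i).card,
    ∃ q : ℕ × ℚ,
      IsTieSup up f {p | ∃ l₁ ≤ (D.forgotten j).card, ∃ l₂ ≤ (D.forgotten k).card,
        l₁ + l₂ = l ∧ p = Γ j l₁ S + Γ k l₂ S} q ∧
      q = Γ i l S + (S.card, G.alpha (G.cut S ∩ (D.bag i ×ˢ D.bag i)))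

/-- The recurrences of the dynamic program, for all nodes. -/
def Recurrences (up : Bool) (f : Objective) (D : TreeDecomposition G I)
    (Γ : I → ℕ → Finset V → ℕ × ℚ) : Prop :=
  LeafRec D Γ ∧ ForgetRec up f D Γ ∧ IntroduceRec D Γ ∧ JoinRec up f D Γ

/-- The entries of the table at the root from which `Φ` is obtained. -/
def rootSet (D : TreeDecomposition G I) (valid : ℕ → Bool) (Γ : I → ℕ → Finset V → ℕ × ℚ) :
    Set (ℕ × ℚ) :=
  {p | ∃ S ⊆ D.bag D.tree.root, ∃ l ≤ (D.forgotten D.tree.root).card,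
    valid (l + S.card) = true ∧ p = Γ D.tree.root l S}

end Tables

/-! ## Machine model

A random access machine with unit costs, programmed with `if` and `while`. The memory consists of
arrays of natural numbers and arrays of rational numbers (a program names finitely many of them).
Natural numbers can be added, subtracted (truncated), halved and compared (there is no
multiplication), and used as indices; rational numbers can be added, subtracted and compared. The
objective function and the validator are given as oracles of unit cost. -/

structure Memory where
  nat : ℕ → ℕ → ℕ
  rat : ℕ → ℕ → ℚ

/-- Writing `x` to the cell `i` of the array `a`. -/
def write {α : Type} (M : ℕ → ℕ → α) (a i : ℕ) (x : α) : ℕ → ℕ → α :=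
  Function.update M a (Function.update (M a) i x)

inductive NatExp where
  | const (c : ℕ)
  | read (a : ℕ) (i : NatExp)
  | add (e₁ e₂ : NatExp)
  | sub (e₁ e₂ : NatExp)
  | half (e : NatExp)

def NatExp.eval (s : Memory) : NatExp → ℕ
  | const c => c
  | read a i => s.nat a (i.eval s)
  | add e₁ e₂ => e₁.eval s + e₂.eval s
  | sub e₁ e₂ => e₁.eval s - e₂.eval s
  | half e => e.eval s / 2

def NatExp.cost : NatExp → ℕ
  | const _ => 1
  | read _ i => i.cost + 1
  | add e₁ e₂ => e₁.cost + e₂.cost + 1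
  | sub e₁ e₂ => e₁.cost + e₂.cost + 1
  | half e => e.cost + 1

inductive RatExp where
  | zero
  | read (a : ℕ) (i : NatExp)
  | add (r₁ r₂ : RatExp)
  | sub (r₁ r₂ : RatExp)

def RatExp.eval (s : Memory) : RatExp → ℚ
  | zero => 0
  | read a i => s.rat a (i.eval s)
  | add r₁ r₂ => r₁.eval s + r₂.eval s
  | sub r₁ r₂ => r₁.eval s - r₂.eval s

def RatExp.cost : RatExp → ℕ
  | zero => 1
  | read _ i => i.cost + 1
  | add r₁ r₂ => r₁.cost + r₂.cost + 1
  | sub r₁ r₂ => r₁.cost + r₂.cost + 1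

/-- The functions that are given to a program as oracles. -/
structure Oracles where
  f : Objective
  valid : ℕ → Bool

inductive Test where
  | natLe (e₁ e₂ : NatExp)
  | ratLe (r₁ r₂ : RatExp)
  | objLe (e₁ : NatExp) (r₁ : RatExp) (e₂ : NatExp) (r₂ : RatExp)
  | isValid (e : NatExp)
  | not (b : Test)
  | and (b₁ b₂ : Test)

def Test.holds (O : Oracles) (s : Memory) : Test → Prop
  | natLe e₁ e₂ => e₁.eval s ≤ e₂.eval s
  | ratLe r₁ r₂ => r₁.eval s ≤ r₂.eval s
  | objLe e₁ r₁ e₂ r₂ => O.f (e₁.eval s) (r₁.eval s) ≤ O.f (e₂.eval s) (r₂.eval s)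
  | isValid e => O.valid (e.eval s) = true
  | not b => ¬ b.holds O s
  | and b₁ b₂ => b₁.holds O s ∧ b₂.holds O s

/-- The test `objLe` evaluates the objective function twice and compares the values. -/
def Test.cost : Test → ℕ
  | natLe e₁ e₂ => e₁.cost + e₂.cost + 1
  | ratLe r₁ r₂ => r₁.cost + r₂.cost + 1
  | objLe e₁ r₁ e₂ r₂ => e₁.cost + r₁.cost + e₂.cost + r₂.cost + 3
  | isValid e => e.cost + 1
  | not b => b.cost + 1
  | and b₁ b₂ => b₁.cost + b₂.cost + 1

inductive Program where
  | skip
  | setNat (a : ℕ) (i e : NatExp)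
  | setRat (a : ℕ) (i : NatExp) (r : RatExp)
  | seq (P Q : Program)
  | ite (b : Test) (P Q : Program)
  | while (b : Test) (P : Program)

/-- `Exec O P s s' T`: the program `P`, started with memory `s`, halts after `T` steps with
memory `s'`. -/
inductive Exec (O : Oracles) : Program → Memory → Memory → ℕ → Prop
  | skip (s : Memory) : Exec O .skip s s 1
  | setNat (a : ℕ) (i e : NatExp) (s : Memory) :
      Exec O (.setNat a i e) s { s with nat := write s.nat a (i.eval s) (e.eval s) }
        (i.cost + e.cost + 1)
  | setRat (a : ℕ) (i : NatExp) (r : RatExp) (s : Memory) :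
      Exec O (.setRat a i r) s { s with rat := write s.rat a (i.eval s) (r.eval s) }
        (i.cost + r.cost + 1)
  | seq {P Q : Program} {s s' s'' : Memory} {T T' : ℕ} :
      Exec O P s s' T → Exec O Q s' s'' T' → Exec O (.seq P Q) s s'' (T + T')
  | iteTrue {b : Test} {P Q : Program} {s s' : Memory} {T : ℕ} :
      b.holds O s → Exec O P s s' T → Exec O (.ite b P Q) s s' (b.cost + T + 1)
  | iteFalse {b : Test} {P Q : Program} {s s' : Memory} {T : ℕ} :
      ¬ b.holds O s → Exec O Q s s' T → Exec O (.ite b P Q) s s' (b.cost + T + 1)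
  | whileTrue {b : Test} {P : Program} {s s' s'' : Memory} {T T' : ℕ} :
      b.holds O s → Exec O P s s' T → Exec O (.while b P) s' s'' T' →
        Exec O (.while b P) s s'' (b.cost + T + T' + 1)
  | whileFalse {b : Test} {P : Program} {s : Memory} :
      ¬ b.holds O s → Exec O (.while b P) s s (b.cost + 1)

/-! ## Input and output

Arrays of natural numbers: `0` holds the number of vertices, the number of edges, the number of
nodes, and the root; `1` and `2` hold the tails and the heads of the edges, listed in any order;
`3` holds the parents of the nodes; `4` and `5` hold the sizes of the bags and pointers into the
array `6`, where the vertices of each bag are listed in any order. The array `0` of rational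
numbers holds the weights of the edges. All other memory cells have arbitrary contents. -/

/-- The memory `s` contains the graph and the tree decomposition. -/
structure IsInput {n m : ℕ} {G : WDigraph (Fin n)} (D : TreeDecomposition G (Fin m))
    (s : Memory) : Prop where
  vertices : s.nat 0 0 = n
  numEdges : s.nat 0 1 = G.edges.card
  nodes : s.nat 0 2 = m
  root : s.nat 0 3 = D.tree.root
  edges : ∃ e : Fin G.edges.card ≃ G.edges, ∀ k : Fin G.edges.card,
    s.nat 1 k = (e k).1.1 ∧ s.nat 2 k = (e k).1.2 ∧ s.rat 0 k = G.weight (e k)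
  parent : ∀ j i, D.tree.IsChild j i → s.nat 3 j = i
  bagCard : ∀ i : Fin m, s.nat 4 i = (D.bag i).card
  bags : ∀ i : Fin m, ∃ b : Fin (D.bag i).card ≃ D.bag i, ∀ k : Fin (D.bag i).card,
    s.nat 6 (s.nat 5 i + k) = (b k).1

/-- The output of a run that halts with memory `s`: `⊥` if the cell `0` of the array `7` of natural
numbers is zero, and otherwise the pair of the cell `1` of that array and the cell `0` of the array
`1` of rational numbers. -/
def output (s : Memory) : Option (ℕ × ℚ) :=
  if s.nat 7 0 = 0 then none else some (s.nat 7 1, s.rat 1 0)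

end CutFramework

open CutFramework

/-!
Fix a node `i` with the bag `X` and the set `F` of vertices forgotten below it. The weight of the cut
of `S ∪ R` within `X ∪ F`, where `S ⊆ X` and `R ⊆ F`, is the weight from `S` to `X \ S` plus the
weight `forgottenCut` of those cut edges that have an end in `F`. For pairs with the same number of
vertices, the objective function only decides whether large or small weights are better
(`isTieSup_iff`), so that the entry `Γ_i(l, S)` amounts to the best element of `cutValues`, the set of
the values of `forgottenCut` for all `R ⊆ F` with `l` elements.

These sets change in two ways. If a vertex is moved from the bag to the forgotten ones, it is either
outside of the cut set or one of the `l` chosen vertices (`cutValues_forget`). If two sets of forgotten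
vertices have no edges between them, they contribute independently (`cutValues_union`), and vertices
of the bag that have no edges to the forgotten ones do not matter (`cutValues_restrict`). In a tree
decomposition, there are no such edges because the bags separate the graph
(`mem_bag_parent`, `mem_vertsBelow_of_edge`). The recurrences at the nodes of a nice decomposition
are instances of these identities, and every recurrence determines the entries at its node, so that
an induction from the leaves shows that they characterize the tables (`isTable_iff_recurrences`). At
the root, every set of vertices is `S ∪ R` for some `S` and `R`
(`isSup_feasible_of_isSup_rootSet`).

The program adds a node with an empty bag above the root, and starts with the tables in which no
vertex has been forgotten. In the order of decreasing depth, every node then forgets the vertices of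
its bag that are not in the bag of its parent (`runs_forgetVertex`), and its table is merged into
that of the parent (`runs_mergeTables`). In the end, the table of the additional node has one entry
for each number of vertices. Whether the objective function is monotone or antitone is not part of
the input, but the largest and the smallest weights for each number of vertices contain a
representative of `Φ` in either case (`IsSup.feasible_of_candidates`), so the program computes both.

Let `K = 2 ^ (t + 1)` for the width `t`. Since there is no multiplication, tables are addressed by
binary numbers whose digits are the elements of `S`, scaled by `n + 1`. All subsets of a bag, with
their addresses and the weights of their edges at the vertex to be forgotten, are listed by repeated
doubling in `O(n K)` steps (`runs_listSubsets`). Forgetting a vertex takes `O(n K)` steps, and this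
happens `n` times. Merging a table with `b` forgotten vertices into one with `a` of them takes
`O(K (n + (a + 1) (b + 1)))` steps. Each pair of vertices is counted in a product `a b` only once,
namely at the node where both are forgotten for the first time, and there are `O(n)` nodes; the
potential `∑ a ^ 2`, with linear terms for the rest, turns this into the bound `O(K n ^ 2)`
(`ElimTree.potential_insert`).
-/

namespace CutFramework

/-! ### Rooted trees -/

namespace RootedTree

variable {I : Type*} (T : RootedTree I)

lemma isChild_or_isChild {a b : I} (h : T.graph.Adj a b) : T.IsChild a b ∨ T.IsChild b a := by
  rcases T.isTree.dist_eq_dist_add_one_of_adj T.root h with h' | h'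
  · exact Or.inl ⟨h.symm, h'⟩
  · exact Or.inr ⟨h, h'⟩

variable {T}

lemma IsChild.parent_unique {a b b' : I} (h : T.IsChild a b) (h' : T.IsChild a b') : b = b' := by
  obtain ⟨p, hp⟩ := T.isTree.connected.exists_walk_length_eq_dist T.root b
  obtain ⟨q, hq⟩ := T.isTree.connected.exists_walk_length_eq_dist T.root b'
  have hp' : (p.concat h.1).IsPath := SimpleGraph.Walk.isPath_of_length_eq_dist _ (by
    rw [SimpleGraph.Walk.length_concat, hp, h.2])
  have hq' : (q.concat h'.1).IsPath := SimpleGraph.Walk.isPath_of_length_eq_dist _ (by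
    rw [SimpleGraph.Walk.length_concat, hq, h'.2])
  have := congrArg Subtype.val
    ((T.isTree.isAcyclic.subsingleton_path _ _).elim ⟨_, hp'⟩ ⟨_, hq'⟩)
  exact (SimpleGraph.Walk.concat_inj this).1

lemma Below.dist_le {k i : I} (h : T.Below k i) :
    T.graph.dist T.root i ≤ T.graph.dist T.root k := by
  induction h with
  | refl => exact le_rfl
  | tail _ h ih => exact le_trans (by have := h.2; omega) ih

lemma IsChild.not_below {j i : I} (h : T.IsChild j i) : ¬ T.Below i j := fun h' => by
  have := h'.dist_le
  have := h.2
  omega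

lemma exists_isChild {j : I} (h : j ≠ T.root) : ∃ i, T.IsChild j i := by
  obtain ⟨p, hp⟩ := T.isTree.connected.exists_walk_length_eq_dist j T.root
  cases p with
  | nil => exact absurd rfl h
  | @cons _ b _ hadj q =>
    refine ⟨b, (T.isChild_or_isChild hadj).resolve_right fun hc => ?_⟩
    have h1 := SimpleGraph.dist_le q
    have h2 := hc.2
    rw [SimpleGraph.dist_comm (u := T.root) (v := b),
      SimpleGraph.dist_comm (u := T.root) (v := j)] at h2
    rw [SimpleGraph.Walk.length_cons] at hp
    omega

lemma below_root (k : I) : T.Below k T.root := by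
  induction hd : T.graph.dist T.root k generalizing k with
  | zero =>
    rw [T.isTree.connected.dist_eq_zero_iff] at hd
    rw [hd]; exact .refl
  | succ d ih =>
    obtain ⟨i, hi⟩ := T.exists_isChild (j := k) (by rintro rfl; simp at hd)
    exact .head hi (ih i (by have := hi.2; omega))

lemma eq_of_below_of_below {i j j' k : I} (hj : T.IsChild j i) (hj' : T.IsChild j' i)
    (h : T.Below k j) (h' : T.Below k j') : j = j' := by
  have key : ∀ {a b}, T.IsChild a i → T.IsChild b i → T.Below a b → a = b := by
    intro a b ha hb hab
    rcases Relation.ReflTransGen.cases_head hab with h | ⟨c, hc, hcb⟩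
    · exact h
    · rw [hc.parent_unique ha] at hcb
      exact absurd hcb hb.not_below
  have hu : Relator.RightUnique T.IsChild := fun _ _ _ h₁ h₂ => h₁.parent_unique h₂
  rcases Relation.ReflTransGen.total_of_right_unique hu h h' with h | h
  · exact key hj hj' h
  · exact (key hj' hj h).symm

/-- The edge from a node to its parent is the only one that leaves the subtree below it. -/
lemma eq_of_adj_of_below_of_not_below {i j a b : I} (hj : T.IsChild j i) (hab : T.graph.Adj a b)
    (ha : T.Below a j) (hb : ¬ T.Below b j) : a = j ∧ b = i := by
  rcases T.isChild_or_isChild hab with h | h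
  · rcases Relation.ReflTransGen.cases_head ha with rfl | ⟨c, hc, hcj⟩
    · exact ⟨rfl, h.parent_unique hj⟩
    · exact absurd (h.parent_unique hc ▸ hcj) hb
  · exact absurd (.head h ha) hb

lemma dist_root_lt [Fintype I] (k : I) : T.graph.dist T.root k < Fintype.card I := by
  obtain ⟨p, hp, hl⟩ := T.isTree.connected.exists_path_of_dist T.root k
  exact hl ▸ hp.length_lt

end RootedTree

/-! ### Separators in tree decompositions -/

namespace TreeDecomposition

variable {V I : Type*} {G : WDigraph V} {D : TreeDecomposition G I}

lemma mem_bag_of_mem_bag {i j k k' : I} {v : V} (hj : D.tree.IsChild j i)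
    (hk : D.tree.Below k j) (hk' : ¬ D.tree.Below k' j) (hv : v ∈ D.bag k) (hv' : v ∈ D.bag k') :
    v ∈ D.bag j ∧ v ∈ D.bag i := by
  obtain ⟨p⟩ := (D.coherence v).preconnected ⟨k, hv⟩ ⟨k', hv'⟩
  obtain ⟨d, -, h1, h2⟩ := p.exists_boundary_dart {x | D.tree.Below x.1 j} hk hk'
  obtain ⟨e1, e2⟩ := RootedTree.eq_of_adj_of_below_of_not_below hj d.adj h1 h2
  exact ⟨e1 ▸ d.fst.2, e2 ▸ d.snd.2⟩

variable [Fintype V]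

lemma mem_vertsBelow {i : I} {v : V} :
    v ∈ D.vertsBelow i ↔ ∃ k, D.tree.Below k i ∧ v ∈ D.bag k := by
  simp [vertsBelow]

lemma bag_subset_vertsBelow (i : I) : D.bag i ⊆ D.vertsBelow i := fun _ hv =>
  mem_vertsBelow.2 ⟨i, .refl, hv⟩

lemma vertsBelow_subset {j i : I} (h : D.tree.IsChild j i) : D.vertsBelow j ⊆ D.vertsBelow i := by
  intro v hv
  obtain ⟨k, hk, hv⟩ := mem_vertsBelow.1 hv
  exact mem_vertsBelow.2 ⟨k, hk.tail h, hv⟩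

lemma mem_vertsBelow_iff {i : I} {v : V} :
    v ∈ D.vertsBelow i ↔ v ∈ D.bag i ∨ ∃ j, D.tree.IsChild j i ∧ v ∈ D.vertsBelow j := by
  constructor
  · intro h
    obtain ⟨k, hk, hv⟩ := mem_vertsBelow.1 h
    rcases Relation.ReflTransGen.cases_tail hk with rfl | ⟨j, hkj, hj⟩
    · exact Or.inl hv
    · exact Or.inr ⟨j, hj, mem_vertsBelow.2 ⟨k, hkj, hv⟩⟩
  · rintro (h | ⟨j, hj, h⟩)
    · exact D.bag_subset_vertsBelow i h
    · exact vertsBelow_subset hj h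

lemma vertsBelow_root : D.vertsBelow D.tree.root = Finset.univ := by
  ext v
  obtain ⟨k, hk⟩ := D.node_coverage v
  simpa using mem_vertsBelow.2 ⟨k, RootedTree.below_root k, hk⟩

lemma mem_bag_child {i j : I} {v : V} (hj : D.tree.IsChild j i) (hv : v ∈ D.vertsBelow j)
    (hv' : v ∈ D.bag i) : v ∈ D.bag j := by
  obtain ⟨k, hk, hv⟩ := mem_vertsBelow.1 hv
  exact (mem_bag_of_mem_bag hj hk hj.not_below hv hv').1

lemma mem_bag_parent {i j j' : I} {v : V} (hj : D.tree.IsChild j i) (hj' : D.tree.IsChild j' i)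
    (hne : j ≠ j') (hv : v ∈ D.vertsBelow j) (hv' : v ∈ D.vertsBelow j') : v ∈ D.bag i := by
  obtain ⟨k, hk, hv⟩ := mem_vertsBelow.1 hv
  obtain ⟨k', hk', hv'⟩ := mem_vertsBelow.1 hv'
  exact (mem_bag_of_mem_bag hj hk
    (fun h => hne (RootedTree.eq_of_below_of_below hj hj' h hk')) hv hv').2

/-- The neighbours of a vertex that has been forgotten between `j` and its parent lie below `j`. -/
lemma mem_vertsBelow_of_edge {i j : I} {u w : V} (hj : D.tree.IsChild j i)
    (hu : u ∈ D.vertsBelow j) (hu' : u ∉ D.bag i) (h : (u, w) ∈ G.edges ∨ (w, u) ∈ G.edges) :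
    w ∈ D.vertsBelow j := by
  obtain ⟨k, hk, hv⟩ := mem_vertsBelow.1 hu
  obtain ⟨l, hul, hwl⟩ : ∃ l, u ∈ D.bag l ∧ w ∈ D.bag l := by
    rcases h with h | h
    · exact D.edge_coverage _ h
    · obtain ⟨l, h1, h2⟩ := D.edge_coverage _ h
      exact ⟨l, h2, h1⟩
  refine mem_vertsBelow.2 ⟨l, ?_, hwl⟩
  by_contra hl
  exact hu' (mem_bag_of_mem_bag hj hk hl hv hul).2

end TreeDecomposition

/-! ### Weights between sets of vertices -/

section Between

variable {V : Type*} [DecidableEq V] (G : WDigraph V)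

/-- The entry `(u, v)` of the weighted adjacency matrix of `G`. -/
def WDigraph.arc (u v : V) : ℚ := if (u, v) ∈ G.edges then G.weight (u, v) else 0

lemma WDigraph.between_eq_sum (A B : Finset V) :
    G.between A B = ∑ u ∈ A, ∑ v ∈ B, G.arc u v := by
  rw [← Finset.sum_product' A B (fun u v => G.arc u v), WDigraph.between, WDigraph.alpha,
    Finset.inter_comm, ← Finset.filter_mem_eq_inter, Finset.sum_filter]
  rfl

@[simp] lemma WDigraph.between_empty_left (B : Finset V) : G.between ∅ B = 0 := by
  simp [WDigraph.between_eq_sum]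

@[simp] lemma WDigraph.between_empty_right (A : Finset V) : G.between A ∅ = 0 := by
  simp [WDigraph.between_eq_sum]

variable {G}

lemma WDigraph.between_union_left {A B : Finset V} (C : Finset V) (h : Disjoint A B) :
    G.between (A ∪ B) C = G.between A C + G.between B C := by
  simp only [WDigraph.between_eq_sum, Finset.sum_union h]

lemma WDigraph.between_union_right {A B : Finset V} (C : Finset V) (h : Disjoint A B) :
    G.between C (A ∪ B) = G.between C A + G.between C B := by
  simp only [WDigraph.between_eq_sum, Finset.sum_union h, Finset.sum_add_distrib]

lemma WDigraph.between_insert_left {v : V} {A : Finset V} (C : Finset V) (h : v ∉ A) :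
    G.between (insert v A) C = G.between {v} C + G.between A C := by
  simp only [WDigraph.between_eq_sum, Finset.sum_insert h, Finset.sum_singleton]

lemma WDigraph.between_insert_right {v : V} {A : Finset V} (C : Finset V) (h : v ∉ A) :
    G.between C (insert v A) = G.between C {v} + G.between C A := by
  simp only [WDigraph.between_eq_sum, Finset.sum_insert h, Finset.sum_singleton,
    Finset.sum_add_distrib]

lemma WDigraph.between_eq_zero {A B : Finset V} (h : ∀ u ∈ A, ∀ v ∈ B, (u, v) ∉ G.edges) :
    G.between A B = 0 := by
  rw [WDigraph.between_eq_sum]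
  refine Finset.sum_eq_zero fun u hu => Finset.sum_eq_zero fun v hv => ?_
  rw [WDigraph.arc, if_neg (h u hu v hv)]

lemma WDigraph.alpha_cut_inter (S Y : Finset V) (h : S ⊆ Y) :
    G.alpha (G.cut S ∩ (Y ×ˢ Y)) = G.between S (Y \ S) := by
  unfold WDigraph.between
  congr 1
  ext ⟨a, b⟩
  simp only [WDigraph.cut, Finset.mem_inter, Finset.mem_filter, Finset.mem_product,
    Finset.mem_sdiff]
  constructor
  · rintro ⟨⟨h1, h2, h3⟩, h4, h5⟩; exact ⟨h1, h2, h5, h3⟩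
  · rintro ⟨h1, h2, h5, h3⟩; exact ⟨⟨h1, h2, h3⟩, h h2, h5⟩

end Between

/-! ### Optimal values -/

/-- The order on the second components of pairs in which larger means better: the usual order if
the objective function is monotone (`up = true`) and its dual if it is antitone. -/
def DirLe (up : Bool) (x y : ℚ) : Prop := if up then x ≤ y else y ≤ x

section DirLe

variable {up : Bool} {x y z : ℚ}

lemma DirLe.refl (up : Bool) (x : ℚ) : DirLe up x x := by cases up <;> simp [DirLe]

lemma DirLe.trans (h : DirLe up x y) (h' : DirLe up y z) : DirLe up x z := by
  cases up <;> simp only [DirLe, if_true, Bool.false_eq_true, if_false] at * <;> linarith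

lemma DirLe.antisymm (h : DirLe up x y) (h' : DirLe up y x) : x = y := by
  cases up <;> simp only [DirLe, if_true, Bool.false_eq_true, if_false] at * <;> linarith

lemma DirLe.total (up : Bool) (x y : ℚ) : DirLe up x y ∨ DirLe up y x := by
  cases up <;> simp only [DirLe, if_true, Bool.false_eq_true, if_false]
  · exact le_total y x
  · exact le_total x y

lemma DirLe.add {x' y' : ℚ} (h : DirLe up x y) (h' : DirLe up x' y') :
    DirLe up (x + x') (y + y') := by
  cases up <;> simp only [DirLe, if_true, Bool.false_eq_true, if_false] at * <;> linarith

end DirLe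

/-- `x` is the best element of the set `M` of values. -/
def IsBest (up : Bool) (M : Set ℚ) (x : ℚ) : Prop := x ∈ M ∧ ∀ y ∈ M, DirLe up y x

section IsBest

variable {up : Bool} {M N : Set ℚ} {x y : ℚ}

lemma IsBest.unique (h : IsBest up M x) (h' : IsBest up M y) : x = y :=
  (h'.2 x h.1).antisymm (h.2 y h'.1)

lemma exists_isBest (up : Bool) (hM : M.Finite) (hne : M.Nonempty) : ∃ x, IsBest up M x := by
  cases up
  · obtain ⟨x, hx, h⟩ := hM.exists_minimalFor id M hne
    exact ⟨x, hx, fun y hy => by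
      rcases DirLe.total false y x with h' | h'
      · exact h'
      · simpa [DirLe] using h hy (by simpa [DirLe] using h')⟩
  · obtain ⟨x, hx, h⟩ := hM.exists_maximalFor id M hne
    exact ⟨x, hx, fun y hy => by
      rcases DirLe.total true y x with h' | h'
      · exact h'
      · simpa [DirLe] using h hy (by simpa [DirLe] using h')⟩

/-- The best element only depends on a cofinal subset. -/
lemma isBest_iff_of_cofinal (hNM : N ⊆ M) (h : ∀ a ∈ M, ∃ b ∈ N, DirLe up a b) :
    IsBest up M x ↔ IsBest up N x := by
  constructor
  · rintro ⟨hx, hx'⟩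
    obtain ⟨b, hb, hab⟩ := h x hx
    obtain rfl := hab.antisymm (hx' b (hNM hb))
    exact ⟨hb, fun y hy => hx' y (hNM hy)⟩
  · rintro ⟨hx, hx'⟩
    refine ⟨hNM hx, fun y hy => ?_⟩
    obtain ⟨b, hb, hab⟩ := h y hy
    exact hab.trans (hx' b hb)

lemma isBest_singleton : IsBest up {x} y ↔ y = x := by
  refine ⟨fun h => h.1, ?_⟩
  rintro rfl
  exact ⟨rfl, by rintro z rfl; exact .refl _ _⟩

lemma IsBest.image_add (h : IsBest up M x) (c : ℚ) : IsBest up ((· + c) '' M) (x + c) :=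
  ⟨⟨x, h.1, rfl⟩, by rintro _ ⟨y, hy, rfl⟩; exact (h.2 y hy).add (.refl _ _)⟩

lemma isBest_image_add_iff {c : ℚ} : IsBest up ((· + c) '' M) x ↔ IsBest up M (x - c) := by
  constructor
  · intro h
    have := h.image_add (-c)
    rw [Set.image_image] at this
    simpa [sub_eq_add_neg] using this
  · intro h
    simpa using h.image_add c

end IsBest

/-! ### The cuts counted by a table -/

section CutValues

variable {V : Type*} [DecidableEq V] (G : WDigraph V)

/-- For a bag `X` and a set `F` of forgotten vertices, the weight of those edges of the cut of
`S ∪ R` within `X ∪ F` that have an end in `F`; here `S ⊆ X` and `R ⊆ F`. -/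
def forgottenCut (X F S R : Finset V) : ℚ :=
  G.between R (F \ R) + G.between R (X \ S) + G.between S (F \ R)

/-- The values of `forgottenCut` for all sets of `l` forgotten vertices. -/
def cutValues (X F : Finset V) (l : ℕ) (S : Finset V) : Set ℚ :=
  {x | ∃ R ⊆ F, R.card = l ∧ x = forgottenCut G X F S R}

variable {G}

lemma exists_isBest_cutValues (up : Bool) {X F S : Finset V} {l : ℕ} (hl : l ≤ F.card) :
    ∃ x, IsBest up (cutValues G X F l S) x := by
  apply exists_isBest
  · refine (F.powerset.image (forgottenCut G X F S)).finite_toSet.subset ?_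
    rintro x ⟨R, hR, -, rfl⟩
    exact Finset.mem_coe.2 (Finset.mem_image_of_mem _ (Finset.mem_powerset.2 hR))
  · obtain ⟨R, hR, hc⟩ := Finset.exists_subset_card_eq hl
    exact ⟨_, R, hR, hc, rfl⟩

lemma card_le_of_mem_cutValues {X F S : Finset V} {l : ℕ} {x : ℚ} (h : x ∈ cutValues G X F l S) :
    l ≤ F.card := by
  obtain ⟨R, hR, rfl, -⟩ := h
  exact Finset.card_le_card hR

lemma cutValues_empty (X S : Finset V) : cutValues G X ∅ 0 S = {0} := by
  ext x
  simp [cutValues, forgottenCut, Finset.subset_empty]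

/-- The cut within `X ∪ F` is made up of the part within the bag and `forgottenCut`. -/
lemma between_union_sdiff {X F S R : Finset V} (hXF : Disjoint X F) (hS : S ⊆ X) (hR : R ⊆ F) :
    G.between (S ∪ R) ((X ∪ F) \ (S ∪ R)) = forgottenCut G X F S R + G.between S (X \ S) := by
  have hSR : Disjoint S R := hXF.mono hS hR
  have h1 : (X ∪ F) \ (S ∪ R) = (X \ S) ∪ (F \ R) := by
    ext w
    have : w ∈ X → w ∉ F := fun hw => Finset.disjoint_left.1 hXF hw
    have : w ∈ S → w ∈ X := fun hw => hS hw
    have : w ∈ R → w ∈ F := fun hw => hR hw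
    simp only [Finset.mem_sdiff, Finset.mem_union]
    tauto
  have h2 : Disjoint (X \ S) (F \ R) := hXF.mono Finset.sdiff_subset Finset.sdiff_subset
  rw [h1, WDigraph.between_union_left _ hSR, WDigraph.between_union_right _ h2,
    WDigraph.between_union_right _ h2, forgottenCut]
  ring

/-- Forgetting a vertex `v` outside of the cut set. -/
lemma forgottenCut_forget_of_notMem {X F S R : Finset V} {v : V} (hvX : v ∈ X) (hvF : v ∉ F)
    (hvS : v ∉ S) (hR : R ⊆ F) :
    forgottenCut G (X.erase v) (insert v F) S R = forgottenCut G X F S R + G.between S {v} := by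
  have hvR : v ∉ R := fun h => hvF (hR h)
  have h1 : insert v F \ R = insert v (F \ R) := Finset.insert_sdiff_of_notMem _ hvR
  have h2 : X \ S = insert v (X.erase v \ S) := by
    rw [← Finset.insert_sdiff_of_notMem _ hvS, Finset.insert_erase hvX]
  simp only [forgottenCut]
  rw [h1, h2, WDigraph.between_insert_right _ (by simp [hvF]),
    WDigraph.between_insert_right _ (by simp [hvF]), WDigraph.between_insert_right _ (by simp)]
  ring

/-- Forgetting a vertex `v` of the cut set. -/
lemma forgottenCut_forget_of_mem {X F S R : Finset V} {v : V} (hvF : v ∉ F)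
    (hvS : v ∉ S) (hR : R ⊆ F) :
    forgottenCut G (X.erase v) (insert v F) S (insert v R) =
      forgottenCut G X F (insert v S) R + G.between {v} (X.erase v \ S) := by
  have hvR : v ∉ R := fun h => hvF (hR h)
  have h1 : insert v F \ insert v R = F \ R := by
    ext w
    by_cases h : w = v
    · simp [h, hvF]
    · simp [h]
  have h2 : X \ insert v S = X.erase v \ S := by
    ext w; simp only [Finset.mem_sdiff, Finset.mem_insert, Finset.mem_erase]; tauto
  simp only [forgottenCut]
  rw [h1, h2, WDigraph.between_insert_left _ hvR, WDigraph.between_insert_left _ hvR,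
    WDigraph.between_insert_left _ hvS]
  ring

/-- The values after forgetting `v`: either `v` is outside of the cut set or it is one of the `l`
forgotten vertices in it. -/
lemma cutValues_forget {X F S : Finset V} {v : V} (hvX : v ∈ X) (hvF : v ∉ F) (hvS : v ∉ S)
    (l : ℕ) :
    cutValues G (X.erase v) (insert v F) l S =
      (· + G.between S {v}) '' cutValues G X F l S ∪
        {x | ∃ k, l = k + 1 ∧
          x ∈ (· + G.between {v} (X.erase v \ S)) '' cutValues G X F k (insert v S)} := by
  ext x
  constructor
  · rintro ⟨R, hR, hc, rfl⟩
    by_cases hv : v ∈ R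
    · right
      have hR' : R.erase v ⊆ F := by
        intro w hw
        have h1 := hR (Finset.mem_of_mem_erase hw)
        exact (Finset.mem_insert.1 h1).resolve_left (Finset.ne_of_mem_erase hw)
      refine ⟨(R.erase v).card, ?_, _, ⟨R.erase v, hR', rfl, rfl⟩, ?_⟩
      · rw [← hc, Finset.card_erase_add_one hv]
      · conv_rhs => rw [← Finset.insert_erase hv]
        exact (forgottenCut_forget_of_mem hvF hvS hR').symm
    · left
      have hR' : R ⊆ F := (Finset.subset_insert_iff_of_notMem hv).1 hR
      exact ⟨_, ⟨R, hR', hc, rfl⟩, (forgottenCut_forget_of_notMem hvX hvF hvS hR').symm⟩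
  · rintro (⟨_, ⟨R, hR, hc, rfl⟩, rfl⟩ | ⟨k, rfl, _, ⟨R, hR, hc, rfl⟩, rfl⟩)
    · exact ⟨R, hR.trans (Finset.subset_insert _ _), hc,
        (forgottenCut_forget_of_notMem hvX hvF hvS hR).symm⟩
    · refine ⟨insert v R, Finset.insert_subset_insert _ hR, ?_,
        (forgottenCut_forget_of_mem hvF hvS hR).symm⟩
      rw [Finset.card_insert_of_notMem (fun h => hvF (hR h)), hc]

/-- Vertices of the bag without edges to or from the forgotten ones do not matter. -/
lemma forgottenCut_restrict {X X' F S R : Finset V} (hX : X' ⊆ X) (hS : S ⊆ X)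
    (hR : R ⊆ F)
    (h : ∀ u ∈ F, ∀ w ∈ X \ X', (u, w) ∉ G.edges ∧ (w, u) ∉ G.edges) :
    forgottenCut G X F S R = forgottenCut G X' F (S ∩ X') R := by
  have e1 : X \ S = (X' \ (S ∩ X')) ∪ ((X \ X') \ S) := by
    ext w
    have : w ∈ X' → w ∈ X := fun hw => hX hw
    simp only [Finset.mem_sdiff, Finset.mem_union, Finset.mem_inter]
    tauto
  have d1 : Disjoint (X' \ (S ∩ X')) ((X \ X') \ S) := by
    rw [Finset.disjoint_left]; intro w; simp only [Finset.mem_sdiff, Finset.mem_inter]; tauto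
  have z1 : G.between R ((X \ X') \ S) = 0 := WDigraph.between_eq_zero fun u hu w hw =>
    (h u (hR hu) w (Finset.sdiff_subset hw)).1
  have d2 : Disjoint (S ∩ X') (S \ X') := by
    rw [Finset.disjoint_left]; intro w; simp only [Finset.mem_sdiff, Finset.mem_inter]; tauto
  have z2 : G.between (S \ X') (F \ R) = 0 := WDigraph.between_eq_zero fun u hu w hw =>
    (h w (Finset.sdiff_subset hw) u
      (Finset.mem_sdiff.2 ⟨hS (Finset.mem_sdiff.1 hu).1, (Finset.mem_sdiff.1 hu).2⟩)).2
  have e2 : G.between S (F \ R) = G.between (S ∩ X') (F \ R) := by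
    conv_lhs => rw [← Finset.sdiff_union_inter S X', Finset.union_comm]
    rw [WDigraph.between_union_left _ d2, z2, add_zero]
  rw [forgottenCut, forgottenCut, e1, WDigraph.between_union_right _ d1, z1, add_zero, e2]

lemma cutValues_restrict {X X' F S : Finset V} (hX : X' ⊆ X) (hS : S ⊆ X)
    (h : ∀ u ∈ F, ∀ w ∈ X \ X', (u, w) ∉ G.edges ∧ (w, u) ∉ G.edges) (l : ℕ) :
    cutValues G X F l S = cutValues G X' F l (S ∩ X') := by
  ext x
  constructor
  · rintro ⟨R, hR, hc, rfl⟩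
    exact ⟨R, hR, hc, forgottenCut_restrict hX hS hR h⟩
  · rintro ⟨R, hR, hc, rfl⟩
    exact ⟨R, hR, hc, (forgottenCut_restrict hX hS hR h).symm⟩

lemma forgottenCut_union {X F F' S R R' : Finset V} (hd : Disjoint F F') (hR : R ⊆ F)
    (hR' : R' ⊆ F') (h : ∀ u ∈ F, ∀ w ∈ F', (u, w) ∉ G.edges ∧ (w, u) ∉ G.edges) :
    forgottenCut G X (F ∪ F') S (R ∪ R') =
      forgottenCut G X F S R + forgottenCut G X F' S R' := by
  have e : (F ∪ F') \ (R ∪ R') = (F \ R) ∪ (F' \ R') := by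
    ext w
    have : w ∈ F → w ∉ F' := fun hw => Finset.disjoint_left.1 hd hw
    have : w ∈ R → w ∈ F := fun hw => hR hw
    have : w ∈ R' → w ∈ F' := fun hw => hR' hw
    simp only [Finset.mem_sdiff, Finset.mem_union]
    tauto
  have d : Disjoint (F \ R) (F' \ R') := hd.mono Finset.sdiff_subset Finset.sdiff_subset
  have dR : Disjoint R R' := hd.mono hR hR'
  have z1 : G.between R (F' \ R') = 0 := WDigraph.between_eq_zero fun u hu w hw =>
    (h u (hR hu) w (Finset.sdiff_subset hw)).1
  have z2 : G.between R' (F \ R) = 0 := WDigraph.between_eq_zero fun u hu w hw =>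
    (h w (Finset.sdiff_subset hw) u (hR' hu)).2
  simp only [forgottenCut]
  rw [e, WDigraph.between_union_left _ dR, WDigraph.between_union_left _ dR,
    WDigraph.between_union_right _ d, WDigraph.between_union_right _ d,
    WDigraph.between_union_right _ d, z1, z2]
  ring

/-- Sets of forgotten vertices without edges between them contribute independently. -/
lemma cutValues_union {X F F' S : Finset V} (hd : Disjoint F F')
    (h : ∀ u ∈ F, ∀ w ∈ F', (u, w) ∉ G.edges ∧ (w, u) ∉ G.edges) (l : ℕ) :
    cutValues G X (F ∪ F') l S =
      {z | ∃ l₁ l₂, l₁ + l₂ = l ∧ ∃ x ∈ cutValues G X F l₁ S, ∃ y ∈ cutValues G X F' l₂ S,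
        z = x + y} := by
  ext z
  constructor
  · rintro ⟨R, hR, hc, rfl⟩
    have e : R ∩ F ∪ R ∩ F' = R := by
      rw [← Finset.inter_union_distrib_left, Finset.inter_eq_left.2 hR]
    have d : Disjoint (R ∩ F) (R ∩ F') :=
      hd.mono Finset.inter_subset_right Finset.inter_subset_right
    refine ⟨(R ∩ F).card, (R ∩ F').card, ?_, _, ⟨R ∩ F, Finset.inter_subset_right, rfl, rfl⟩,
      _, ⟨R ∩ F', Finset.inter_subset_right, rfl, rfl⟩, ?_⟩
    · rw [← Finset.card_union_of_disjoint d, e, hc]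
    · rw [← forgottenCut_union hd Finset.inter_subset_right Finset.inter_subset_right h, e]
  · rintro ⟨l₁, l₂, rfl, _, ⟨R, hR, rfl, rfl⟩, _, ⟨R', hR', rfl, rfl⟩, rfl⟩
    exact ⟨R ∪ R', Finset.union_subset_union hR hR',
      Finset.card_union_of_disjoint (hd.mono hR hR'), (forgottenCut_union hd hR hR' h).symm⟩

/-- The best values after forgetting `v` are obtained from the best values before. -/
lemma isBest_cutValues_forget {up : Bool} {X F S : Finset V} {v : V} {l : ℕ} {z : ℚ}
    (hvX : v ∈ X) (hvF : v ∉ F) (hvS : v ∉ S) {x y : ℕ → ℚ}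
    (hx : ∀ l ≤ F.card, IsBest up (cutValues G X F l S) (x l))
    (hy : ∀ l ≤ F.card, IsBest up (cutValues G X F l (insert v S)) (y l)) :
    IsBest up (cutValues G (X.erase v) (insert v F) l S) z ↔
      IsBest up {a | (l ≤ F.card ∧ a = x l + G.between S {v}) ∨
        ∃ k ≤ F.card, l = k + 1 ∧ a = y k + G.between {v} (X.erase v \ S)} z := by
  rw [cutValues_forget hvX hvF hvS]
  apply isBest_iff_of_cofinal
  · rintro a (⟨hl, rfl⟩ | ⟨k, hk, rfl, rfl⟩)
    · exact Or.inl ⟨_, (hx l hl).1, rfl⟩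
    · exact Or.inr ⟨k, rfl, _, (hy k hk).1, rfl⟩
  · rintro a (⟨b, hb, rfl⟩ | ⟨k, rfl, b, hb, rfl⟩)
    · have hl := card_le_of_mem_cutValues hb
      exact ⟨_, Or.inl ⟨hl, rfl⟩, ((hx l hl).2 b hb).add (.refl _ _)⟩
    · have hl := card_le_of_mem_cutValues hb
      exact ⟨_, Or.inr ⟨k, hl, rfl, rfl⟩, ((hy k hl).2 b hb).add (.refl _ _)⟩

/-- The best values for two independent sets of forgotten vertices are obtained from the best values
for each of them. -/
lemma isBest_cutValues_union {up : Bool} {X F F' S : Finset V} {l : ℕ} {z : ℚ}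
    (hd : Disjoint F F')
    (h : ∀ u ∈ F, ∀ w ∈ F', (u, w) ∉ G.edges ∧ (w, u) ∉ G.edges) {x y : ℕ → ℚ}
    (hx : ∀ l ≤ F.card, IsBest up (cutValues G X F l S) (x l))
    (hy : ∀ l ≤ F'.card, IsBest up (cutValues G X F' l S) (y l)) :
    IsBest up (cutValues G X (F ∪ F') l S) z ↔
      IsBest up {a | ∃ l₁ ≤ F.card, ∃ l₂ ≤ F'.card, l₁ + l₂ = l ∧ a = x l₁ + y l₂} z := by
  rw [cutValues_union hd h]
  apply isBest_iff_of_cofinal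
  · rintro a ⟨l₁, h₁, l₂, h₂, rfl, rfl⟩
    exact ⟨l₁, l₂, rfl, _, (hx _ h₁).1, _, (hy _ h₂).1, rfl⟩
  · rintro a ⟨l₁, l₂, rfl, b, hb, c, hc, rfl⟩
    have h₁ := card_le_of_mem_cutValues hb
    have h₂ := card_le_of_mem_cutValues hc
    exact ⟨_, ⟨l₁, h₁, l₂, h₂, rfl, rfl⟩, ((hx _ h₁).2 b hb).add ((hy _ h₂).2 c hc)⟩

end CutValues

/-! ### The recurrences characterize the tables -/

/-- For pairs with the same first component, the objective function only decides in which direction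
the second components are compared. -/
lemma isTieSup_iff {up : Bool} {f : Objective} (hf : MonotoneDir up f) {M : Set (ℕ × ℚ)} {c : ℕ}
    (hM : ∀ q ∈ M, q.1 = c) (p : ℕ × ℚ) :
    IsTieSup up f M p ↔ p.1 = c ∧ IsBest up (Prod.snd '' M) p.2 := by
  have hmono : ∀ a x y, DirLe up x y → f a x ≤ f a y := by
    intro a x y h
    cases up <;> simp only [DirLe, MonotoneDir, if_true, Bool.false_eq_true, if_false] at *
    · exact hf a h
    · exact hf a h
  constructor
  · rintro ⟨⟨h1, h2⟩, h3⟩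
    have hp : p ∈ M := by
      rcases h1 with h1 | ⟨q, hq, h⟩
      · cases h1
      · cases h; exact hq
    refine ⟨hM p hp, ⟨p, hp, rfl⟩, ?_⟩
    rintro _ ⟨q, hq, rfl⟩
    rcases DirLe.total up q.2 p.2 with h | h
    · exact h
    · have e : q.1 = p.1 := (hM q hq).trans (hM p hp).symm
      exact h3 q hq (Or.inr ⟨p, q, rfl, rfl, by rw [e]; exact hmono _ _ _ h⟩) e
  · rintro ⟨h1, ⟨q, hq, h2⟩, h3⟩
    have e : q = p := Prod.ext ((hM q hq).trans h1.symm) h2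
    subst e
    refine ⟨⟨Or.inr ⟨q, hq, rfl⟩, fun r hr => ?_⟩, fun r hr _ _ => h3 _ ⟨r, hr, rfl⟩⟩
    exact Or.inr ⟨r, q, rfl, rfl, by rw [hM r hr, ← h1]; exact hmono _ _ _ (h3 _ ⟨r, hr, rfl⟩)⟩

lemma between_insert_sdiff {V : Type*} [DecidableEq V] {G : WDigraph V} {X S : Finset V} {v : V}
    (hv : v ∉ S) (hvX : v ∈ X) :
    G.between (insert v S) (X \ insert v S) =
      G.between S (X \ S) + (G.between {v} (X \ insert v S) - G.between S {v}) := by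
  have h : X \ S = insert v (X \ insert v S) := by
    rw [Finset.sdiff_insert, Finset.insert_erase (Finset.mem_sdiff.2 ⟨hvX, hv⟩)]
  rw [h, WDigraph.between_insert_left _ hv, WDigraph.between_insert_right _ (by simp)]
  ring

section Tables

variable {V I : Type*} [Fintype V] [DecidableEq V] {G : WDigraph V} {D : TreeDecomposition G I}

lemma TreeDecomposition.bag_union_forgotten (i : I) :
    D.bag i ∪ D.forgotten i = D.vertsBelow i :=
  Finset.union_sdiff_of_subset (D.bag_subset_vertsBelow i)

lemma TreeDecomposition.disjoint_bag_forgotten (i : I) : Disjoint (D.bag i) (D.forgotten i) :=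
  Finset.disjoint_sdiff

/-- The pair `p` has the components that the entry `Γ_i(l, S)` of the table has to have. -/
def IsEntry (up : Bool) (D : TreeDecomposition G I) (i : I) (l : ℕ) (S : Finset V) (p : ℕ × ℚ) :
    Prop :=
  p.1 = l + S.card ∧
    IsBest up (cutValues G (D.bag i) (D.forgotten i) l S) (p.2 - G.between S (D.bag i \ S))

lemma IsEntry.unique {up : Bool} {i : I} {l : ℕ} {S : Finset V} {p q : ℕ × ℚ}
    (hp : IsEntry up D i l S p) (hq : IsEntry up D i l S q) : p = q :=
  Prod.ext (hp.1.trans hq.1.symm) (by simpa using hp.2.unique hq.2)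

lemma snd_image_tableSet {i : I} {l : ℕ} {S : Finset V} (hS : S ⊆ D.bag i) :
    Prod.snd '' tableSet D i l S =
      (· + G.between S (D.bag i \ S)) '' cutValues G (D.bag i) (D.forgotten i) l S := by
  have key : ∀ R ⊆ D.forgotten i,
      G.alpha (G.cut (S ∪ R) ∩ (D.vertsBelow i ×ˢ D.vertsBelow i)) =
        forgottenCut G (D.bag i) (D.forgotten i) S R + G.between S (D.bag i \ S) := by
    intro R hR
    rw [← D.bag_union_forgotten, WDigraph.alpha_cut_inter _ _ (Finset.union_subset_union hS hR),
      between_union_sdiff (D.disjoint_bag_forgotten i) hS hR]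
  ext x
  constructor
  · rintro ⟨_, ⟨R, hR, hc, rfl⟩, rfl⟩
    exact ⟨_, ⟨R, hR, hc, rfl⟩, (key R hR).symm⟩
  · rintro ⟨_, ⟨R, hR, hc, rfl⟩, rfl⟩
    exact ⟨_, ⟨R, hR, hc, rfl⟩, key R hR⟩

lemma isTieSup_tableSet_iff {up : Bool} {f : Objective} (hf : MonotoneDir up f) {i : I} {l : ℕ}
    {S : Finset V} (hS : S ⊆ D.bag i) (p : ℕ × ℚ) :
    IsTieSup up f (tableSet D i l S) p ↔ IsEntry up D i l S p := by
  rw [isTieSup_iff hf (c := l + S.card) (by rintro q ⟨R, -, -, rfl⟩; rfl), snd_image_tableSet hS,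
    isBest_image_add_iff, IsEntry]

lemma exists_isTable (up : Bool) {f : Objective} (hf : MonotoneDir up f) :
    ∃ Γ, IsTable up f D Γ := by
  have h : ∀ i l S, ∃ p : ℕ × ℚ, l ≤ (D.forgotten i).card → IsEntry up D i l S p := by
    intro i l S
    by_cases hl : l ≤ (D.forgotten i).card
    · obtain ⟨x, hx⟩ := exists_isBest_cutValues (G := G) up (X := D.bag i) (S := S) hl
      exact ⟨(l + S.card, x + G.between S (D.bag i \ S)), fun _ => ⟨rfl, by simpa using hx⟩⟩
    · exact ⟨0, fun h => absurd h hl⟩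
  choose Γ hΓ using h
  exact ⟨Γ, fun i l hl S hS => (isTieSup_tableSet_iff hf hS _).2 (hΓ i l S hl)⟩

/-- All entries of the table of the node `i` are as they have to be. -/
def IsNodeTable (up : Bool) (D : TreeDecomposition G I) (Γ : I → ℕ → Finset V → ℕ × ℚ) (i : I) :
    Prop :=
  ∀ l ≤ (D.forgotten i).card, ∀ S ⊆ D.bag i, IsEntry up D i l S (Γ i l S)

lemma isTable_iff {up : Bool} {f : Objective} (hf : MonotoneDir up f)
    {Γ : I → ℕ → Finset V → ℕ × ℚ} : IsTable up f D Γ ↔ ∀ i, IsNodeTable up D Γ i :=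
  forall_congr' fun _ => forall_congr' fun _ => forall_congr' fun _ => forall_congr' fun _ =>
    forall_congr' fun hS => isTieSup_tableSet_iff hf hS _

/-! ### Leaves -/

lemma forgotten_leaf {i : I} (hi : D.IsLeaf i) : D.forgotten i = ∅ := by
  refine Finset.eq_empty_of_forall_notMem fun v hv => ?_
  obtain ⟨h, h'⟩ := Finset.mem_sdiff.1 hv
  rcases TreeDecomposition.mem_vertsBelow_iff.1 h with h | ⟨j, hj, -⟩
  · exact h' h
  · exact hi j hj

lemma isEntry_leaf_iff {up : Bool} {i : I} (hi : D.IsLeaf i) {S : Finset V} {p : ℕ × ℚ} :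
    IsEntry up D i 0 S p ↔ p = (S.card, G.between S (D.bag i \ S)) := by
  rw [IsEntry, forgotten_leaf hi, cutValues_empty, isBest_singleton, sub_eq_zero, zero_add,
    Prod.ext_iff]

lemma leafRec_iff {up : Bool} {Γ : I → ℕ → Finset V → ℕ × ℚ} :
    LeafRec D Γ ↔ ∀ i, D.IsLeaf i → IsNodeTable up D Γ i := by
  refine forall_congr' fun i => forall_congr' fun hi => ?_
  have e : IsNodeTable up D Γ i ↔
      ∀ S ⊆ D.bag i, Γ i 0 S = (S.card, G.between S (D.bag i \ S)) := by
    simp only [IsNodeTable, forgotten_leaf hi, Finset.card_empty, Nat.le_zero, forall_eq,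
      isEntry_leaf_iff hi]
  rw [e]
  constructor
  · rintro ⟨h1, h2, h3⟩ S
    induction S using Finset.induction_on with
    | empty => intro _; simpa using h1
    | insert v S hv ih =>
      intro hS
      have hS' := (Finset.subset_insert v S).trans hS
      rcases S.eq_empty_or_nonempty with rfl | hne
      · rw [insert_empty_eq, h2 v (hS (Finset.mem_insert_self v _))]; simp
      · rw [h3 S v hne hv hS, ih hS', Prod.mk_add_mk, Finset.card_insert_of_notMem hv,
          between_insert_sdiff hv (hS (Finset.mem_insert_self v _))]
  · intro h
    refine ⟨by simpa using h ∅ (Finset.empty_subset _), fun v hv => ?_, fun S v _ hv hS => ?_⟩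
    · simpa using h {v} (Finset.singleton_subset_iff.2 hv)
    · rw [h _ hS, h _ ((Finset.subset_insert v S).trans hS), Prod.mk_add_mk,
        Finset.card_insert_of_notMem hv, between_insert_sdiff hv (hS (Finset.mem_insert_self v _))]

/-! ### Forget nodes -/

lemma forgotten_forget {i j : I} {v : V} (h : D.IsForget i j v) :
    v ∉ D.forgotten j ∧ D.forgotten i = insert v (D.forgotten j) := by
  obtain ⟨h1, h2, h3⟩ := h
  constructor
  · simp [TreeDecomposition.forgotten, h3]
  ext w
  simp only [TreeDecomposition.forgotten, Finset.mem_sdiff, Finset.mem_insert,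
    TreeDecomposition.mem_vertsBelow_iff (i := i), h1, exists_eq_left, h3]
  have hv : v ∈ D.vertsBelow j := D.bag_subset_vertsBelow j (by simp [h3])
  by_cases hw : w = v
  · subst hw; simp [h2, hv]
  · tauto

lemma isNodeTable_forget_iff {up : Bool} {f : Objective} (hf : MonotoneDir up f)
    {Γ : I → ℕ → Finset V → ℕ × ℚ} {i j : I} {v : V} (h : D.IsForget i j v)
    (hj : IsNodeTable up D Γ j) :
    IsNodeTable up D Γ i ↔ ∀ S ⊆ D.bag i, Γ i 0 S = Γ j 0 S ∧
      ∀ l, 1 ≤ l → l ≤ (D.forgotten i).card → IsTieSup up f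
        {p | p = Γ j (l - 1) (insert v S) ∨ (l ≤ (D.forgotten j).card ∧ p = Γ j l S)}
        (Γ i l S) := by
  obtain ⟨hvF, hF⟩ := forgotten_forget h
  have hvj : v ∈ D.bag j := by rw [h.2.2]; exact Finset.mem_insert_self _ _
  have hX : D.bag i = (D.bag j).erase v := by rw [h.2.2, Finset.erase_insert h.2.1]
  have hcard : (D.forgotten i).card = (D.forgotten j).card + 1 := by
    rw [hF, Finset.card_insert_of_notMem hvF]
  have key : ∀ S ⊆ D.bag i, ∀ l p, IsEntry up D i l S p ↔ p.1 = l + S.card ∧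
      IsBest up {a | (l ≤ (D.forgotten j).card ∧ a = (Γ j l S).2) ∨
        ∃ k ≤ (D.forgotten j).card, l = k + 1 ∧ a = (Γ j k (insert v S)).2} p.2 := by
    intro S hS l p
    have hvS : v ∉ S := fun hv => h.2.1 (hS hv)
    have hSj : S ⊆ D.bag j := by rw [h.2.2]; exact hS.trans (Finset.subset_insert _ _)
    rw [IsEntry, hX, hF, isBest_cutValues_forget hvj hvF hvS (fun l hl => (hj l hl S hSj).2)
      (fun l hl => (hj l hl (insert v S) (Finset.insert_subset hvj hSj)).2),
      sub_eq_add_neg p.2]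
    have e1 : G.between S (D.bag j \ S) =
        G.between S {v} + G.between S ((D.bag j).erase v \ S) := by
      rw [← WDigraph.between_insert_right _ (by simp), ← Finset.insert_sdiff_of_notMem _ hvS,
        Finset.insert_erase hvj]
    have e2 : D.bag j \ insert v S = (D.bag j).erase v \ S := by
      ext w; simp only [Finset.mem_sdiff, Finset.mem_insert, Finset.mem_erase]; tauto
    have e3 := WDigraph.between_insert_left (G := G) (D.bag j \ insert v S) hvS
    rw [e2] at e3
    refine and_congr_right fun _ => ?_
    rw [← sub_eq_add_neg, ← isBest_image_add_iff]
    refine iff_of_eq (congrArg (fun M => IsBest up M p.2) ?_)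
    ext a
    simp only [Set.mem_image, Set.mem_ofPred_eq, e1, e2, e3]
    constructor
    · rintro ⟨b, ⟨hl, rfl⟩ | ⟨k, hk, hl, rfl⟩, rfl⟩
      · exact Or.inl ⟨hl, by ring⟩
      · exact Or.inr ⟨k, hk, hl, by ring⟩
    · rintro (⟨hl, rfl⟩ | ⟨k, hk, hl, rfl⟩)
      · exact ⟨_, Or.inl ⟨hl, rfl⟩, by ring⟩
      · exact ⟨_, Or.inr ⟨k, hk, hl, rfl⟩, by ring⟩
  have hfst : ∀ S ⊆ D.bag j, ∀ l ≤ (D.forgotten j).card, (Γ j l S).1 = l + S.card :=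
    fun S hS l hl => (hj l hl S hS).1
  have hzero : ∀ S ⊆ D.bag i, ∀ p, IsEntry up D i 0 S p ↔ p = Γ j 0 S := by
    intro S hS p
    have hSj : S ⊆ D.bag j := by rw [h.2.2]; exact hS.trans (Finset.subset_insert _ _)
    rw [key S hS, Prod.ext_iff, hfst S hSj 0 (Nat.zero_le _)]
    refine and_congr_right fun _ => ?_
    rw [← isBest_singleton (up := up)]
    refine iff_of_eq (congrArg (fun M => IsBest up M p.2) ?_)
    ext a
    simp
  have hsucc : ∀ S ⊆ D.bag i, ∀ l, 1 ≤ l → l ≤ (D.forgotten i).card → ∀ p,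
      IsEntry up D i l S p ↔ IsTieSup up f
        {p | p = Γ j (l - 1) (insert v S) ∨ (l ≤ (D.forgotten j).card ∧ p = Γ j l S)} p := by
    intro S hS l hl hl' p
    have hSj : S ⊆ D.bag j := by rw [h.2.2]; exact hS.trans (Finset.subset_insert _ _)
    have hvS : v ∉ S := fun hv => h.2.1 (hS hv)
    rw [key S hS, isTieSup_iff hf (c := l + S.card)]
    · refine and_congr_right fun _ => iff_of_eq (congrArg (fun M => IsBest up M p.2) ?_)
      ext a
      constructor
      · rintro (⟨hl, rfl⟩ | ⟨k, hk, rfl, rfl⟩)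
        · exact ⟨_, Or.inr ⟨hl, rfl⟩, rfl⟩
        · exact ⟨_, Or.inl rfl, by simp⟩
      · rintro ⟨q, rfl | ⟨hl, rfl⟩, rfl⟩
        · exact Or.inr ⟨l - 1, by omega, by omega, rfl⟩
        · exact Or.inl ⟨hl, rfl⟩
    · rintro q (rfl | ⟨hl, rfl⟩)
      · rw [hfst _ (Finset.insert_subset hvj hSj) _ (by omega), Finset.card_insert_of_notMem hvS]
        omega
      · exact hfst _ hSj _ hl
  constructor
  · intro hi S hS
    exact ⟨(hzero S hS _).1 (hi 0 (Nat.zero_le _) S hS),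
      fun l hl hl' => (hsucc S hS l hl hl' _).1 (hi l hl' S hS)⟩
  · intro hi l hl S hS
    rcases Nat.eq_zero_or_pos l with rfl | hl'
    · exact (hzero S hS _).2 (hi S hS).1
    · exact (hsucc S hS l hl' hl _).2 ((hi S hS).2 l hl' hl)

/-! ### Introduce nodes -/

lemma forgotten_introduce {i j : I} {v : V} (h : D.IsIntroduce i j v) :
    D.forgotten i = D.forgotten j ∧
      ∀ u ∈ D.forgotten j, (u, v) ∉ G.edges ∧ (v, u) ∉ G.edges := by
  obtain ⟨h1, h2, h3⟩ := h
  have hj : D.tree.IsChild j i := (h1 j).2 rfl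
  have hv : v ∉ D.vertsBelow j := fun hv =>
    h2 (TreeDecomposition.mem_bag_child hj hv (by simp [h3]))
  constructor
  · ext w
    simp only [TreeDecomposition.forgotten, Finset.mem_sdiff,
      TreeDecomposition.mem_vertsBelow_iff (i := i), h1, exists_eq_left, h3, Finset.mem_insert]
    by_cases hw : w = v
    · subst hw; simp [hv]
    · tauto
  · intro u hu
    have hu' := Finset.mem_sdiff.1 hu
    have hui : u ∉ D.bag i := by
      rw [h3, Finset.mem_insert]
      rintro (rfl | h)
      · exact hv hu'.1
      · exact hu'.2 h
    exact ⟨fun he => hv (TreeDecomposition.mem_vertsBelow_of_edge hj hu'.1 hui (Or.inl he)),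
      fun he => hv (TreeDecomposition.mem_vertsBelow_of_edge hj hu'.1 hui (Or.inr he))⟩

lemma isNodeTable_introduce_iff {up : Bool} {Γ : I → ℕ → Finset V → ℕ × ℚ} {i j : I} {v : V}
    (h : D.IsIntroduce i j v) (hj : IsNodeTable up D Γ j) :
    IsNodeTable up D Γ i ↔ ∀ S ⊆ D.bag i, ∀ l ≤ (D.forgotten i).card,
      (v ∈ S → Γ i l S = (1, G.between {v} (D.bag i \ S)) + Γ j l (S.erase v)) ∧
      (v ∉ S → Γ i l S = (0, G.between S {v}) + Γ j l S) := by
  obtain ⟨hF, hE⟩ := forgotten_introduce h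
  have hX := h.2.2
  have hvj := h.2.1
  have hcut : ∀ S ⊆ D.bag i, ∀ l, cutValues G (D.bag i) (D.forgotten i) l S =
      cutValues G (D.bag j) (D.forgotten j) l (S ∩ D.bag j) := by
    intro S hS l
    rw [hF]
    refine cutValues_restrict (by rw [hX]; exact Finset.subset_insert _ _) hS
      (fun u hu w hw => ?_) l
    have : w = v := by
      rw [hX, Finset.mem_sdiff, Finset.mem_insert] at hw
      exact hw.1.resolve_right hw.2
    exact this ▸ hE u hu
  have hvi : v ∈ D.bag i := by rw [hX]; exact Finset.mem_insert_self _ _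
  have key : ∀ S ⊆ D.bag i, ∀ l ≤ (D.forgotten i).card,
      (v ∈ S → IsEntry up D i l S ((1, G.between {v} (D.bag i \ S)) + Γ j l (S.erase v))) ∧
      (v ∉ S → IsEntry up D i l S ((0, G.between S {v}) + Γ j l S)) := by
    intro S hS l hl
    rw [hF] at hl
    constructor
    · intro hv
      have hSj : S.erase v ⊆ D.bag j := by
        intro w hw
        have := hS (Finset.mem_of_mem_erase hw)
        rw [hX, Finset.mem_insert] at this
        exact this.resolve_left (Finset.ne_of_mem_erase hw)
      have hI : S ∩ D.bag j = S.erase v := by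
        ext w
        constructor
        · intro hw
          rw [Finset.mem_inter] at hw
          exact Finset.mem_erase.2 ⟨fun e => hvj (e ▸ hw.2), hw.1⟩
        · intro hw
          exact Finset.mem_inter.2 ⟨Finset.mem_of_mem_erase hw, hSj hw⟩
      have hb : D.bag i \ S = D.bag j \ S.erase v := by
        rw [hX]
        ext w
        by_cases hw : w = v
        · subst hw; simp [hv, hvj]
        · simp [hw]
      have he := hj l hl _ hSj
      have hbt : G.between S (D.bag j \ S.erase v) =
          G.between {v} (D.bag j \ S.erase v) + G.between (S.erase v) (D.bag j \ S.erase v) := by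
        rw [← WDigraph.between_insert_left _ (by simp), Finset.insert_erase hv]
      refine ⟨?_, ?_⟩
      · rw [Prod.fst_add, he.1, ← Finset.card_erase_add_one hv]; dsimp only; ring
      · rw [hcut S hS, hI, Prod.snd_add, hb, hbt]
        convert he.2 using 1
        ring
    · intro hv
      have hSj : S ⊆ D.bag j := by
        intro w hw
        have := hS hw
        rw [hX, Finset.mem_insert] at this
        exact this.resolve_left fun e => hv (e ▸ hw)
      have hI : S ∩ D.bag j = S := Finset.inter_eq_left.2 hSj
      have hb : D.bag i \ S = insert v (D.bag j \ S) := by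
        rw [hX, Finset.insert_sdiff_of_notMem _ hv]
      have he := hj l hl _ hSj
      refine ⟨?_, ?_⟩
      · rw [Prod.fst_add, he.1, zero_add]
      · rw [hcut S hS, hI, Prod.snd_add, hb, WDigraph.between_insert_right _ (by simp [hvj])]
        convert he.2 using 1
        ring
  constructor
  · intro hi S hS l hl
    exact ⟨fun hv => (hi l hl S hS).unique ((key S hS l hl).1 hv),
      fun hv => (hi l hl S hS).unique ((key S hS l hl).2 hv)⟩
  · intro hi l hl S hS
    by_cases hv : v ∈ S
    · rw [(hi S hS l hl).1 hv]; exact (key S hS l hl).1 hv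
    · rw [(hi S hS l hl).2 hv]; exact (key S hS l hl).2 hv

/-! ### Join nodes -/

lemma forgotten_join {i j k : I} (h : D.IsJoin i j k) :
    D.forgotten i = D.forgotten j ∪ D.forgotten k ∧
      Disjoint (D.forgotten j) (D.forgotten k) ∧
      ∀ u ∈ D.forgotten j, ∀ w ∈ D.forgotten k, (u, w) ∉ G.edges ∧ (w, u) ∉ G.edges := by
  obtain ⟨hne, hc, hj, hk⟩ := h
  have hcj : D.tree.IsChild j i := (hc j).2 (Or.inl rfl)
  have hck : D.tree.IsChild k i := (hc k).2 (Or.inr rfl)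
  have hdis : ∀ u ∈ D.forgotten j, u ∉ D.vertsBelow k := by
    intro u hu hu'
    have hu := Finset.mem_sdiff.1 hu
    exact hu.2 (hj ▸ TreeDecomposition.mem_bag_parent hcj hck hne hu.1 hu')
  refine ⟨?_, ?_, ?_⟩
  · ext w
    simp only [TreeDecomposition.forgotten, Finset.mem_sdiff, Finset.mem_union,
      TreeDecomposition.mem_vertsBelow_iff (i := i), hc, ← hj, ← hk, or_and_right, exists_or,
      exists_eq_left]
    tauto
  · exact Finset.disjoint_left.2 fun u hu hu' => hdis u hu (Finset.mem_sdiff.1 hu').1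
  · intro u hu w hw
    have hw' := Finset.mem_sdiff.1 hw
    exact ⟨fun he => hdis u hu (TreeDecomposition.mem_vertsBelow_of_edge hck hw'.1 (hk ▸ hw'.2)
        (Or.inr he)),
      fun he => hdis u hu (TreeDecomposition.mem_vertsBelow_of_edge hck hw'.1 (hk ▸ hw'.2)
        (Or.inl he))⟩

lemma isNodeTable_join_iff {up : Bool} {f : Objective} (hf : MonotoneDir up f)
    {Γ : I → ℕ → Finset V → ℕ × ℚ} {i j k : I} (h : D.IsJoin i j k)
    (hj : IsNodeTable up D Γ j) (hk : IsNodeTable up D Γ k) :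
    IsNodeTable up D Γ i ↔ ∀ S ⊆ D.bag i, ∀ l ≤ (D.forgotten i).card, ∃ q : ℕ × ℚ,
      IsTieSup up f {p | ∃ l₁ ≤ (D.forgotten j).card, ∃ l₂ ≤ (D.forgotten k).card,
        l₁ + l₂ = l ∧ p = Γ j l₁ S + Γ k l₂ S} q ∧
      q = Γ i l S + (S.card, G.alpha (G.cut S ∩ (D.bag i ×ˢ D.bag i))) := by
  obtain ⟨hF, hd, hE⟩ := forgotten_join h
  obtain ⟨-, -, hXj, hXk⟩ := h
  have key : ∀ S ⊆ D.bag i, ∀ l p, IsEntry up D i l S p ↔ IsTieSup up f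
      {p | ∃ l₁ ≤ (D.forgotten j).card, ∃ l₂ ≤ (D.forgotten k).card,
        l₁ + l₂ = l ∧ p = Γ j l₁ S + Γ k l₂ S}
      (p + (S.card, G.alpha (G.cut S ∩ (D.bag i ×ˢ D.bag i)))) := by
    intro S hS l p
    have hj' := fun l hl => hj l hl S (hXj ▸ hS)
    have hk' := fun l hl => hk l hl S (hXk ▸ hS)
    simp only [IsEntry, ← hXj] at hj'
    simp only [IsEntry, ← hXk] at hk'
    rw [isTieSup_iff hf (c := l + 2 * S.card), IsEntry, hF,
      isBest_cutValues_union hd hE (fun l hl => (hj' l hl).2) (fun l hl => (hk' l hl).2),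
      WDigraph.alpha_cut_inter _ _ hS]
    · refine and_congr (by rw [Prod.fst_add]; dsimp only; omega) ?_
      set β := G.between S (D.bag i \ S)
      have e : p.2 - β = (p + (S.card, β)).2 - (β + β) := by
        rw [Prod.snd_add]; ring
      rw [e, ← isBest_image_add_iff]
      refine iff_of_eq (congrArg (fun M => IsBest up M _) ?_)
      ext a
      constructor
      · rintro ⟨_, ⟨l₁, h₁, l₂, h₂, hl, rfl⟩, rfl⟩
        exact ⟨_, ⟨l₁, h₁, l₂, h₂, hl, rfl⟩, by rw [Prod.snd_add]; ring⟩
      · rintro ⟨_, ⟨l₁, h₁, l₂, h₂, hl, rfl⟩, rfl⟩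
        exact ⟨_, ⟨l₁, h₁, l₂, h₂, hl, rfl⟩, by rw [Prod.snd_add]; ring⟩
    · rintro q ⟨l₁, h₁, l₂, h₂, rfl, rfl⟩
      rw [Prod.fst_add, (hj' l₁ h₁).1, (hk' l₂ h₂).1]
      ring
  constructor
  · intro hi S hS l hl
    exact ⟨_, (key S hS l _).1 (hi l hl S hS), rfl⟩
  · intro hi l hl S hS
    obtain ⟨q, hq, rfl⟩ := hi S hS l hl
    exact (key S hS l _).2 hq

/-! ### All nodes -/

lemma isTable_iff_recurrences {m : ℕ} {D : TreeDecomposition G (Fin m)} {up : Bool} {f : Objective}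
    (hD : D.IsNice) (hf : MonotoneDir up f) {Γ : Fin m → ℕ → Finset V → ℕ × ℚ} :
    IsTable up f D Γ ↔ Recurrences up f D Γ := by
  rw [isTable_iff hf]
  constructor
  · intro h
    exact ⟨(leafRec_iff (up := up)).2 fun i _ => h i,
      fun i j v hi => (isNodeTable_forget_iff hf hi (h j)).1 (h i),
      fun i j v hi => (isNodeTable_introduce_iff hi (h j)).1 (h i),
      fun i j k hi => (isNodeTable_join_iff hf hi (h j) (h k)).1 (h i)⟩
  · rintro ⟨h1, h2, h3, h4⟩
    -- induction from the nodes that are farthest from the root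
    suffices H : ∀ d i, m ≤ D.tree.graph.dist D.tree.root i + d → IsNodeTable up D Γ i from
      fun i => H m i (by omega)
    intro d
    induction d with
    | zero =>
      intro i hi
      have := D.tree.dist_root_lt i
      rw [Fintype.card_fin] at this
      omega
    | succ d ih =>
      intro i hi
      have hc : ∀ j, D.tree.IsChild j i → IsNodeTable up D Γ j := fun j hj =>
        ih j (by have := hj.2; omega)
      rcases hD i with h | ⟨j, v, h⟩ | ⟨j, v, h⟩ | ⟨j, k, h⟩
      · exact leafRec_iff.1 h1 i h
      · exact (isNodeTable_forget_iff hf h (hc j ((h.1 j).2 rfl))).2 (h2 i j v h)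
      · exact (isNodeTable_introduce_iff h (hc j ((h.1 j).2 rfl))).2 (h3 i j v h)
      · exact (isNodeTable_join_iff hf h (hc j ((h.2.1 j).2 (Or.inl rfl)))
          (hc k ((h.2.1 k).2 (Or.inr rfl)))).2 (h4 i j k h)

/-- A supremum of a cofinal subset of `M` is a supremum of `M`. -/
lemma IsSup.of_cofinal {f : Objective} {M N : Set (ℕ × ℚ)} {x : Option (ℕ × ℚ)} (h : IsSup f N x)
    (hNM : N ⊆ M) (hc : ∀ p ∈ M, ∃ q ∈ N, f p.1 p.2 ≤ f q.1 q.2) : IsSup f M x := by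
  obtain ⟨h1, h2⟩ := h
  refine ⟨h1.imp_right fun ⟨p, hp, e⟩ => ⟨p, hNM hp, e⟩, fun p hp => ?_⟩
  obtain ⟨q, hq, hle⟩ := hc p hp
  rcases h2 q hq with h | ⟨a, b, ha, rfl, hab⟩
  · cases h
  · cases ha
    exact Or.inr ⟨p, b, rfl, rfl, hle.trans hab⟩

lemma isSup_feasible_of_isSup_rootSet {up : Bool} {f : Objective} {valid : ℕ → Bool}
    {Γ : I → ℕ → Finset V → ℕ × ℚ} (hΓ : IsTable up f D Γ)
    {x : Option (ℕ × ℚ)} (hx : IsSup f (rootSet D valid Γ) x) :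
    IsSup f (feasible G valid) x := by
  have hset : ∀ l S p, p ∈ tableSet D D.tree.root l S ↔
      ∃ R ⊆ D.forgotten D.tree.root, R.card = l ∧
        p = (l + S.card, G.alpha (G.cut (S ∪ R))) := by
    intro l S p
    simp only [tableSet, TreeDecomposition.vertsBelow_root, Finset.univ_product_univ,
      Finset.inter_univ]
    rfl
  have hdis := D.disjoint_bag_forgotten D.tree.root
  refine hx.of_cofinal ?_ ?_
  · rintro p ⟨S, hS, l, hl, hv, rfl⟩
    obtain ⟨h1, -⟩ := (hΓ _ l hl S hS).1
    obtain ⟨q, hq, e⟩ := h1.resolve_left (by simp)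
    obtain ⟨R, hR, hc, hq⟩ := (hset _ _ _).1 hq
    have hcard : (S ∪ R).card = l + S.card := by
      rw [Finset.card_union_of_disjoint (hdis.mono hS hR), hc, add_comm]
    refine ⟨S ∪ R, by rw [hcard]; exact hv, ?_⟩
    rw [Option.some.inj e, hq, hcard]
  · rintro p ⟨S, hv, rfl⟩
    have hS : S ∩ D.bag D.tree.root ∪ S ∩ D.forgotten D.tree.root = S := by
      rw [← Finset.inter_union_distrib_left, TreeDecomposition.bag_union_forgotten,
        TreeDecomposition.vertsBelow_root, Finset.inter_univ]
    have hcard : (S ∩ D.forgotten D.tree.root).card + (S ∩ D.bag D.tree.root).card = S.card := by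
      rw [add_comm, ← Finset.card_union_of_disjoint
        (hdis.mono Finset.inter_subset_right Finset.inter_subset_right), hS]
    have hl : (S ∩ D.forgotten D.tree.root).card ≤ (D.forgotten D.tree.root).card :=
      Finset.card_le_card Finset.inter_subset_right
    refine ⟨_, ⟨_, Finset.inter_subset_right, _, hl, by rw [hcard]; exact hv, rfl⟩, ?_⟩
    have := (hΓ _ _ hl _ Finset.inter_subset_right).1.2 (S.card, G.alpha (G.cut S)) (by
      rw [hset]
      exact ⟨_, Finset.inter_subset_right, rfl, by rw [hcard, hS]⟩)
    rcases this with h | ⟨a, b, ha, hb, hab⟩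
    · cases h
    · cases ha; cases hb; exact hab

end Tables

/-! ### Verifying programs -/

/-- Whether the program contains an assignment to the array `a` of natural numbers. -/
def Program.writesNat : Program → ℕ → Bool
  | .skip, _ => false
  | .setNat b _ _, a => b == a
  | .setRat _ _ _, _ => false
  | .seq P Q, a => P.writesNat a || Q.writesNat a
  | .ite _ P Q, a => P.writesNat a || Q.writesNat a
  | .while _ P, a => P.writesNat a

/-- Whether the program contains an assignment to the array `a` of rational numbers. -/
def Program.writesRat : Program → ℕ → Bool
  | .skip, _ => false
  | .setNat _ _ _, _ => false
  | .setRat b _ _, a => b == a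
  | .seq P Q, a => P.writesRat a || Q.writesRat a
  | .ite _ P Q, a => P.writesRat a || Q.writesRat a
  | .while _ P, a => P.writesRat a

lemma write_apply {α : Type} (M : ℕ → ℕ → α) (a i : ℕ) (x : α) (b : ℕ) :
    write M a i x b = if b = a then Function.update (M a) i x else M b := by
  unfold write
  split_ifs with h
  · subst h; simp
  · simp [h]

/-- The memories `s` and `s'` agree except for arrays to which the program `P` writes. -/
structure Frame (P : Program) (s s' : Memory) : Prop where
  nat : ∀ a, P.writesNat a = false → s'.nat a = s.nat a
  rat : ∀ a, P.writesRat a = false → s'.rat a = s.rat a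

lemma Frame.refl (P : Program) (s : Memory) : Frame P s s := ⟨fun _ _ => rfl, fun _ _ => rfl⟩

lemma Frame.trans {P : Program} {s s' s'' : Memory} (h : Frame P s s') (h' : Frame P s' s'') :
    Frame P s s'' :=
  ⟨fun a ha => (h'.nat a ha).trans (h.nat a ha), fun a ha => (h'.rat a ha).trans (h.rat a ha)⟩

lemma Frame.mono {P Q : Program} {s s' : Memory} (h : Frame P s s')
    (hn : ∀ a, Q.writesNat a = false → P.writesNat a = false)
    (hr : ∀ a, Q.writesRat a = false → P.writesRat a = false) : Frame Q s s' :=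
  ⟨fun a ha => h.nat a (hn a ha), fun a ha => h.rat a (hr a ha)⟩

lemma Exec.frame {O : Oracles} {P : Program} {s s' : Memory} {T : ℕ} (h : Exec O P s s' T) :
    Frame P s s' := by
  induction h with
  | skip => exact Frame.refl _ _
  | setNat a i e s =>
    refine ⟨fun b hb => ?_, fun _ _ => rfl⟩
    have hb : ¬ b = a := fun e => by simp [Program.writesNat, e] at hb
    simp [write_apply, hb]
  | setRat a i e s =>
    refine ⟨fun _ _ => rfl, fun b hb => ?_⟩
    have hb : ¬ b = a := fun e => by simp [Program.writesRat, e] at hb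
    simp [write_apply, hb]
  | seq _ _ h₁ h₂ =>
    refine (h₁.mono ?_ ?_).trans (h₂.mono ?_ ?_) <;> intro a ha <;>
      simp only [Program.writesNat, Program.writesRat, Bool.or_eq_false_iff] at ha <;>
      first | exact ha.1 | exact ha.2
  | iteTrue _ _ h =>
    refine h.mono ?_ ?_ <;> intro a ha <;>
      simp only [Program.writesNat, Program.writesRat, Bool.or_eq_false_iff] at ha <;> exact ha.1
  | iteFalse _ _ h =>
    refine h.mono ?_ ?_ <;> intro a ha <;>
      simp only [Program.writesNat, Program.writesRat, Bool.or_eq_false_iff] at ha <;> exact ha.2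
  | whileTrue _ _ _ h₁ h₂ =>
    exact Frame.trans (h₁.mono (fun _ h => h) (fun _ h => h)) h₂
  | whileFalse => exact Frame.refl _ _

/-- Started with the memory `s`, the program `P` halts within `B` steps, and the memory then
satisfies `Q`. -/
def Runs (O : Oracles) (P : Program) (s : Memory) (B : ℕ) (Q : Memory → Prop) : Prop :=
  ∃ s' T, Exec O P s s' T ∧ T ≤ B ∧ Q s'

section Runs

variable {O : Oracles} {P P' : Program} {s : Memory} {B B' B'' : ℕ} {Q Q' : Memory → Prop}

lemma Runs.mono (h : Runs O P s B Q) (hB : B ≤ B') (hQ : ∀ s', Frame P s s' → Q s' → Q' s') :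
    Runs O P s B' Q' := by
  obtain ⟨s', T, h, hT, hs⟩ := h
  exact ⟨s', T, h, hT.trans hB, hQ s' h.frame hs⟩

lemma Runs.seq (h : Runs O P s B Q) (h' : ∀ s', Frame P s s' → Q s' → Runs O P' s' B' Q')
    (hB : B + B' ≤ B'') : Runs O (.seq P P') s B'' Q' := by
  obtain ⟨s', T, h, hT, hs⟩ := h
  obtain ⟨s'', T', h', hT', hs'⟩ := h' s' h.frame hs
  exact ⟨s'', T + T', h.seq h', (Nat.add_le_add hT hT').trans hB, hs'⟩

lemma Runs.ite {b : Test} (h : b.holds O s → Runs O P s B Q) (h' : ¬ b.holds O s → Runs O P' s B Q)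
    (hB : b.cost + B + 1 ≤ B') : Runs O (.ite b P P') s B' Q := by
  by_cases hb : b.holds O s
  · obtain ⟨s', T, h, hT, hs⟩ := h hb
    exact ⟨s', _, .iteTrue hb h, by omega, hs⟩
  · obtain ⟨s', T, h, hT, hs⟩ := h' hb
    exact ⟨s', _, .iteFalse hb h, by omega, hs⟩

end Runs

/-- The weakest precondition of a program without loops. -/
def Program.wp (O : Oracles) : Program → (Memory → Prop) → Memory → Prop
  | .skip, Q, s => Q s
  | .setNat a i e, Q, s => Q { s with nat := write s.nat a (i.eval s) (e.eval s) }
  | .setRat a i r, Q, s => Q { s with rat := write s.rat a (i.eval s) (r.eval s) }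
  | .seq P P', Q, s => P.wp O (P'.wp O Q) s
  | .ite b P P', Q, s => (b.holds O s → P.wp O Q s) ∧ (¬ b.holds O s → P'.wp O Q s)
  | .while _ _, _, _ => False

/-- A bound on the running time of a program without loops. -/
def Program.maxCost : Program → ℕ
  | .skip => 1
  | .setNat _ i e => i.cost + e.cost + 1
  | .setRat _ i r => i.cost + r.cost + 1
  | .seq P Q => P.maxCost + Q.maxCost
  | .ite b P Q => b.cost + (P.maxCost + Q.maxCost) + 1
  | .while _ _ => 0

lemma Runs.of_wp {O : Oracles} {P : Program} {s : Memory} {Q : Memory → Prop} {B : ℕ}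
    (h : P.wp O Q s) (hB : P.maxCost ≤ B) : Runs O P s B Q := by
  induction P generalizing s Q B with
  | skip => exact ⟨s, _, .skip s, hB, h⟩
  | setNat a i e => exact ⟨_, _, .setNat a i e s, hB, h⟩
  | setRat a i e => exact ⟨_, _, .setRat a i e s, hB, h⟩
  | seq P P' ih ih' => exact (ih h le_rfl).seq (fun _ _ h => ih' h le_rfl) hB
  | ite b P P' ih ih' =>
    exact Runs.ite (fun hb => ih (h.1 hb) (Nat.le_add_right _ _))
      (fun hb => ih' (h.2 hb) (Nat.le_add_left _ _)) hB
  | _ => exact h.elim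

/-- The loop `for i = 0, …, e - 1`, where the cell `0` of the array `i` holds the variable. -/
def forLoop (i : ℕ) (e : NatExp) (P : Program) : Program :=
  .seq (.setNat i (.const 0) (.const 0))
    (.while (.not (.natLe e (.read i (.const 0))))
      (.seq P (.setNat i (.const 0) (.add (.read i (.const 0)) (.const 1)))))

/-- The memory after writing `x` to the cell `0` of the array `i`. -/
def Memory.setReg (s : Memory) (i x : ℕ) : Memory := { s with nat := write s.nat i 0 x }

/-- Rule for loops whose iterations may have different running times: these are bounded by the
increments of the potential `Φ`. -/
lemma runs_forLoop_potential {O : Oracles} {i : ℕ} {e : NatExp} {P : Program} {s : Memory} {N : ℕ}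
    {Inv : ℕ → Memory → Prop} {Φ : ℕ → ℕ} {Q : Memory → Prop} {B' : ℕ}
    (hi : P.writesNat i = false)
    (he : ∀ s', Frame (forLoop i e P) s s' → e.eval s' = N)
    (hreg : ∀ k s x, Inv k s → Inv k (s.setReg i x))
    (h0 : Inv 0 s)
    (hstep : ∀ k < N, ∀ s', Frame (forLoop i e P) s s' → s'.nat i 0 = k → Inv k s' →
      ∃ B, Φ k + B + e.cost + 11 ≤ Φ (k + 1) ∧ Runs O P s' B (Inv (k + 1)))
    (hQ : ∀ s', Frame (forLoop i e P) s s' → Inv N s' → Q s')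
    (hB : Φ N + e.cost + 8 ≤ B' + Φ 0) :
    Runs O (forLoop i e P) s B' Q := by
  have hfr : ∀ s' x, Frame (forLoop i e P) s' (s'.setReg i x) := by
    intro s' x
    refine ⟨fun a ha => ?_, fun a _ => rfl⟩
    have ha : ¬ a = i := fun e => by simp [forLoop, Program.writesNat, e] at ha
    simp [Memory.setReg, write_apply, ha]
  have hfP : ∀ s' s'', Frame P s' s'' → Frame (forLoop i e P) s' s'' := by
    intro s' s'' h
    refine h.mono ?_ ?_ <;> intro a ha <;>
      simp only [forLoop, Program.writesNat, Program.writesRat, Bool.or_eq_false_iff,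
        Bool.false_or, Bool.or_false] at ha
    · exact ha.2.1
    · exact ha
  have main : ∀ d k s', k + d = N → Frame (forLoop i e P) s s' → s'.nat i 0 = k → Inv k s' →
      ∃ s'' T, Exec O (.while (.not (.natLe e (.read i (.const 0))))
        (.seq P (.setNat i (.const 0) (.add (.read i (.const 0)) (.const 1))))) s' s'' T ∧
        T + Φ k ≤ Φ N + e.cost + 5 ∧ Q s'' := by
    intro d
    induction d with
    | zero =>
      intro k s' hk hf hr hinv
      refine ⟨s', _, .whileFalse ?_, ?_, hQ s' hf ?_⟩
      · simp only [Test.holds, NatExp.eval, he s' hf, hr, not_not]; omega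
      · simp only [Test.cost, NatExp.cost]
        obtain rfl : k = N := by omega
        omega
      · obtain rfl : k = N := by omega
        exact hinv
    | succ d ih =>
      intro k s' hk hf hr hinv
      obtain ⟨B, hB, s₁, T₁, hex, hT₁, hs₁⟩ := hstep k (by omega) s' hf hr hinv
      have hr₁ : s₁.nat i 0 = k := by rw [hex.frame.nat i hi, hr]
      obtain ⟨s₂, T₂, hex₂, hT₂, hs₂⟩ := ih (k + 1) (s₁.setReg i (k + 1)) (by omega)
        (hf.trans ((hfP _ _ hex.frame).trans (hfr _ _)))
        (by simp [Memory.setReg, write_apply]) (hreg _ _ _ hs₁)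
      have hset := Exec.setNat (O := O) i (.const 0) (.add (.read i (.const 0)) (.const 1)) s₁
      have hst : (⟨write s₁.nat i (NatExp.eval s₁ (.const 0))
          (NatExp.eval s₁ (.add (.read i (.const 0)) (.const 1))), s₁.rat⟩ : Memory) =
          s₁.setReg i (k + 1) := by
        simp [NatExp.eval, Memory.setReg, hr₁]
      rw [hst] at hset
      refine ⟨s₂, _, .whileTrue ?_ (hex.seq hset) hex₂, ?_, hs₂⟩
      · simp only [Test.holds, NatExp.eval, he s' hf, hr]; omega
      · simp only [Test.cost, NatExp.cost]
        omega
  obtain ⟨s'', T, hex, hT, hs⟩ := main N 0 (s.setReg i 0) (by omega) (hfr _ _)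
    (by simp [Memory.setReg, write_apply]) (hreg _ _ _ h0)
  refine ⟨s'', _, .seq (.setNat i (.const 0) (.const 0) s) hex, ?_, hs⟩
  simp only [NatExp.cost]
  omega

/-- Rule for loops whose iterations all halt within `B` steps. -/
lemma runs_forLoop {O : Oracles} {i : ℕ} {e : NatExp} {P : Program} {s : Memory} (N B : ℕ)
    (Inv : ℕ → Memory → Prop) {Q : Memory → Prop} {B' : ℕ}
    (hi : P.writesNat i = false)
    (he : ∀ s', Frame (forLoop i e P) s s' → e.eval s' = N)
    (hreg : ∀ k s x, Inv k s → Inv k (s.setReg i x))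
    (h0 : Inv 0 s)
    (hstep : ∀ k < N, ∀ s', Frame (forLoop i e P) s s' → s'.nat i 0 = k → Inv k s' →
      Runs O P s' B (Inv (k + 1)))
    (hQ : ∀ s', Frame (forLoop i e P) s s' → Inv N s' → Q s')
    (hB : N * (B + e.cost + 11) + e.cost + 8 ≤ B') :
    Runs O (forLoop i e P) s B' Q :=
  runs_forLoop_potential (Φ := fun k => k * (B + e.cost + 11)) hi he hreg h0
    (fun k hk s' hf hr hI => ⟨B, by simp only [Nat.succ_mul]; omega, hstep k hk s' hf hr hI⟩) hQ
    (by omega)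

/-! ### Loops over bags -/

/-- The scalar variable that is held in the cell `0` of the array `a`. -/
def reg (a : ℕ) : NatExp := .read a (.const 0)

@[simp] lemma reg_eval (s : Memory) (a : ℕ) : (reg a).eval s = s.nat a 0 := rfl

@[simp] lemma reg_cost (a : ℕ) : (reg a).cost = 2 := rfl

/-- The vertices of `X` are listed as the bag of the node `i`. -/
def IsBagList {n : ℕ} (s : Memory) (i : ℕ) (X : Finset (Fin n)) : Prop :=
  ∃ L : List (Fin n), L.Nodup ∧ L.toFinset = X ∧ s.nat 4 i = L.length ∧
    ∀ (k : ℕ) (h : k < L.length), s.nat 6 (s.nat 5 i + k) = L[k]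

lemma IsBagList.congr {n : ℕ} {s s' : Memory} {i : ℕ} {X : Finset (Fin n)} (h : IsBagList s i X)
    (h4 : s'.nat 4 = s.nat 4) (h5 : s'.nat 5 = s.nat 5) (h6 : s'.nat 6 = s.nat 6) :
    IsBagList s' i X := by
  unfold IsBagList at *
  rwa [h4, h5, h6]

/-- The loop in which `v` ranges over the bag of a node; `k` is an auxiliary variable. -/
def forBag (k v : ℕ) (node : NatExp) (P : Program) : Program :=
  forLoop k (.read 4 node)
    (.seq (.setNat v (.const 0) (.read 6 (.add (.read 5 node) (reg k)))) P)

/-- Rule for loops over bags; the invariant and the potential depend on the set of those vertices of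
the bag that have already been treated. -/
lemma runs_forBag_potential {O : Oracles} {n k v : ℕ} {node : NatExp} {P : Program} {s : Memory}
    {i : ℕ} {X : Finset (Fin n)} {Inv : Finset (Fin n) → Memory → Prop} {Φ : Finset (Fin n) → ℕ}
    {Q : Memory → Prop} {B' : ℕ}
    (hX : IsBagList s i X)
    (hk : (Program.seq (.setNat v (.const 0) (.const 0)) P).writesNat k = false)
    (h4 : (forBag k v node P).writesNat 4 = false) (h5 : (forBag k v node P).writesNat 5 = false)
    (h6 : (forBag k v node P).writesNat 6 = false)
    (hnode : ∀ s', Frame (forBag k v node P) s s' → node.eval s' = i)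
    (hreg : ∀ A s x, Inv A s → Inv A (s.setReg k x))
    (hreg' : ∀ A s x, Inv A s → Inv A (s.setReg v x))
    (h0 : Inv ∅ s)
    (hstep : ∀ A ⊆ X, ∀ u ∈ X, u ∉ A → ∀ s', Frame (forBag k v node P) s s' →
      s'.nat v 0 = (u : ℕ) → Inv A s' →
      ∃ B, Φ A + B + 2 * node.cost + 19 ≤ Φ (insert u A) ∧ Runs O P s' B (Inv (insert u A)))
    (hQ : ∀ s', Frame (forBag k v node P) s s' → Inv X s' → Q s')
    (hB : Φ X + node.cost + 9 ≤ B' + Φ ∅) :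
    Runs O (forBag k v node P) s B' Q := by
  obtain ⟨L, hnd, rfl, hlen, hL⟩ := hX
  refine runs_forLoop_potential (N := L.length) (Inv := fun k => Inv (L.take k).toFinset)
    (Φ := fun k => Φ (L.take k).toFinset) (Q := Q) hk ?_ (fun _ => hreg _) (by simpa using h0)
    ?_ (fun s' hf hI => hQ s' hf (by simpa using hI)) ?_
  · intro s' hf
    rw [NatExp.eval, hnode s' hf, hf.nat 4 h4, hlen]
  · intro k' hk' s' hf hr hI
    have hu : L[k'] ∉ (L.take k').toFinset := by
      rw [List.mem_toFinset]
      intro hmem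
      obtain ⟨j, hj, e⟩ := List.mem_take_iff_getElem.1 hmem
      have := (List.Nodup.getElem_inj_iff hnd).1 e
      omega
    have hins : (L.take (k' + 1)).toFinset = insert L[k'] (L.take k').toFinset := by
      rw [List.take_add_one, List.getElem?_eq_getElem hk']
      simp only [Option.toList_some, List.toFinset_append, List.toFinset_cons, List.toFinset_nil,
        insert_empty_eq]
      rw [Finset.union_comm, Finset.insert_eq]
    have hsub : (L.take k').toFinset ⊆ L.toFinset := fun w hw =>
      List.mem_toFinset.2 (List.mem_of_mem_take (List.mem_toFinset.1 hw))
    have hval : (NatExp.read 6 (.add (.read 5 node) (reg k))).eval s' = (L[k'] : ℕ) := by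
      simp only [NatExp.eval, reg_eval, hnode s' hf, hf.nat 5 h5, hf.nat 6 h6, hr, hL k' hk']
    have hf' : Frame (forBag k v node P) s (s'.setReg v L[k']) := by
      refine hf.trans ⟨fun a ha => ?_, fun _ _ => rfl⟩
      have ha : ¬ a = v := by
        rintro rfl
        simp [forLoop, Program.writesNat] at ha
      simp [Memory.setReg, write_apply, ha]
    obtain ⟨B, hB, hrun⟩ := hstep _ hsub L[k'] (List.mem_toFinset.2 (List.getElem_mem _)) hu
      (s'.setReg v L[k']) hf' (by simp [Memory.setReg, write_apply]) (hreg' _ _ _ hI)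
    refine ⟨B + node.cost + 7, ?_, ?_⟩
    · rw [hins]
      simp only [NatExp.cost]
      omega
    · refine Runs.seq (B := node.cost + 7) (Q := fun t => t = s'.setReg v L[k'])
        (Runs.of_wp ?_ ?_) ?_ (by omega : node.cost + 7 + B ≤ B + node.cost + 7)
      · simp only [Program.wp, hval]; rfl
      · simp only [Program.maxCost, NatExp.cost, reg_cost]; omega
      · rintro _ - rfl
        rw [hins]
        exact hrun
  · simp only [NatExp.cost, List.take_length, List.take_zero, List.toFinset_nil]
    omega

/-- Rule for loops over bags whose iterations all halt within `B` steps. -/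
lemma runs_forBag {O : Oracles} {n k v : ℕ} {node : NatExp} {P : Program} {s : Memory}
    {i : ℕ} {X : Finset (Fin n)} (B : ℕ) (Inv : Finset (Fin n) → Memory → Prop)
    {Q : Memory → Prop} {B' : ℕ}
    (hX : IsBagList s i X)
    (hk : (Program.seq (.setNat v (.const 0) (.const 0)) P).writesNat k = false)
    (h4 : (forBag k v node P).writesNat 4 = false) (h5 : (forBag k v node P).writesNat 5 = false)
    (h6 : (forBag k v node P).writesNat 6 = false)
    (hnode : ∀ s', Frame (forBag k v node P) s s' → node.eval s' = i)
    (hreg : ∀ A s x, Inv A s → Inv A (s.setReg k x))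
    (hreg' : ∀ A s x, Inv A s → Inv A (s.setReg v x))
    (h0 : Inv ∅ s)
    (hstep : ∀ A ⊆ X, ∀ u ∈ X, u ∉ A → ∀ s', Frame (forBag k v node P) s s' →
      s'.nat v 0 = (u : ℕ) → Inv A s' → Runs O P s' B (Inv (insert u A)))
    (hQ : ∀ s', Frame (forBag k v node P) s s' → Inv X s' → Q s')
    (hB : X.card * (B + 2 * node.cost + 19) + node.cost + 9 ≤ B') :
    Runs O (forBag k v node P) s B' Q := by
  refine runs_forBag_potential (Φ := fun A => A.card * (B + 2 * node.cost + 19)) hX hk h4 h5 h6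
    hnode hreg hreg' h0 (fun A hA u hu huA s' hf hr hI => ⟨B, ?_, hstep A hA u hu huA s' hf hr hI⟩)
    hQ (by simpa using hB)
  rw [Finset.card_insert_of_notMem huA, Nat.succ_mul A.card]
  omega

/-! ### Enumerating the subsets of a bag -/

/-- Doubles the list of subsets: each of them is also listed with the additional vertex `u`, held by
the variable `30`. The variable `20` holds the number of subsets. -/
def extendSubsets : Program :=
  .seq
    (forLoop 31 (reg 20)
      (.seq (.setNat 17 (.add (reg 20) (reg 31)) (.add (.read 17 (reg 31)) (.read 8 (reg 30))))
      (.seq (.setNat 18 (.add (reg 20) (reg 31)) (.add (.read 18 (reg 31)) (.read 16 (reg 30))))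
      (.seq (.setRat 6 (.add (reg 20) (reg 31)) (.add (.read 6 (reg 31)) (.read 4 (reg 30))))
      (.seq (.setRat 7 (.add (reg 20) (reg 31)) (.read 7 (reg 31)))
      (.setRat 7 (reg 31) (.add (.read 7 (reg 31)) (.read 5 (reg 30)))))))))
    (.setNat 20 (.const 0) (.add (reg 20) (reg 20)))

/-- Lists the subsets of the set of those vertices of the bag of a node, held by the variable `21`,
that are marked in the array `15`. -/
def listSubsets : Program :=
  .seq (.seq (.setNat 20 (.const 0) (.const 1))
    (.seq (.setNat 17 (.const 0) (.const 0)) (.seq (.setNat 18 (.const 0) (.const 0))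
    (.seq (.setRat 6 (.const 0) .zero) (.setRat 7 (.const 0) .zero)))))
  (forBag 29 30 (reg 21) (.ite (.natLe (.const 1) (.read 15 (reg 30))) extendSubsets .skip))

/-- The weights of vertices from which the lists of subsets are computed. -/
structure SubsetWeights (n : ℕ) where
  W : Fin n → ℕ
  W' : Fin n → ℕ
  p : Fin n → ℚ
  q : Fin n → ℚ

/-- The memory holds the weights `W`, `W'`, `p` and `q` in the arrays `8` and `16`, and `4` and `5` of
rational numbers. -/
structure SubsetWeights.Loaded {n : ℕ} (w : SubsetWeights n) (s : Memory) : Prop where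
  W : ∀ u : Fin n, s.nat 8 u = w.W u
  W' : ∀ u : Fin n, s.nat 16 u = w.W' u
  p : ∀ u : Fin n, s.rat 4 u = w.p u
  q : ∀ u : Fin n, s.rat 5 u = w.q u

/-- The memory holds a list of all subsets of `A`, each represented by sums over it (arrays `17`,
`18`, and `6` of rational numbers) and over its complement in `A` (array `7` of rational numbers);
`g` maps the positions in the list to the subsets. -/
structure SubsetWeights.Listed {n : ℕ} (w : SubsetWeights n) (A : Finset (Fin n))
    (g : ℕ → Finset (Fin n)) (s : Memory) : Prop where
  bijOn : Set.BijOn g (Set.Iio (2 ^ A.card)) {S | S ⊆ A}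
  card : s.nat 20 0 = 2 ^ A.card
  W : ∀ x < 2 ^ A.card, s.nat 17 x = ∑ u ∈ g x, w.W u
  W' : ∀ x < 2 ^ A.card, s.nat 18 x = ∑ u ∈ g x, w.W' u
  p : ∀ x < 2 ^ A.card, s.rat 6 x = ∑ u ∈ g x, w.p u
  q : ∀ x < 2 ^ A.card, s.rat 7 x = ∑ u ∈ A \ g x, w.q u

/-- The list of the subsets of `A` is followed by the list of their unions with `{u}`. -/
lemma bijOn_subsets_insert {n : ℕ} {A : Finset (Fin n)} {g : ℕ → Finset (Fin n)} {u : Fin n}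
    (hu : u ∉ A) (hg : Set.BijOn g (Set.Iio (2 ^ A.card)) {S | S ⊆ A}) :
    Set.BijOn (fun x => if x < 2 ^ A.card then g x else insert u (g (x - 2 ^ A.card)))
      (Set.Iio (2 ^ (insert u A).card)) {S | S ⊆ insert u A} := by
  obtain ⟨hm, hi, hs⟩ := hg
  rw [Finset.card_insert_of_notMem hu, pow_succ]
  set N := 2 ^ A.card
  have hm' : ∀ x < N, g x ⊆ A := fun x hx => hm hx
  have hug : ∀ x < N, u ∉ g x := fun x hx h => hu (hm' x hx h)
  refine ⟨?_, ?_, ?_⟩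
  · intro x hx
    have hx : x < N * 2 := hx
    show (if x < N then g x else insert u (g (x - N))) ⊆ insert u A
    split_ifs with h
    · exact (hm' x h).trans (Finset.subset_insert _ _)
    · exact Finset.insert_subset_insert _ (hm' _ (by omega))
  · intro x hx y hy hxy
    have hx : x < N * 2 := hx
    have hy : y < N * 2 := hy
    dsimp only at hxy
    split_ifs at hxy with h1 h2 h2
    · exact hi h1 h2 hxy
    · exact absurd (hxy ▸ Finset.mem_insert_self _ _) (hug x h1)
    · exact absurd (hxy.symm ▸ Finset.mem_insert_self _ _) (hug y h2)
    · have := congrArg (fun S => Finset.erase S u) hxy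
      simp only [Finset.erase_insert (hug _ (by omega : x - N < N)),
        Finset.erase_insert (hug _ (by omega : y - N < N))] at this
      have := hi (show x - N < N by omega) (show y - N < N by omega) this
      omega
  · intro S hS
    have hS : S ⊆ insert u A := hS
    by_cases h : u ∈ S
    · have hS' : S.erase u ⊆ A := fun v hv => (Finset.mem_insert.1
        (hS (Finset.mem_of_mem_erase hv))).resolve_left (Finset.ne_of_mem_erase hv)
      obtain ⟨x, hx, e⟩ := hs hS'
      have hx : x < N := hx
      refine ⟨x + N, show x + N < N * 2 by omega, ?_⟩
      simp [e, Finset.insert_erase h]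
    · obtain ⟨x, hx, e⟩ := hs ((Finset.subset_insert_iff_of_notMem h).1 hS)
      have hx : x < N := hx
      refine ⟨x, show x < N * 2 by omega, ?_⟩
      simp [e, hx]

lemma runs_extendSubsets {O : Oracles} {n : ℕ} {w : SubsetWeights n} {A : Finset (Fin n)}
    {g : ℕ → Finset (Fin n)} {u : Fin n} {s : Memory} (hw : w.Loaded s) (hs : w.Listed A g s)
    (hu : u ∉ A) (hr : s.nat 30 0 = u) :
    Runs O extendSubsets s (100 * 2 ^ A.card) fun s' => ∃ g', w.Listed (insert u A) g' s' := by
  obtain ⟨hbij, hcard, hW, hW', hp, hq⟩ := hs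
  obtain ⟨N, hN⟩ : ∃ N, N = 2 ^ A.card := ⟨_, rfl⟩
  rw [← hN] at hbij hcard hW hW' hp hq ⊢
  have hNpos : 0 < N := by rw [hN]; positivity
  refine Runs.seq (B := N * 80 + 10) (B' := 7) (Q := fun s' => s'.nat 20 0 = N ∧
      (∀ x < N, s'.nat 17 x = s.nat 17 x ∧ s'.nat 18 x = s.nat 18 x ∧ s'.rat 6 x = s.rat 6 x ∧
        s'.rat 7 x = s.rat 7 x + w.q u) ∧
      (∀ x < N, s'.nat 17 (N + x) = s.nat 17 x + w.W u ∧
        s'.nat 18 (N + x) = s.nat 18 x + w.W' u ∧ s'.rat 6 (N + x) = s.rat 6 x + w.p u ∧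
        s'.rat 7 (N + x) = s.rat 7 x)) ?_ ?_ (by omega)
  · refine runs_forLoop N 60 (fun k s' =>
      (∀ x < N, s'.nat 17 x = s.nat 17 x ∧ s'.nat 18 x = s.nat 18 x ∧ s'.rat 6 x = s.rat 6 x ∧
        s'.rat 7 x = s.rat 7 x + if x < k then w.q u else 0) ∧
      (∀ x < k, s'.nat 17 (N + x) = s.nat 17 x + w.W u ∧
        s'.nat 18 (N + x) = s.nat 18 x + w.W' u ∧ s'.rat 6 (N + x) = s.rat 6 x + w.p u ∧
        s'.rat 7 (N + x) = s.rat 7 x)) rfl ?_ (fun _ _ _ h => h) (by simp) ?_ ?_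
        (by simp only [reg_cost]; omega)
    · intro s' hf
      rw [reg_eval, hf.nat 20 rfl, hcard]
    · rintro k hk s' hf hr' ⟨h1, h2⟩
      have e20 : s'.nat 20 0 = N := by rw [hf.nat 20 rfl, hcard]
      have e30 : s'.nat 30 0 = u := by rw [hf.nat 30 rfl, hr]
      have e8 : s'.nat 8 u = w.W u := by rw [hf.nat 8 rfl, hw.W]
      have e16 : s'.nat 16 u = w.W' u := by rw [hf.nat 16 rfl, hw.W']
      have e4 : s'.rat 4 u = w.p u := by rw [hf.rat 4 rfl, hw.p]
      have e5 : s'.rat 5 u = w.q u := by rw [hf.rat 5 rfl, hw.q]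
      obtain ⟨k1, k2, k3, k4⟩ := h1 k hk
      refine Runs.of_wp ?_ (by decide)
      simp only [Program.wp, NatExp.eval, RatExp.eval, reg_eval, write_apply, Function.update_apply,
        reduceIte, Nat.reduceEqDiff, e20, e30, e8, hr', e16, e4, e5, k1, k2, k3, k4]
      refine ⟨fun x hx => ?_, fun x hx => ?_⟩
      · obtain ⟨a1, a2, a3, a4⟩ := h1 x hx
        have hne : x ≠ N + k := by omega
        simp only [if_neg hne, a1, a2, a3, a4, true_and, lt_irrefl, if_false, add_zero, ite_self]
        rcases lt_trichotomy x k with h | rfl | h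
        · rw [if_neg h.ne, if_pos h, if_pos (by omega)]
        · rw [if_pos rfl, if_pos (by omega)]
        · rw [if_neg h.ne', if_neg (by omega), if_neg (by omega)]
      · have hne : N + x ≠ k := by omega
        simp only [if_neg hne, add_right_inj, lt_irrefl, if_false, add_zero]
        rcases Nat.lt_succ_iff_lt_or_eq.1 hx with h | rfl
        · simp only [if_neg h.ne, h2 x h, and_self]
        · simp only [if_true, and_self]
    · rintro s' hf ⟨h1, h2⟩
      refine ⟨by rw [hf.nat 20 rfl, hcard], fun x hx => ?_, h2⟩
      have := h1 x hx
      rwa [if_pos hx] at this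
  · rintro s' hf ⟨h1, h2, h3⟩
    refine Runs.of_wp ?_ (by decide)
    simp only [Program.wp, NatExp.eval, reg_eval, h1]
    refine ⟨_, bijOn_subsets_insert hu (hN ▸ hbij), ?_, ?_, ?_, ?_, ?_⟩ <;>
      simp only [write_apply, Function.update_apply, reduceIte, Nat.reduceEqDiff,
        Finset.card_insert_of_notMem hu, pow_succ, ← hN]
    · omega
    all_goals
      intro x hx
      have hsub : ∀ y < N, g y ⊆ A := fun y hy => hbij.1 hy
      have hux : ∀ y < N, u ∉ g y := fun y hy h => hu (hsub y hy h)
      split_ifs with h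
    · rw [(h2 x h).1, hW x h]
    · obtain ⟨y, rfl⟩ : ∃ y, x = N + y := ⟨x - N, by omega⟩
      have hy : y < N := by omega
      rw [(h3 y hy).1, Nat.add_sub_cancel_left, Finset.sum_insert (hux y hy), hW y hy, add_comm]
    · rw [(h2 x h).2.1, hW' x h]
    · obtain ⟨y, rfl⟩ : ∃ y, x = N + y := ⟨x - N, by omega⟩
      have hy : y < N := by omega
      rw [(h3 y hy).2.1, Nat.add_sub_cancel_left, Finset.sum_insert (hux y hy), hW' y hy, add_comm]
    · rw [(h2 x h).2.2.1, hp x h]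
    · obtain ⟨y, rfl⟩ : ∃ y, x = N + y := ⟨x - N, by omega⟩
      have hy : y < N := by omega
      rw [(h3 y hy).2.2.1, Nat.add_sub_cancel_left, Finset.sum_insert (hux y hy), hp y hy,
        add_comm]
    · rw [(h2 x h).2.2.2, hq x h, Finset.insert_sdiff_of_notMem _ (hux x h),
        Finset.sum_insert (by simp [hu]), add_comm]
    · obtain ⟨y, rfl⟩ : ∃ y, x = N + y := ⟨x - N, by omega⟩
      have hy : y < N := by omega
      have e : insert u A \ insert u (g y) = A \ g y := by
        ext v
        by_cases hv : v = u
        · simp [hv, hu]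
        · simp [hv]
      rw [(h3 y hy).2.2.2, Nat.add_sub_cancel_left, e, hq y hy]

/-- Running time and result of `listSubsets`. -/
lemma runs_listSubsets {O : Oracles} {n : ℕ} {w : SubsetWeights n} {X A : Finset (Fin n)}
    {s : Memory} {i : ℕ} (hw : w.Loaded s) (hX : IsBagList s i X) (hi : s.nat 21 0 = i)
    (hA : A ⊆ X) (hsel : ∀ u ∈ X, 1 ≤ s.nat 15 u ↔ u ∈ A) :
    Runs O listSubsets s (200 * (n + 1) * 2 ^ A.card) fun s' => ∃ g, w.Listed A g s' := by
  have hXn : X.card ≤ n := by simpa using Finset.card_le_univ X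
  have hpos : 1 ≤ 2 ^ A.card := Nat.one_le_two_pow
  refine Runs.seq (B := 20) (B' := X.card * (100 * 2 ^ A.card + 40) + 11)
    (Q := fun s' => ∃ g, w.Listed ∅ g s') (Runs.of_wp ?_ (by decide)) ?_ ?_
  · refine ⟨fun _ => ∅, ⟨fun _ _ => Finset.empty_subset _, ?_, ?_⟩, ?_, ?_, ?_, ?_, ?_⟩
    · intro x hx y hy _
      simp only [Finset.card_empty, pow_zero, Set.mem_Iio, Nat.lt_one_iff] at hx hy
      rw [hx, hy]
    · intro S hS
      exact ⟨0, by simp, (Finset.subset_empty.1 hS).symm⟩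
    all_goals simp [write_apply, NatExp.eval, RatExp.eval, Function.update_apply]
  · intro s₁ hf₁ h₁
    refine runs_forBag (100 * 2 ^ A.card + 10)
      (fun Z s' => ∃ g, w.Listed (Z.filter (· ∈ A)) g s')
      (hX.congr (hf₁.nat 4 rfl) (hf₁.nat 5 rfl) (hf₁.nat 6 rfl)) rfl rfl rfl rfl ?_
      (fun _ _ _ ⟨g, h⟩ => ⟨g, ⟨h.1, h.2, h.3, h.4, h.5, h.6⟩⟩)
      (fun _ _ _ ⟨g, h⟩ => ⟨g, ⟨h.1, h.2, h.3, h.4, h.5, h.6⟩⟩) (by simpa using h₁) ?_ ?_ ?_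
    · intro s' hf
      rw [reg_eval, hf.nat 21 rfl, hf₁.nat 21 rfl, hi]
    · rintro Z hZ u hu huZ s' hf hr ⟨g, hg⟩
      have hw' : w.Loaded s' := by
        refine ⟨fun v => ?_, fun v => ?_, fun v => ?_, fun v => ?_⟩
        · rw [hf.nat 8 rfl, hf₁.nat 8 rfl, hw.W]
        · rw [hf.nat 16 rfl, hf₁.nat 16 rfl, hw.W']
        · rw [hf.rat 4 rfl, hf₁.rat 4 rfl, hw.p]
        · rw [hf.rat 5 rfl, hf₁.rat 5 rfl, hw.q]
      have htest : (Test.natLe (.const 1) (.read 15 (reg 30))).holds O s' ↔ u ∈ A := by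
        simp only [Test.holds, NatExp.eval, reg_eval, hr]
        rw [hf.nat 15 rfl, hf₁.nat 15 rfl, hsel u hu]
      refine Runs.ite (B := 100 * 2 ^ A.card + 3) (fun h => ?_) (fun h => ?_)
        (by simp only [Test.cost, NatExp.cost, reg_cost]; omega)
      · have hu' := htest.1 h
        rw [Finset.filter_insert, if_pos hu']
        refine (runs_extendSubsets hw' hg (by simp [huZ]) hr).mono ?_ fun _ _ h => h
        have : (Z.filter (· ∈ A)).card ≤ A.card :=
          Finset.card_le_card fun v hv => (Finset.mem_filter.1 hv).2
        have := Nat.pow_le_pow_right (n := 2) (by norm_num) this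
        omega
      · rw [htest] at h
        rw [Finset.filter_insert, if_neg h]
        exact Runs.of_wp ⟨g, hg⟩ (by simp [Program.maxCost])
    · rintro s' - h
      rwa [Finset.filter_mem_eq_inter, Finset.inter_eq_right.2 hA] at h
    · simp only [reg_cost]
      have : X.card * (100 * 2 ^ A.card + 10 + 2 * 2 + 19) ≤
        X.card * (100 * 2 ^ A.card + 40) := Nat.mul_le_mul_left _ (by omega)
      omega
  · nlinarith [Nat.mul_le_mul hXn hpos, Nat.mul_le_mul hXn (le_refl (2 ^ A.card))]

/-! ### The memory of the dynamic program -/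

/-- The address at which the entries `Γ_i(l, S)`, for all `l`, start in the array of tables. Sets of
vertices are represented by the binary numbers that have them as sets of digits. -/
def rowAddr (n i : ℕ) (S : Finset (Fin n)) : ℕ :=
  i * 2 ^ n * (n + 1) + ∑ u ∈ S, 2 ^ (u : ℕ) * (n + 1)

/-- A set of digits represents a number with `n` binary digits. -/
lemma sum_two_pow_lt {n : ℕ} (S : Finset (Fin n)) : ∑ u ∈ S, 2 ^ (u : ℕ) < 2 ^ n := by
  have h : ∑ u ∈ S, 2 ^ (u : ℕ) = ∑ k ∈ S.map Fin.valEmbedding, 2 ^ k := by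
    rw [Finset.sum_map]; rfl
  rw [h]
  exact Nat.geomSum_lt le_rfl fun k hk => by
    obtain ⟨u, -, rfl⟩ := Finset.mem_map.1 hk
    exact u.2

lemma sum_two_pow_injective {n : ℕ} {S S' : Finset (Fin n)}
    (h : ∑ u ∈ S, 2 ^ (u : ℕ) = ∑ u ∈ S', 2 ^ (u : ℕ)) : S = S' := by
  have e : ∀ S : Finset (Fin n),
      ∑ u ∈ S, 2 ^ (u : ℕ) = ∑ k ∈ S.map Fin.valEmbedding, 2 ^ k := fun S => by
    rw [Finset.sum_map]; rfl
  rw [e, e] at h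
  exact Finset.map_injective _ (Finset.geomSum_injective le_rfl h)

lemma rowAddr_injective {n i i' l l' : ℕ} {S S' : Finset (Fin n)} (hl : l ≤ n) (hl' : l' ≤ n)
    (h : rowAddr n i S + l = rowAddr n i' S' + l') : i = i' ∧ S = S' ∧ l = l' := by
  have e : ∀ i (S : Finset (Fin n)) l, rowAddr n i S + l =
      l + (n + 1) * ((∑ u ∈ S, 2 ^ (u : ℕ)) + 2 ^ n * i) := by
    intro i S l
    rw [rowAddr, ← Finset.sum_mul]
    ring
  rw [e, e] at h
  have h1 := congrArg (· % (n + 1)) h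
  have h2 := congrArg (· / (n + 1)) h
  simp only [Nat.add_mul_mod_self_left, Nat.mod_eq_of_lt (Nat.lt_succ_of_le hl),
    Nat.mod_eq_of_lt (Nat.lt_succ_of_le hl')] at h1
  simp only [Nat.add_mul_div_left _ _ (Nat.succ_pos n), Nat.div_eq_of_lt (Nat.lt_succ_of_le hl),
    Nat.div_eq_of_lt (Nat.lt_succ_of_le hl'), zero_add] at h2
  have h3 := congrArg (· % 2 ^ n) h2
  have h4 := congrArg (· / 2 ^ n) h2
  simp only [Nat.add_mul_mod_self_left, Nat.mod_eq_of_lt (sum_two_pow_lt _)] at h3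
  simp only [Nat.add_mul_div_left _ _ (Nat.two_pow_pos n), Nat.div_eq_of_lt (sum_two_pow_lt _),
    zero_add] at h4
  exact ⟨h4, sum_two_pow_injective h3, h1⟩

lemma rowAddr_add_eq_iff {n i i' l l' : ℕ} {S S' : Finset (Fin n)} (hl : l ≤ n) (hl' : l' ≤ n) :
    rowAddr n i S + l = rowAddr n i' S' + l' ↔ i = i' ∧ S = S' ∧ l = l' := by
  refine ⟨rowAddr_injective hl hl', ?_⟩
  rintro ⟨rfl, rfl, rfl⟩
  rfl

lemma rowAddr_insert {n i : ℕ} {S : Finset (Fin n)} {v : Fin n} (hv : v ∉ S) :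
    rowAddr n i (insert v S) = rowAddr n i S + 2 ^ (v : ℕ) * (n + 1) := by
  rw [rowAddr, rowAddr, Finset.sum_insert hv]
  ring

/-- What the dynamic program needs to know about a tree decomposition of `G` with the nodes
`0, …, m - 1`, after an additional node `m` with an empty bag has been made the root. The set `Z j`
consists of the vertices that are in a bag below `j` but not in the bag of the parent of `j`. -/
structure ElimTree {n : ℕ} (m : ℕ) (G : WDigraph (Fin n)) where
  par : ℕ → ℕ
  dep : ℕ → ℕ
  bag : ℕ → Finset (Fin n)
  Z : ℕ → Finset (Fin n)
  par_le : ∀ j < m, par j ≤ m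
  dep_par : ∀ j < m, dep j = dep (par j) + 1
  dep_root : dep m = 0
  dep_le : ∀ j ≤ m, dep j ≤ m
  bag_root : bag m = ∅
  Z_eq : ∀ j < m, Z j =
    ((Finset.range m).filter (par · = j)).biUnion Z ∪ (bag j \ bag (par j))
  Z_disjoint_bag : ∀ j < m, Disjoint (Z j) (bag (par j))
  Z_disjoint : ∀ j < m, ∀ k < m, j ≠ k → par j = par k → Disjoint (Z j) (Z k)
  no_edge_bag : ∀ j < m, ∀ u ∈ Z j, ∀ w ∈ bag (par j) \ bag j, (u, w) ∉ G.edges ∧ (w, u) ∉ G.edges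
  no_edge : ∀ j < m, ∀ k < m, j ≠ k → par j = par k → ∀ u ∈ Z j, ∀ w ∈ Z k,
    (u, w) ∉ G.edges ∧ (w, u) ∉ G.edges
  cover : ((Finset.range m).filter (par · = m)).biUnion Z = Finset.univ

/-- The input as it has been prepared for the dynamic program: the parents and the bags (arrays `3`
to `6`), the weights of vertices in row addresses (array `8`), the addresses of the tables
(array `9`), the addresses of the rows of the adjacency matrix (array `10`), the depths of the nodes
(array `11`), and the adjacency matrix (array `2` of rational numbers). -/
structure Prepared {n m : ℕ} {G : WDigraph (Fin n)} (E : ElimTree m G) (s : Memory) : Prop where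
  vertices : s.nat 0 0 = n
  nodes : s.nat 0 2 = m
  parent : ∀ j < m, s.nat 3 j = E.par j
  bags : ∀ i ≤ m, IsBagList s i (E.bag i)
  weight : ∀ u : Fin n, s.nat 8 u = 2 ^ (u : ℕ) * (n + 1)
  base : ∀ i ≤ m, s.nat 9 i = i * 2 ^ n * (n + 1)
  row : ∀ u : Fin n, s.nat 10 u = u * n
  depth : ∀ j < m, s.nat 11 j = E.dep j
  arc : ∀ u v : Fin n, s.rat 2 (u * n + v) = G.arc u v

lemma Prepared.frame {n m : ℕ} {G : WDigraph (Fin n)} {E : ElimTree m G} {s s' : Memory}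
    {P : Program} (h : Prepared E s) (hf : Frame P s s')
    (hn : ∀ a ∈ [0, 3, 4, 5, 6, 8, 9, 10, 11], P.writesNat a = false)
    (hr : P.writesRat 2 = false) : Prepared E s' := by
  simp only [List.forall_mem_cons] at hn
  obtain ⟨h0, h3, h4, h5, h6, h8, h9, h10, h11, -⟩ := hn
  refine ⟨?_, ?_, ?_, fun i hi => (h.bags i hi).congr (hf.nat 4 h4) (hf.nat 5 h5) (hf.nat 6 h6),
    ?_, ?_, ?_, ?_, ?_⟩
  · rw [hf.nat 0 h0]; exact h.vertices
  · rw [hf.nat 0 h0]; exact h.nodes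
  · rw [hf.nat 3 h3]; exact h.parent
  · rw [hf.nat 8 h8]; exact h.weight
  · rw [hf.nat 9 h9]; exact h.base
  · rw [hf.nat 10 h10]; exact h.row
  · rw [hf.nat 11 h11]; exact h.depth
  · rw [hf.rat 2 hr]; exact h.arc

/-- The memory holds the table of the node `i` for the current bag `X` and the set `F` of forgotten
vertices: its size in the array `12`, its entries in the array `3` of rational numbers. -/
def HasTable {n : ℕ} (up : Bool) (G : WDigraph (Fin n)) (s : Memory) (i : ℕ)
    (X F : Finset (Fin n)) : Prop :=
  s.nat 12 i = F.card ∧ ∀ S ⊆ X, ∀ l ≤ F.card,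
    IsBest up (cutValues G X F l S) (s.rat 3 (rowAddr n i S + l))

/-- The tables of all nodes other than `j` are the same in both memories. -/
def SameTables (n : ℕ) (j : ℕ) (s s' : Memory) : Prop :=
  ∀ i ≠ j, s'.nat 12 i = s.nat 12 i ∧
    ∀ (S : Finset (Fin n)) (l : ℕ), l ≤ n →
      s'.rat 3 (rowAddr n i S + l) = s.rat 3 (rowAddr n i S + l)

lemma SameTables.trans {n j : ℕ} {s s' s'' : Memory} (h : SameTables n j s s')
    (h' : SameTables n j s' s'') : SameTables n j s s'' := fun i hi =>
  ⟨((h' i hi).1).trans (h i hi).1, fun S l hl => ((h' i hi).2 S l hl).trans ((h i hi).2 S l hl)⟩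

lemma HasTable.congr {n : ℕ} {up : Bool} {G : WDigraph (Fin n)} {s s' : Memory} {i j : ℕ}
    {X F : Finset (Fin n)} (h : HasTable up G s i X F) (hs : SameTables n j s s') (hi : i ≠ j) :
    HasTable up G s' i X F := by
  refine ⟨((hs i hi).1).trans h.1, fun S hS l hl => ?_⟩
  rw [(hs i hi).2 S l (hl.trans (by simpa using Finset.card_le_univ F))]
  exact h.2 S hS l hl

/-- The test whether the second of two values is at least as good as the first. -/
def dirTest (up : Bool) (r₁ r₂ : RatExp) : Test := if up then .ratLe r₁ r₂ else .ratLe r₂ r₁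

@[simp] lemma dirTest_holds (O : Oracles) (s : Memory) (up : Bool) (r₁ r₂ : RatExp) :
    (dirTest up r₁ r₂).holds O s ↔ DirLe up (r₁.eval s) (r₂.eval s) := by
  cases up <;> simp [dirTest, DirLe, Test.holds]

/-! ### Forgetting a vertex -/

/-- Computes an entry of the new table: the value obtained with the vertex outside of the set is
chosen if it is the only one (`l = 0`) or if it exists (`l ≤ a`) and is the better one. -/
def forgetEntry (up : Bool) : Program :=
  .ite
    (.and (.natLe (reg 33) (reg 39))
      (.not (.and (.not (.natLe (reg 33) (.const 0)))
        (.not (dirTest up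
          (.add (.read 3 (.add (reg 38) (.sub (reg 33) (.const 1)))) (.read 7 (reg 32)))
          (.add (.read 3 (.add (reg 37) (reg 33))) (.read 6 (reg 32))))))))
    (.setRat 3 (.add (reg 37) (reg 33))
      (.add (.read 3 (.add (reg 37) (reg 33))) (.read 6 (reg 32))))
    (.setRat 3 (.add (reg 37) (reg 33))
      (.add (.read 3 (.add (reg 38) (.sub (reg 33) (.const 1)))) (.read 7 (reg 32))))

/-- The new entries of the table for the `x`-th set, where `x` is held by the variable `32`. The
variables `37` and `38` hold the addresses of the old entries for this set and for its union with the
vertex, and `39` holds the number of vertices forgotten before. The entries are computed in place. -/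
def forgetRow (up : Bool) : Program :=
  .seq (.seq (.setNat 37 (.const 0) (.add (.read 9 (reg 22)) (.read 17 (reg 32))))
    (.setNat 38 (.const 0) (.add (reg 37) (.read 8 (reg 27)))))
  (forLoop 33 (.add (reg 39) (.const 2)) (forgetEntry up))

/-- The vertex `v`, held by the variable `27`, is forgotten in the table of the node held by the
variable `22`. The array `13` holds the characteristic function of the current bag. -/
def forgetVertex (up : Bool) : Program :=
  .seq (.setNat 13 (reg 27) (.const 0))
  (.seq (forLoop 28 (reg 0)
    (.seq (.setNat 15 (reg 28) (.read 13 (reg 28)))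
    (.seq (.setRat 4 (reg 28) (.read 2 (.add (.read 10 (reg 28)) (reg 27))))
      (.setRat 5 (reg 28) (.read 2 (.add (.read 10 (reg 27)) (reg 28)))))))
  (.seq (.seq (.setNat 21 (.const 0) (reg 22)) listSubsets)
  (.seq (.setNat 39 (.const 0) (.read 12 (reg 22)))
  (.seq (forLoop 32 (reg 20) (forgetRow up))
    (.setNat 12 (reg 22) (.add (reg 39) (.const 1)))))))

open Classical in
/-- The entry computed by `forgetEntry` from the values `x` with the vertex outside of the set and
the values `y` with the vertex in the set. -/
noncomputable def forgetValue (up : Bool) (a : ℕ) (x y : ℕ → ℚ) (l : ℕ) : ℚ :=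
  if l ≤ a ∧ (l = 0 ∨ DirLe up (y (l - 1)) (x l)) then x l else y (l - 1)

lemma isBest_forgetValue (up : Bool) {a l : ℕ} (hl : l ≤ a + 1) (x y : ℕ → ℚ) :
    IsBest up {z | (l ≤ a ∧ z = x l) ∨ ∃ k ≤ a, l = k + 1 ∧ z = y k} (forgetValue up a x y l) := by
  unfold forgetValue
  rcases Nat.eq_zero_or_pos l with rfl | hpos
  · simp only [Nat.zero_le, true_and, true_or, if_true]
    refine ⟨Or.inl rfl, ?_⟩
    rintro z (rfl | ⟨k, -, h, -⟩)
    · exact .refl _ _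
    · omega
  obtain ⟨k, rfl⟩ : ∃ k, l = k + 1 := ⟨l - 1, by omega⟩
  split_ifs with h
  · refine ⟨Or.inl ⟨h.1, rfl⟩, ?_⟩
    rintro z (⟨-, rfl⟩ | ⟨k', -, h', rfl⟩)
    · exact .refl _ _
    · obtain rfl : k' = k := by omega
      exact h.2.resolve_left (by omega)
  · refine ⟨Or.inr ⟨k, by omega, rfl, rfl⟩, ?_⟩
    rintro z (⟨h', rfl⟩ | ⟨k', -, h', rfl⟩)
    · exact (DirLe.total up _ _).resolve_right fun h'' => h ⟨h', Or.inr h''⟩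
    · obtain rfl : k' = k := by omega
      exact .refl _ _

lemma runs_forgetRow {O : Oracles} {up : Bool} {n m j k a : ℕ} {G : WDigraph (Fin n)}
    {E : ElimTree m G} {s : Memory} {S : Finset (Fin n)} {v : Fin n} (hE : Prepared E s)
    (hj : j ≤ m) (h22 : s.nat 22 0 = j) (h27 : s.nat 27 0 = v) (h32 : s.nat 32 0 = k)
    (h39 : s.nat 39 0 = a) (ha : a + 1 ≤ n) (hv : v ∉ S)
    (hS : s.nat 17 k = ∑ u ∈ S, 2 ^ (u : ℕ) * (n + 1)) :
    Runs O (forgetRow up) s (200 * (n + 1)) fun s' =>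
      ∀ i T l, l ≤ n → s'.rat 3 (rowAddr n i T + l) =
        if i = j ∧ T = S ∧ l ≤ a + 1 then
          forgetValue up a (fun l => s.rat 3 (rowAddr n j S + l) + s.rat 6 k)
            (fun l => s.rat 3 (rowAddr n j (insert v S) + l) + s.rat 7 k) l
        else s.rat 3 (rowAddr n i T + l) := by
  have hne : insert v S ≠ S := fun h => hv (h ▸ Finset.mem_insert_self v S)
  refine Runs.seq (B := 20) (B' := (a + 2) * 100 + 13) (Q := fun s' =>
    s'.nat 37 0 = rowAddr n j S ∧ s'.nat 38 0 = rowAddr n j (insert v S))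
    (Runs.of_wp ?_ (by decide)) ?_ (by omega)
  · simp only [Program.wp, NatExp.eval, reg_eval, write_apply, Function.update_apply, reduceIte,
      Nat.reduceEqDiff, h22, h27, h32, hE.base j hj, hE.weight, hS, rowAddr_insert hv]
    exact ⟨rfl, rfl⟩
  · rintro s₁ hf₁ ⟨h37, h38⟩
    refine runs_forLoop (a + 2) 80 (fun k' s' => ∀ i T l, l ≤ n → s'.rat 3 (rowAddr n i T + l) =
        if i = j ∧ T = S ∧ l < k' then
          forgetValue up a (fun l => s.rat 3 (rowAddr n j S + l) + s.rat 6 k)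
            (fun l => s.rat 3 (rowAddr n j (insert v S) + l) + s.rat 7 k) l
        else s.rat 3 (rowAddr n i T + l)) rfl ?_ (fun _ _ _ h => h) ?_ ?_ ?_ ?_
    · intro s' hf
      rw [NatExp.eval, reg_eval, hf.nat 39 rfl, hf₁.nat 39 rfl, h39, NatExp.eval]
    · intro i T l hl
      simp [hf₁.rat 3 rfl]
    · intro l hl s' hf hr hI
      have e39 : s'.nat 39 0 = a := by rw [hf.nat 39 rfl, hf₁.nat 39 rfl, h39]
      have e32 : s'.nat 32 0 = k := by rw [hf.nat 32 rfl, hf₁.nat 32 rfl, h32]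
      have e37 : s'.nat 37 0 = rowAddr n j S := by rw [hf.nat 37 rfl, h37]
      have e38 : s'.nat 38 0 = rowAddr n j (insert v S) := by rw [hf.nat 38 rfl, h38]
      have e6 : s'.rat 6 = s.rat 6 := by rw [hf.rat 6 rfl, hf₁.rat 6 rfl]
      have e7 : s'.rat 7 = s.rat 7 := by rw [hf.rat 7 rfl, hf₁.rat 7 rfl]
      have v1 : s'.rat 3 (rowAddr n j S + l) = s.rat 3 (rowAddr n j S + l) := by
        rw [hI j S l (by omega), if_neg (by omega)]
      have v2 : s'.rat 3 (rowAddr n j (insert v S) + (l - 1)) =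
          s.rat 3 (rowAddr n j (insert v S) + (l - 1)) := by
        rw [hI j _ _ (by omega), if_neg (fun h => hne h.2.1)]
      refine Runs.of_wp ?_ (by cases up <;> decide)
      simp only [forgetEntry, Program.wp, NatExp.eval, RatExp.eval, reg_eval, Test.holds,
        dirTest_holds, e39, e32, e37, e38, e6, e7, hr, v1, v2, write_apply, reduceIte,
        Function.update_apply]
      set val := forgetValue up a (fun l => s.rat 3 (rowAddr n j S + l) + s.rat 6 k)
        (fun l => s.rat 3 (rowAddr n j (insert v S) + l) + s.rat 7 k)
      have step : ∀ z, val l = z → ∀ i T l', l' ≤ n →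
          (if rowAddr n i T + l' = rowAddr n j S + l then z else s'.rat 3 (rowAddr n i T + l')) =
          if i = j ∧ T = S ∧ l' < l + 1 then val l' else s.rat 3 (rowAddr n i T + l') := by
        rintro z rfl i T l' hl'
        rw [hI i T l' hl']
        simp only [rowAddr_add_eq_iff hl' (show l ≤ n by omega)]
        by_cases h : i = j ∧ T = S
        · rcases lt_trichotomy l' l with h' | rfl | h'
          · rw [if_neg (by omega), if_pos ⟨h.1, h.2, h'⟩, if_pos ⟨h.1, h.2, by omega⟩]
          · rw [if_pos ⟨h.1, h.2, rfl⟩, if_pos ⟨h.1, h.2, by omega⟩]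
          · rw [if_neg (by omega), if_neg (by omega), if_neg (by omega)]
        · rw [if_neg (by tauto), if_neg (by tauto), if_neg (by tauto)]
      constructor
      · intro hc
        refine step _ (if_pos ⟨hc.1, ?_⟩)
        by_contra hcon
        rw [not_or] at hcon
        exact hc.2 ⟨by omega, hcon.2⟩
      · intro hc
        refine step _ (if_neg fun hcon => hc ⟨hcon.1, fun h => ?_⟩)
        rcases hcon.2 with h' | h'
        · exact h.1 (by omega)
        · exact h.2 h'
    · intro s' hf hI i T l hl
      rw [hI i T l hl]
      simp only [Nat.lt_succ_iff]
    · simp only [NatExp.cost, reg_cost]; omega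

lemma two_pow_card_le {n : ℕ} {A X : Finset (Fin n)} (h : A ⊆ X) : 2 ^ A.card ≤ 2 ^ X.card :=
  Nat.pow_le_pow_right (by norm_num) (Finset.card_le_card h)

lemma runs_forgetVertex {O : Oracles} {up : Bool} {n m j : ℕ} {G : WDigraph (Fin n)}
    {E : ElimTree m G} {s : Memory} {X F : Finset (Fin n)} {v : Fin n} (hE : Prepared E s)
    (hj : j ≤ m) (h22 : s.nat 22 0 = j) (h27 : s.nat 27 0 = v) (hX : X ⊆ E.bag j) (hvX : v ∈ X)
    (hvF : v ∉ F) (h13 : ∀ u : Fin n, s.nat 13 u = if u ∈ X then 1 else 0)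
    (hT : HasTable up G s j X F) :
    Runs O (forgetVertex up) s (1000 * (n + 1) * 2 ^ (E.bag j).card) fun s' =>
      HasTable up G s' j (X.erase v) (insert v F) ∧ SameTables n j s s' ∧
        ∀ u : Fin n, s'.nat 13 u = if u ∈ X.erase v then 1 else 0 := by
  set K := 2 ^ (E.bag j).card with hK
  have hA : X.erase v ⊆ E.bag j := (Finset.erase_subset _ _).trans hX
  have hAK : 2 ^ (X.erase v).card ≤ K := two_pow_card_le hA
  have hKpos : 1 ≤ K := Nat.one_le_two_pow
  have hFn : F.card + 1 ≤ n := by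
    rw [← Finset.card_insert_of_notMem hvF]
    simpa using Finset.card_le_univ (insert v F)
  -- the characteristic function of the new bag
  refine Runs.seq (B := 10) (B' := 900 * (n + 1) * K) (Q := fun s' =>
    ∀ u : Fin n, s'.nat 13 u = if u ∈ X.erase v then 1 else 0) (Runs.of_wp ?_ (by decide)) ?_
    (by nlinarith)
  · intro u
    simp only [NatExp.eval, reg_eval, write_apply, Function.update_apply, reduceIte, h27,
      Fin.val_inj, h13, Finset.mem_erase]
    by_cases h : u = v <;> simp [h]
  intro s₁ hf₁ h13'
  -- the weights of the edges between `v` and the other vertices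
  refine Runs.seq (B := n * 60 + 20) (B' := 800 * (n + 1) * K) (Q := fun s' =>
    ∀ u : Fin n, s'.nat 15 u = s₁.nat 13 u ∧ s'.rat 4 u = G.arc u v ∧ s'.rat 5 u = G.arc v u)
    ?_ ?_ (by nlinarith)
  · refine runs_forLoop n 40 (fun k s' => ∀ u : Fin n, (u : ℕ) < k →
      s'.nat 15 u = s₁.nat 13 u ∧ s'.rat 4 u = G.arc u v ∧ s'.rat 5 u = G.arc v u) rfl ?_
      (fun _ _ _ h => h) (fun u hu => absurd hu (Nat.not_lt_zero _)) ?_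
      (fun s' _ h u => h u u.2) (by simp only [reg_cost]; omega)
    · intro s' hf
      rw [reg_eval, hf.nat 0 rfl, hf₁.nat 0 rfl, hE.vertices]
    · intro k hk s' hf hr hI
      refine Runs.of_wp ?_ (by decide)
      have e27 : s'.nat 27 0 = v := by rw [hf.nat 27 rfl, hf₁.nat 27 rfl, h27]
      have e13 : s'.nat 13 = s₁.nat 13 := hf.nat 13 rfl
      have hE' := (hE.frame hf₁ (by decide) rfl).frame hf (by decide) rfl
      have a1 := hE'.arc ⟨k, hk⟩ v
      have a2 := hE'.arc v ⟨k, hk⟩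
      have r1 := hE'.row ⟨k, hk⟩
      have r2 := hE'.row v
      dsimp only at a1 a2 r1 r2
      simp only [Program.wp, NatExp.eval, RatExp.eval, reg_eval, write_apply, Function.update_apply,
        reduceIte, Nat.reduceEqDiff, hr, e13, e27, r1, r2, a1, a2]
      intro u hu
      by_cases h : (u : ℕ) = k
      · obtain rfl : u = ⟨k, hk⟩ := Fin.ext h
        simp
      · simpa only [if_neg h] using hI u (by omega)
  intro s₂ hf₂ hw
  have hE₂ := (hE.frame hf₁ (by decide) rfl).frame hf₂ (by decide) rfl
  -- the subsets of the new bag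
  let w : SubsetWeights n :=
    ⟨fun u => 2 ^ (u : ℕ) * (n + 1), fun u => s₂.nat 16 u, fun u => G.arc u v, fun u => G.arc v u⟩
  refine Runs.seq (B := 250 * (n + 1) * K) (B' := 500 * (n + 1) * K) (Q := fun s' =>
    ∃ g, w.Listed (X.erase v) g s') ?_ ?_ (by nlinarith)
  · refine Runs.seq (B := 10) (B' := 200 * (n + 1) * 2 ^ (X.erase v).card)
      (Q := fun s' => s'.nat 21 0 = j) (Runs.of_wp ?_ (by decide)) ?_ (by nlinarith)
    · simp only [Program.wp, NatExp.eval, reg_eval, write_apply, Function.update_apply, reduceIte]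
      rw [hf₂.nat 22 rfl, hf₁.nat 22 rfl, h22]
    · intro s' hf h21
      have hE' := hE₂.frame hf (by decide) rfl
      refine runs_listSubsets ⟨hE'.weight, fun u => ?_, fun u => ?_, fun u => ?_⟩
        (hE'.bags j hj) h21
        hA fun u hu => ?_
      · rw [hf.nat 16 rfl]
      · rw [hf.rat 4 rfl]; exact (hw u).2.1
      · rw [hf.rat 5 rfl]; exact (hw u).2.2
      · rw [hf.nat 15 rfl, (hw u).1, h13' u]
        split_ifs with h <;> simp [h]
  rintro s₃ hf₃ ⟨g, hg⟩
  have hE₃ := hE₂.frame hf₃ (by decide) rfl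
  have hrat : s₃.rat 3 = s.rat 3 := by rw [hf₃.rat 3 rfl, hf₂.rat 3 rfl, hf₁.rat 3 rfl]
  have h12 : s₃.nat 12 = s.nat 12 := by rw [hf₃.nat 12 rfl, hf₂.nat 12 rfl, hf₁.nat 12 rfl]
  refine Runs.seq (B := 10) (B' := 400 * (n + 1) * K) (Q := fun s' => s'.nat 39 0 = F.card)
    (Runs.of_wp ?_ (by decide)) ?_ (by nlinarith)
  · simp only [Program.wp, NatExp.eval, reg_eval, write_apply, Function.update_apply, reduceIte]
    rw [h12, hf₃.nat 22 rfl, hf₂.nat 22 rfl, hf₁.nat 22 rfl, h22, hT.1]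
  intro s₄ hf₄ h39
  have hE₄ := hE₃.frame hf₄ (by decide) rfl
  have hrat₄ : s₄.rat 3 = s.rat 3 := by rw [hf₄.rat 3 rfl, hrat]
  have e22 : s₄.nat 22 0 = j := by
    rw [hf₄.nat 22 rfl, hf₃.nat 22 rfl, hf₂.nat 22 rfl, hf₁.nat 22 rfl, h22]
  have e27 : s₄.nat 27 0 = v := by
    rw [hf₄.nat 27 rfl, hf₃.nat 27 rfl, hf₂.nat 27 rfl, hf₁.nat 27 rfl, h27]
  have hcount : ∀ x < 2 ^ (X.erase v).card, v ∉ g x := fun x hx h =>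
    Finset.notMem_erase v X (hg.bijOn.1 hx h)
  -- the rows of the new table
  let new : Finset (Fin n) → ℕ → ℚ := fun S => forgetValue up F.card
    (fun l => s.rat 3 (rowAddr n j S + l) + ∑ u ∈ S, G.arc u v)
    (fun l => s.rat 3 (rowAddr n j (insert v S) + l) + ∑ u ∈ X.erase v \ S, G.arc v u)
  refine Runs.seq (B := K * (200 * (n + 1) + 13) + 10) (B' := 10) (Q := fun s' =>
      (∀ S ⊆ X.erase v, ∀ l ≤ F.card + 1, s'.rat 3 (rowAddr n j S + l) = new S l) ∧
      ∀ i ≠ j, ∀ (S : Finset (Fin n)) l, l ≤ n →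
        s'.rat 3 (rowAddr n i S + l) = s.rat 3 (rowAddr n i S + l)) ?_ ?_ (by nlinarith)
  · refine runs_forLoop (2 ^ (X.erase v).card) (200 * (n + 1)) (fun k s' =>
      (∀ x < k, ∀ l ≤ F.card + 1, s'.rat 3 (rowAddr n j (g x) + l) = new (g x) l) ∧
      ∀ i (S : Finset (Fin n)) l, l ≤ n → (i = j → ∀ x < k, S ≠ g x) →
        s'.rat 3 (rowAddr n i S + l) = s.rat 3 (rowAddr n i S + l)) rfl ?_
      (fun _ _ _ h => h) ?_ ?_ ?_ ?_
    · intro s' hf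
      rw [reg_eval, hf.nat 20 rfl, hf₄.nat 20 rfl, hg.card]
    · exact ⟨fun x hx => absurd hx (Nat.not_lt_zero _), fun i S l _ _ => by rw [hrat₄]⟩
    · rintro k hk s' hf hr ⟨hI, hI'⟩
      have hE' := hE₄.frame hf (by cases up <;> decide) rfl
      refine (runs_forgetRow (S := g k) (v := v) hE' hj (by rw [hf.nat 22 rfl, e22])
        (by rw [hf.nat 27 rfl, e27]) hr (by rw [hf.nat 39 rfl, h39]) hFn (hcount k hk)
        (by rw [hf.nat 17 rfl, hf₄.nat 17 rfl, hg.W k hk])).mono le_rfl ?_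
      intro s'' _ h
      have hdiff : ∀ x < k, g k ≠ g x := fun x hx e => by
        have := hg.bijOn.2.1 hk (lt_trans hx hk) e
        omega
      constructor
      · intro x hx l hl
        rw [h j (g x) l (by omega)]
        rcases Nat.lt_succ_iff_lt_or_eq.1 hx with hx' | rfl
        · rw [if_neg (fun hc => hdiff x hx' hc.2.1.symm), hI x hx' l hl]
        · rw [if_pos ⟨rfl, rfl, hl⟩]
          have c0 : s'.rat 6 x = ∑ u ∈ g x, G.arc u v := by
            rw [hf.rat 6 rfl, hf₄.rat 6 rfl, hg.p x hk]
          have c1 : s'.rat 7 x = ∑ u ∈ X.erase v \ g x, G.arc v u := by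
            rw [hf.rat 7 rfl, hf₄.rat 7 rfl, hg.q x hk]
          have hcong : ∀ (x₁ y₁ x₂ y₂ : ℕ → ℚ), (∀ l ≤ n, x₁ l = x₂ l) → (∀ l ≤ n, y₁ l = y₂ l) →
              forgetValue up F.card x₁ y₁ l = forgetValue up F.card x₂ y₂ l := by
            intro x₁ y₁ x₂ y₂ h1 h2
            unfold forgetValue
            rw [h1 l (by omega), h2 (l - 1) (by omega)]
          refine hcong _ _ _ _ (fun l hl => ?_) (fun l hl => ?_)
          · rw [hI' j (g x) l hl fun _ => hdiff, c0]
          · rw [hI' j _ l hl fun _ y hy e => hcount y (lt_trans hy hk)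
              (e ▸ Finset.mem_insert_self _ _), c1]
      · intro i S l hl hne
        rw [h i S l hl, if_neg (fun hc => hne hc.1 k (Nat.lt_succ_self k) hc.2.1),
          hI' i S l hl fun e x hx => hne e x (Nat.lt_succ_of_lt hx)]
    · rintro s' - ⟨hI, hI'⟩
      refine ⟨fun S hS l hl => ?_, fun i hi S l hl => hI' i S l hl fun e => absurd e hi⟩
      obtain ⟨x, hx, rfl⟩ := hg.bijOn.2.2 hS
      exact hI x hx l hl
    · have := Nat.mul_le_mul_right (200 * (n + 1) + 13) hAK
      simp only [reg_cost]
      nlinarith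
  rintro s₅ hf₅ ⟨hnew, hother⟩
  refine Runs.of_wp ?_ (by decide)
  have e39 : s₅.nat 39 0 = F.card := by rw [hf₅.nat 39 rfl, h39]
  have e22' : s₅.nat 22 0 = j := by rw [hf₅.nat 22 rfl, e22]
  have e12 : s₅.nat 12 = s.nat 12 := by rw [hf₅.nat 12 rfl, hf₄.nat 12 rfl, h12]
  simp only [Program.wp, NatExp.eval, reg_eval, e39, e22']
  refine ⟨⟨?_, ?_⟩, fun i hi => ⟨?_, hother i hi⟩, ?_⟩
  · simp [write_apply, Finset.card_insert_of_notMem hvF]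
  · intro S hS l hl
    rw [Finset.card_insert_of_notMem hvF] at hl
    have hvS : v ∉ S := fun h => Finset.notMem_erase v X (hS h)
    have hSX : S ⊆ X := hS.trans (Finset.erase_subset _ _)
    rw [isBest_cutValues_forget hvX hvF hvS (hT.2 S hSX) (hT.2 _ (Finset.insert_subset hvX hSX)),
      hnew S hS l hl]
    have e1 : G.between S {v} = ∑ u ∈ S, G.arc u v := by
      simp [WDigraph.between_eq_sum]
    have e2 : G.between {v} (X.erase v \ S) = ∑ u ∈ X.erase v \ S, G.arc v u := by
      simp [WDigraph.between_eq_sum]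
    rw [e1, e2]
    exact isBest_forgetValue up hl _ _
  · simp [write_apply, hi, e12]
  · intro u
    have : s₅.nat 13 = s₁.nat 13 := by
      rw [hf₅.nat 13 rfl, hf₄.nat 13 rfl, hf₃.nat 13 rfl, hf₂.nat 13 rfl]
    simp only [write_apply, reduceIte, Nat.reduceEqDiff, this, h13' u]

/-! ### Merging the table of a node into that of its parent -/

/-- Improves the entry of the array `8` for `l₁ + l₂` by the sum of the entries of two tables for
`l₁` and for `l₂`. If `l₁ = 0` or `l₂` is maximal, this is the first value for `l₁ + l₂`. -/
def mergeEntry (up : Bool) : Program :=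
  .ite
    (.not (.and (.not (.natLe (reg 33) (.const 0))) (.and (.not (.natLe (reg 40) (reg 34)))
      (.not (dirTest up (.read 8 (.add (reg 33) (reg 34)))
        (.add (.read 3 (.add (reg 37) (reg 33))) (.read 3 (.add (reg 38) (reg 34)))))))))
    (.setRat 8 (.add (reg 33) (reg 34))
      (.add (.read 3 (.add (reg 37) (reg 33))) (.read 3 (.add (reg 38) (reg 34)))))
    .skip

/-- The new entries of the table for the `x`-th set, where `x` is held by the variable `32`. The
variables `37` and `38` hold the addresses of the entries in the two tables, and `39` and `40` hold the
numbers of vertices forgotten there. The new entries are collected in the array `8` before the old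
ones, which are needed for all of them, are overwritten. -/
def mergeRow (up : Bool) : Program :=
  .seq (.seq (.setNat 37 (.const 0) (.add (.read 9 (reg 23)) (.read 17 (reg 32))))
    (.setNat 38 (.const 0) (.add (.read 9 (reg 22)) (.read 18 (reg 32)))))
  (.seq (forLoop 33 (.add (reg 39) (.const 1))
      (forLoop 34 (.add (reg 40) (.const 1)) (mergeEntry up)))
    (forLoop 35 (.add (.add (reg 39) (reg 40)) (.const 1))
      (.setRat 3 (.add (reg 37) (reg 35)) (.read 8 (reg 35)))))

/-- Merges the table of the node held by the variable `22`, whose current bag has the characteristic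
function given by the array `13`, into the table of the node held by the variable `23`. -/
def mergeTables (up : Bool) : Program :=
  .seq (forLoop 28 (reg 0)
    (.seq (.setNat 15 (reg 28) (.const 1))
      (.ite (.natLe (.const 1) (.read 13 (reg 28)))
        (.setNat 16 (reg 28) (.read 8 (reg 28))) (.setNat 16 (reg 28) (.const 0)))))
  (.seq (.seq (.setNat 21 (.const 0) (reg 23)) listSubsets)
  (.seq (.seq (.setNat 39 (.const 0) (.read 12 (reg 23)))
    (.setNat 40 (.const 0) (.read 12 (reg 22))))
  (.seq (forLoop 32 (reg 20) (mergeRow up))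
    (.setNat 12 (reg 23) (.add (reg 39) (reg 40))))))

/-- The sums of entries `x l₁` and `y l₂` with `l₁ + l₂ = l` for those pairs `(l₁, l₂)` that are
lexicographically smaller than `(k₁, k₂)`. -/
def mergeSums (a b : ℕ) (x y : ℕ → ℚ) (k₁ k₂ l : ℕ) : Set ℚ :=
  {z | ∃ m₁ ≤ a, ∃ m₂ ≤ b, (m₁ < k₁ ∨ m₁ = k₁ ∧ m₂ < k₂) ∧ m₁ + m₂ = l ∧ z = x m₁ + y m₂}

/-- The function `t` has the best of these sums as its values, as far as there are any. -/
def MergedUpTo (up : Bool) (a b : ℕ) (x y : ℕ → ℚ) (k₁ k₂ : ℕ) (t : ℕ → ℚ) : Prop :=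
  ∀ l, (mergeSums a b x y k₁ k₂ l).Nonempty → IsBest up (mergeSums a b x y k₁ k₂ l) (t l)

lemma mergeSums_next_row (a b : ℕ) (x y : ℕ → ℚ) (k₁ l : ℕ) :
    mergeSums a b x y k₁ (b + 1) l = mergeSums a b x y (k₁ + 1) 0 l := by
  ext z
  constructor
  · rintro ⟨m₁, h₁, m₂, h₂, h, hl, hz⟩
    exact ⟨m₁, h₁, m₂, h₂, by omega, hl, hz⟩
  · rintro ⟨m₁, h₁, m₂, h₂, h, hl, hz⟩
    exact ⟨m₁, h₁, m₂, h₂, by omega, hl, hz⟩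

lemma MergedUpTo.step_of_le {up : Bool} {a b k₁ k₂ : ℕ} {x y t : ℕ → ℚ}
    (h : MergedUpTo up a b x y k₁ k₂ t) (h₁ : k₁ ≤ a) (h₂ : k₂ ≤ b)
    (hc : k₁ = 0 ∨ b ≤ k₂ ∨ DirLe up (t (k₁ + k₂)) (x k₁ + y k₂)) :
    MergedUpTo up a b x y k₁ (k₂ + 1) (Function.update t (k₁ + k₂) (x k₁ + y k₂)) := by
  rintro l ⟨z, m₁, hm₁, m₂, hm₂, hm, rfl, hz⟩
  by_cases hl : m₁ + m₂ = k₁ + k₂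
  · rw [hl, Function.update_self]
    refine ⟨⟨k₁, h₁, k₂, h₂, by omega, rfl, rfl⟩, ?_⟩
    rintro _ ⟨p₁, hp₁, p₂, hp₂, hp, hpl, rfl⟩
    by_cases hk : p₁ = k₁
    · obtain rfl : p₂ = k₂ := by omega
      rw [hk]
      exact .refl _ _
    have hmem : x p₁ + y p₂ ∈ mergeSums a b x y k₁ k₂ (k₁ + k₂) :=
      ⟨p₁, hp₁, p₂, hp₂, by omega, hpl, rfl⟩
    rcases hc with hc | hc | hc
    · omega
    · omega
    · exact ((h _ ⟨_, hmem⟩).2 _ hmem).trans hc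
  · have e : mergeSums a b x y k₁ (k₂ + 1) (m₁ + m₂) = mergeSums a b x y k₁ k₂ (m₁ + m₂) := by
      ext z
      constructor
      · rintro ⟨p₁, hp₁, p₂, hp₂, hp, hpl, hz⟩
        exact ⟨p₁, hp₁, p₂, hp₂, by omega, hpl, hz⟩
      · rintro ⟨p₁, hp₁, p₂, hp₂, hp, hpl, hz⟩
        exact ⟨p₁, hp₁, p₂, hp₂, by omega, hpl, hz⟩
    rw [Function.update_of_ne hl, e]
    exact h _ ⟨z, m₁, hm₁, m₂, hm₂, by omega, rfl, hz⟩

lemma MergedUpTo.step_of_not_le {up : Bool} {a b k₁ k₂ : ℕ} {x y t : ℕ → ℚ}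
    (h : MergedUpTo up a b x y k₁ k₂ t) (h₁ : k₁ ≤ a)
    (hc : ¬ (k₁ = 0 ∨ b ≤ k₂ ∨ DirLe up (t (k₁ + k₂)) (x k₁ + y k₂))) :
    MergedUpTo up a b x y k₁ (k₂ + 1) t := by
  rw [not_or, not_or] at hc
  rintro l ⟨z, m₁, hm₁, m₂, hm₂, hm, rfl, hz⟩
  by_cases hl : m₁ + m₂ = k₁ + k₂
  · -- the pair `(k₁ - 1, k₂ + 1)` has been taken into account before
    have hmem : x (k₁ - 1) + y (k₂ + 1) ∈ mergeSums a b x y k₁ k₂ (k₁ + k₂) :=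
      ⟨k₁ - 1, by omega, k₂ + 1, by omega, by omega, by omega, rfl⟩
    obtain ⟨⟨q₁, hq₁, q₂, hq₂, hq, hql, hqz⟩, hbest⟩ := h _ ⟨_, hmem⟩
    rw [hl]
    refine ⟨⟨q₁, hq₁, q₂, hq₂, by omega, hql, hqz⟩, ?_⟩
    rintro _ ⟨p₁, hp₁, p₂, hp₂, hp, hpl, rfl⟩
    by_cases hk : p₁ = k₁
    · obtain rfl : p₂ = k₂ := by omega
      rw [hk]
      exact (DirLe.total up _ _).resolve_right hc.2.2
    · exact hbest _ ⟨p₁, hp₁, p₂, hp₂, by omega, hpl, rfl⟩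
  · have e : mergeSums a b x y k₁ (k₂ + 1) (m₁ + m₂) = mergeSums a b x y k₁ k₂ (m₁ + m₂) := by
      ext z
      constructor
      · rintro ⟨p₁, hp₁, p₂, hp₂, hp, hpl, hz⟩
        exact ⟨p₁, hp₁, p₂, hp₂, by omega, hpl, hz⟩
      · rintro ⟨p₁, hp₁, p₂, hp₂, hp, hpl, hz⟩
        exact ⟨p₁, hp₁, p₂, hp₂, by omega, hpl, hz⟩
    rw [e]
    exact h _ ⟨z, m₁, hm₁, m₂, hm₂, by omega, rfl, hz⟩

lemma runs_mergeRow {O : Oracles} {up : Bool} {n m i j k a b : ℕ} {G : WDigraph (Fin n)}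
    {E : ElimTree m G} {s : Memory} {S S' : Finset (Fin n)} (hE : Prepared E s)
    (hi : i ≤ m) (hj : j ≤ m) (h22 : s.nat 22 0 = j) (h23 : s.nat 23 0 = i) (h32 : s.nat 32 0 = k)
    (h39 : s.nat 39 0 = a) (h40 : s.nat 40 0 = b) (hab : a + b ≤ n)
    (hS : s.nat 17 k = ∑ u ∈ S, 2 ^ (u : ℕ) * (n + 1))
    (hS' : s.nat 18 k = ∑ u ∈ S', 2 ^ (u : ℕ) * (n + 1)) :
    Runs O (mergeRow up) s (200 * ((a + 1) * (b + 1)) + 100 * (n + 1)) fun s' =>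
      (∀ l ≤ a + b, IsBest up
        {z | ∃ l₁ ≤ a, ∃ l₂ ≤ b, l₁ + l₂ = l ∧
          z = s.rat 3 (rowAddr n i S + l₁) + s.rat 3 (rowAddr n j S' + l₂)}
        (s'.rat 3 (rowAddr n i S + l))) ∧
      ∀ i' T l, l ≤ n → (i' = i → T ≠ S) →
        s'.rat 3 (rowAddr n i' T + l) = s.rat 3 (rowAddr n i' T + l) := by
  obtain ⟨x, hx⟩ : ∃ x : ℕ → ℚ, ∀ l, s.rat 3 (rowAddr n i S + l) = x l := ⟨_, fun _ => rfl⟩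
  obtain ⟨y, hy⟩ : ∃ y : ℕ → ℚ, ∀ l, s.rat 3 (rowAddr n j S' + l) = y l := ⟨_, fun _ => rfl⟩
  simp only [hx, hy]
  refine Runs.seq (B := 20) (B' := 200 * ((a + 1) * (b + 1)) + 70 * (n + 1)) (Q := fun s' =>
    s'.nat 37 0 = rowAddr n i S ∧ s'.nat 38 0 = rowAddr n j S')
    (Runs.of_wp ?_ (by decide)) ?_ (by omega)
  · simp only [Program.wp, NatExp.eval, reg_eval, write_apply, Function.update_apply, reduceIte,
      Nat.reduceEqDiff, h22, h23, h32, hE.base j hj, hE.base i hi, hS, hS']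
    exact ⟨rfl, rfl⟩
  rintro s₁ hf₁ ⟨h37, h38⟩
  have hrat₁ : s₁.rat 3 = s.rat 3 := hf₁.rat 3 rfl
  refine Runs.seq (B := (a + 1) * ((b + 1) * 80 + 12 + 15) + 12) (B' := (a + b + 1) * 40 + 14)
    (Q := fun s' => MergedUpTo up a b x y (a + 1) 0 (s'.rat 8)) ?_ ?_ (by nlinarith)
  · refine runs_forLoop (a + 1) ((b + 1) * 80 + 12)
      (fun k₁ s' => MergedUpTo up a b x y k₁ 0 (s'.rat 8)) rfl ?_ (fun _ _ _ h => h) ?_ ?_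
      (fun _ _ h => h) (by simp only [NatExp.cost, reg_cost, Nat.add_assoc, Nat.reduceAdd]; omega)
    · intro s' hf
      rw [NatExp.eval, reg_eval, hf.nat 39 rfl, hf₁.nat 39 rfl, h39, NatExp.eval]
    · rintro l ⟨z, m₁, -, m₂, -, hm, -⟩
      omega
    · intro k₁ hk₁ s₂ hf₂ hr₂ hI₂
      refine runs_forLoop (b + 1) 60 (fun k₂ s' => MergedUpTo up a b x y k₁ k₂ (s'.rat 8)) rfl ?_
        (fun _ _ _ h => h) hI₂ ?_ ?_ (by simp only [NatExp.cost, reg_cost]; omega)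
      · intro s' hf
        rw [NatExp.eval, reg_eval, hf.nat 40 rfl, hf₂.nat 40 rfl, hf₁.nat 40 rfl, h40, NatExp.eval]
      · intro k₂ hk₂ s' hf hr hI
        have e33 : s'.nat 33 0 = k₁ := by rw [hf.nat 33 rfl, hr₂]
        have e37 : s'.nat 37 0 = rowAddr n i S := by rw [hf.nat 37 rfl, hf₂.nat 37 rfl, h37]
        have e38 : s'.nat 38 0 = rowAddr n j S' := by rw [hf.nat 38 rfl, hf₂.nat 38 rfl, h38]
        have e40 : s'.nat 40 0 = b := by rw [hf.nat 40 rfl, hf₂.nat 40 rfl, hf₁.nat 40 rfl, h40]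
        have e3 : s'.rat 3 = s.rat 3 := by rw [hf.rat 3 rfl, hf₂.rat 3 rfl, hrat₁]
        refine Runs.of_wp ?_ (by cases up <;> decide)
        simp only [mergeEntry, Program.wp, NatExp.eval, RatExp.eval, reg_eval, Test.holds,
          dirTest_holds, e33, e37, e38, e40, e3, hr, hx, hy, write_apply, reduceIte]
        constructor
        · intro hc
          refine hI.step_of_le (by omega) (by omega) ?_
          by_contra hcon
          rw [not_or, not_or] at hcon
          exact hc ⟨by omega, hcon.2⟩
        · intro hc
          rw [not_not] at hc
          refine hI.step_of_not_le (by omega) ?_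
          rw [not_or, not_or]
          exact ⟨by omega, hc.2⟩
      · intro s' _ h l
        rw [← mergeSums_next_row]
        exact h l
  intro s₂ hf₂ hI₂
  have hmerged : ∀ l ≤ a + b, IsBest up
      {z | ∃ l₁ ≤ a, ∃ l₂ ≤ b, l₁ + l₂ = l ∧ z = x l₁ + y l₂} (s₂.rat 8 l) := by
    intro l hl
    have e : mergeSums a b x y (a + 1) 0 l =
        {z | ∃ l₁ ≤ a, ∃ l₂ ≤ b, l₁ + l₂ = l ∧ z = x l₁ + y l₂} := by
      ext z
      constructor
      · rintro ⟨m₁, h₁, m₂, h₂, -, h⟩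
        exact ⟨m₁, h₁, m₂, h₂, h⟩
      · rintro ⟨m₁, h₁, m₂, h₂, h⟩
        exact ⟨m₁, h₁, m₂, h₂, by omega, h⟩
    rw [← e]
    refine hI₂ l ?_
    rw [e]
    exact ⟨_, min l a, by omega, l - min l a, by omega, by omega, rfl⟩
  refine runs_forLoop (a + b + 1) 20 (fun k s' =>
    (∀ l < k, s'.rat 3 (rowAddr n i S + l) = s₂.rat 8 l) ∧
    ∀ i' T l, l ≤ n → (i' = i → T ≠ S) →
        s'.rat 3 (rowAddr n i' T + l) = s.rat 3 (rowAddr n i' T + l)) rfl ?_ (fun _ _ _ h => h)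
    ?_ ?_ ?_ (by simp only [NatExp.cost, reg_cost]; omega)
  · intro s' hf
    simp only [NatExp.eval, reg_eval]
    rw [hf.nat 39 rfl, hf.nat 40 rfl, hf₂.nat 39 rfl, hf₂.nat 40 rfl, hf₁.nat 39 rfl,
      hf₁.nat 40 rfl, h39, h40]
  · exact ⟨fun l hl => absurd hl (Nat.not_lt_zero _), fun _ _ _ _ _ => by
      rw [hf₂.rat 3 rfl, hrat₁]⟩
  · rintro k' hk' s' hf hr ⟨hI, hI'⟩
    have e37 : s'.nat 37 0 = rowAddr n i S := by rw [hf.nat 37 rfl, hf₂.nat 37 rfl, h37]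
    have e8 : s'.rat 8 = s₂.rat 8 := hf.rat 8 rfl
    refine Runs.of_wp ?_ (by decide)
    simp only [Program.wp, NatExp.eval, RatExp.eval, reg_eval, e37, e8, hr, write_apply, reduceIte,
      Function.update_apply]
    constructor
    · intro l hl
      by_cases h : l = k'
      · simp [h]
      · rw [if_neg (by omega), hI l (by omega)]
    · intro i' T l hl hne
      simp only [rowAddr_add_eq_iff hl (show k' ≤ n by omega)]
      rw [if_neg (fun h => hne h.1 h.2.1)]
      exact hI' i' T l hl hne
  · rintro s' - ⟨hI, hI'⟩
    refine ⟨fun l hl => ?_, hI'⟩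
    rw [hI l (by omega)]
    exact hmerged l hl

lemma runs_mergeTables {O : Oracles} {up : Bool} {n m i j : ℕ} {G : WDigraph (Fin n)}
    {E : ElimTree m G} {s : Memory} {X F F' : Finset (Fin n)} (hE : Prepared E s)
    (hi : i ≤ m) (hj : j ≤ m) (hij : i ≠ j) (h22 : s.nat 22 0 = j) (h23 : s.nat 23 0 = i)
    (hX : X ⊆ E.bag i) (h13 : ∀ u : Fin n, s.nat 13 u = if u ∈ X then 1 else 0)
    (hT : HasTable up G s i (E.bag i) F) (hT' : HasTable up G s j X F') (hd : Disjoint F F')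
    (hFF : ∀ u ∈ F, ∀ w ∈ F', (u, w) ∉ G.edges ∧ (w, u) ∉ G.edges)
    (hFX : ∀ u ∈ F', ∀ w ∈ E.bag i \ X, (u, w) ∉ G.edges ∧ (w, u) ∉ G.edges) :
    Runs O (mergeTables up) s
      (1000 * 2 ^ (E.bag i).card * ((n + 1) + F.card * F'.card)) fun s' =>
        HasTable up G s' i (E.bag i) (F ∪ F') ∧ SameTables n i s s' := by
  obtain ⟨K, hK⟩ : ∃ K, K = 2 ^ (E.bag i).card := ⟨_, rfl⟩
  obtain ⟨a, ha⟩ : ∃ a, a = F.card := ⟨_, rfl⟩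
  obtain ⟨b, hb⟩ : ∃ b, b = F'.card := ⟨_, rfl⟩
  have hKpos : 1 ≤ K := hK ▸ Nat.one_le_two_pow
  have hab : a + b ≤ n := by
    rw [ha, hb, ← Finset.card_union_of_disjoint hd]
    simpa using Finset.card_le_univ (F ∪ F')
  rw [← hK, ← ha, ← hb]
  refine Runs.seq (B := n * 60 + 20) (B' := 900 * K * ((n + 1) + a * b)) (Q := fun s' =>
    ∀ u : Fin n, s'.nat 15 u = 1 ∧
      s'.nat 16 u = if u ∈ X then 2 ^ (u : ℕ) * (n + 1) else 0) ?_ ?_ (by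
        nlinarith [Nat.mul_le_mul hKpos (le_refl (n + 1 + a * b))])
  · refine runs_forLoop n 40 (fun k s' => ∀ u : Fin n, (u : ℕ) < k → s'.nat 15 u = 1 ∧
      s'.nat 16 u = if u ∈ X then 2 ^ (u : ℕ) * (n + 1) else 0) rfl ?_
      (fun _ _ _ h => h) (fun u hu => absurd hu (Nat.not_lt_zero _)) ?_
      (fun s' _ h u => h u u.2) (by simp only [reg_cost]; omega)
    · intro s' hf
      rw [reg_eval, hf.nat 0 rfl, hE.vertices]
    · intro k hk s' hf hr hI
      refine Runs.of_wp ?_ (by decide)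
      have e13 := h13 ⟨k, hk⟩
      have e8 := hE.weight ⟨k, hk⟩
      dsimp only at e13 e8
      simp only [Program.wp, NatExp.eval, reg_eval, write_apply, Function.update_apply,
        reduceIte, Nat.reduceEqDiff, hr, hf.nat 13 rfl, hf.nat 8 rfl, e13, e8, Test.holds]
      constructor <;> intro hc u hu <;>
      · by_cases h : (u : ℕ) = k
        · obtain rfl : u = ⟨k, hk⟩ := Fin.ext h
          by_cases hm : (⟨k, hk⟩ : Fin n) ∈ X
          · simp_all
          · simp_all
        · simpa only [if_neg h] using hI u (by omega)
  intro s₂ hf₂ hw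
  have hE₂ := hE.frame hf₂ (by decide) rfl
  let w : SubsetWeights n :=
    ⟨fun u => 2 ^ (u : ℕ) * (n + 1), fun u => if u ∈ X then 2 ^ (u : ℕ) * (n + 1) else 0,
      fun u => s₂.rat 4 u, fun u => s₂.rat 5 u⟩
  refine Runs.seq (B := 200 * (n + 1) * K + 10) (B' := 600 * K * ((n + 1) + a * b)) (Q := fun s' =>
    ∃ g, w.Listed (E.bag i) g s') ?_ ?_ (by
        nlinarith [Nat.mul_le_mul hKpos (le_refl (n + 1 + a * b)), Nat.zero_le (K * (a * b))])
  · refine Runs.seq (B := 10) (B' := 200 * (n + 1) * 2 ^ (E.bag i).card)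
      (Q := fun s' => s'.nat 21 0 = i) (Runs.of_wp ?_ (by decide)) ?_ (by rw [← hK]; omega)
    · simp only [Program.wp, NatExp.eval, reg_eval, write_apply, Function.update_apply, reduceIte]
      rw [hf₂.nat 23 rfl, h23]
    · intro s' hf h21
      have hE' := hE₂.frame hf (by decide) rfl
      refine runs_listSubsets ⟨hE'.weight, fun u => ?_, fun u => ?_, fun u => ?_⟩
        (hE'.bags i hi) h21
        subset_rfl fun u hu => ?_
      · rw [hf.nat 16 rfl]; exact (hw u).2
      · rw [hf.rat 4 rfl]
      · rw [hf.rat 5 rfl]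
      · rw [hf.nat 15 rfl, (hw u).1]; simpa using hu
  rintro s₃ hf₃ ⟨g, hg⟩
  have hE₃ := hE₂.frame hf₃ (by decide) rfl
  refine Runs.seq (B := 20) (B' := 500 * K * ((n + 1) + a * b)) (Q := fun s' =>
    s'.nat 39 0 = a ∧ s'.nat 40 0 = b) (Runs.of_wp ?_ (by decide)) ?_ (by
        nlinarith [Nat.mul_le_mul hKpos (le_refl (n + 1 + a * b))])
  · simp only [Program.wp, NatExp.eval, reg_eval, write_apply, Function.update_apply, reduceIte,
      Nat.reduceEqDiff]
    rw [hf₃.nat 12 rfl, hf₂.nat 12 rfl, hf₃.nat 22 rfl, hf₂.nat 22 rfl, hf₃.nat 23 rfl,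
      hf₂.nat 23 rfl, h22, h23, hT.1, hT'.1]
    exact ⟨ha.symm, hb.symm⟩
  rintro s₄ hf₄ ⟨h39, h40⟩
  have hE₄ := hE₃.frame hf₄ (by decide) rfl
  have hrat₄ : s₄.rat 3 = s.rat 3 := by rw [hf₄.rat 3 rfl, hf₃.rat 3 rfl, hf₂.rat 3 rfl]
  have e22 : s₄.nat 22 0 = j := by rw [hf₄.nat 22 rfl, hf₃.nat 22 rfl, hf₂.nat 22 rfl, h22]
  have e23 : s₄.nat 23 0 = i := by rw [hf₄.nat 23 rfl, hf₃.nat 23 rfl, hf₂.nat 23 rfl, h23]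
  let sums : Finset (Fin n) → ℕ → Set ℚ := fun S l => {z | ∃ l₁ ≤ a, ∃ l₂ ≤ b, l₁ + l₂ = l ∧
    z = s.rat 3 (rowAddr n i S + l₁) + s.rat 3 (rowAddr n j (S ∩ X) + l₂)}
  refine Runs.seq (B := K * (200 * ((a + 1) * (b + 1)) + 100 * (n + 1) + 13) + 10) (B' := 10)
    (Q := fun s' =>
      (∀ S ⊆ E.bag i, ∀ l ≤ a + b, IsBest up (sums S l) (s'.rat 3 (rowAddr n i S + l))) ∧
      ∀ i' ≠ i, ∀ (S : Finset (Fin n)) l, l ≤ n →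
        s'.rat 3 (rowAddr n i' S + l) = s.rat 3 (rowAddr n i' S + l)) ?_ ?_ ?_
  · refine runs_forLoop (2 ^ (E.bag i).card) (200 * ((a + 1) * (b + 1)) + 100 * (n + 1))
      (fun k s' =>
      (∀ x < k, ∀ l ≤ a + b, IsBest up (sums (g x) l) (s'.rat 3 (rowAddr n i (g x) + l))) ∧
      ∀ i' (S : Finset (Fin n)) l, l ≤ n → (i' = i → ∀ x < k, S ≠ g x) →
        s'.rat 3 (rowAddr n i' S + l) = s.rat 3 (rowAddr n i' S + l)) rfl ?_
      (fun _ _ _ h => h) ?_ ?_ ?_ ?_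
    · intro s' hf
      rw [reg_eval, hf.nat 20 rfl, hf₄.nat 20 rfl, hg.card]
    · exact ⟨fun x hx => absurd hx (Nat.not_lt_zero _), fun _ _ _ _ _ => by rw [hrat₄]⟩
    · rintro k hk s' hf hr ⟨hI, hI'⟩
      have hE' := hE₄.frame hf (by cases up <;> decide) rfl
      refine (runs_mergeRow (S := g k) (S' := g k ∩ X) hE' hi hj (by rw [hf.nat 22 rfl, e22])
        (by rw [hf.nat 23 rfl, e23]) hr (by rw [hf.nat 39 rfl, h39]) (by rw [hf.nat 40 rfl, h40])
        hab (by rw [hf.nat 17 rfl, hf₄.nat 17 rfl, hg.W k hk]) ?_).mono le_rfl ?_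
      · rw [hf.nat 18 rfl, hf₄.nat 18 rfl, hg.W' k hk, ← Finset.sum_filter,
          Finset.filter_mem_eq_inter]
      rintro s'' - ⟨h1, h2⟩
      have hdiff : ∀ x < k, g k ≠ g x := fun x hx e => by
        have := hg.bijOn.2.1 hk (lt_trans hx hk) e
        omega
      constructor
      · intro x hx l hl
        rcases Nat.lt_succ_iff_lt_or_eq.1 hx with hx' | rfl
        · rw [h2 i (g x) l (by omega) fun _ => (hdiff x hx').symm]
          exact hI x hx' l hl
        · refine (iff_of_eq (congrArg (fun M => IsBest up M _) ?_)).1 (h1 l hl)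
          have hi' : ∀ l ≤ n, s'.rat 3 (rowAddr n i (g x) + l) =
              s.rat 3 (rowAddr n i (g x) + l) := fun l hl => hI' i _ l hl fun _ => hdiff
          have hj' : ∀ l ≤ n, s'.rat 3 (rowAddr n j (g x ∩ X) + l) =
              s.rat 3 (rowAddr n j (g x ∩ X) + l) :=
            fun l hl => hI' j _ l hl fun e => absurd e.symm hij
          ext z
          constructor
          · rintro ⟨l₁, h₁, l₂, h₂, hl, rfl⟩
            exact ⟨l₁, h₁, l₂, h₂, hl, by rw [hi' _ (by omega), hj' _ (by omega)]⟩
          · rintro ⟨l₁, h₁, l₂, h₂, hl, rfl⟩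
            exact ⟨l₁, h₁, l₂, h₂, hl, by rw [hi' _ (by omega), hj' _ (by omega)]⟩
      · intro i' S l hl hne
        rw [h2 i' S l hl fun e => hne e k (Nat.lt_succ_self k),
          hI' i' S l hl fun e x hx => hne e x (Nat.lt_succ_of_lt hx)]
    · rintro s' - ⟨hI, hI'⟩
      refine ⟨fun S hS l hl => ?_, fun i' hi' S l hl => hI' i' S l hl fun e => absurd e hi'⟩
      obtain ⟨x, hx, rfl⟩ := hg.bijOn.2.2 hS
      exact hI x hx l hl
    · simp only [reg_cost, ← hK, Nat.add_assoc, Nat.reduceAdd]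
      omega
  · rintro s₅ hf₅ ⟨hnew, hother⟩
    refine Runs.of_wp ?_ (by decide)
    have e39 : s₅.nat 39 0 = a := by rw [hf₅.nat 39 rfl, h39]
    have e40 : s₅.nat 40 0 = b := by rw [hf₅.nat 40 rfl, h40]
    have e23' : s₅.nat 23 0 = i := by rw [hf₅.nat 23 rfl, e23]
    have e12 : s₅.nat 12 = s.nat 12 := by
      rw [hf₅.nat 12 rfl, hf₄.nat 12 rfl, hf₃.nat 12 rfl, hf₂.nat 12 rfl]
    simp only [Program.wp, NatExp.eval, reg_eval, e39, e40, e23']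
    have hcard : (F ∪ F').card = a + b := by rw [Finset.card_union_of_disjoint hd, ha, hb]
    refine ⟨⟨?_, ?_⟩, fun i' hi' => ⟨?_, hother i' hi'⟩⟩
    · simp [write_apply, hcard]
    · intro S hS l hl
      rw [hcard] at hl
      have hSX : S ∩ X ⊆ X := Finset.inter_subset_right
      rw [isBest_cutValues_union hd hFF (hT.2 S hS)
        (fun l hl => by rw [cutValues_restrict hX hS hFX]; exact hT'.2 _ hSX l hl), ← ha, ← hb]
      exact hnew S hS l hl
    · simp [write_apply, hi', e12]
  · have : a * b + (a + b) + 1 = (a + 1) * (b + 1) := by ring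
    have h1 : K * ((a + 1) * (b + 1)) ≤ K * (a * b + (n + 1)) := Nat.mul_le_mul_left _ (by omega)
    nlinarith [Nat.mul_le_mul hKpos (le_refl (n + 1 + a * b)), Nat.zero_le (K * (a * b)),
      Nat.mul_le_mul (le_refl K) (show 1 ≤ n + 1 by omega)]

/-! ### Eliminating the nodes bottom-up -/

/-- Sets the array `a` to the characteristic function of the bag of the node held by the
variable `r`. -/
def markBag (a r : ℕ) : Program :=
  .seq (forLoop 24 (reg 0) (.setNat a (reg 24) (.const 0)))
    (forBag 24 25 (reg r) (.setNat a (reg 25) (.const 1)))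

lemma runs_markBag {O : Oracles} {n a r i : ℕ} {s : Memory} {X : Finset (Fin n)}
    (ha : a ∉ [0, 4, 5, 6, 24, 25]) (hr : r ∉ [24, 25, a]) (h0 : s.nat 0 0 = n)
    (hi : s.nat r 0 = i) (hX : IsBagList s i X) :
    Runs O (markBag a r) s (100 * (n + 1)) fun s' =>
      ∀ u : Fin n, s'.nat a u = if u ∈ X then 1 else 0 := by
  simp only [List.mem_cons, List.not_mem_nil, or_false, not_or] at ha hr
  obtain ⟨a0, a4, a5, a6, a24, a25⟩ := ha
  obtain ⟨r24, r25, ra⟩ := hr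
  have hXn : X.card ≤ n := by simpa using Finset.card_le_univ X
  refine Runs.seq (B := n * 40 + 10) (B' := n * 60 + 20)
    (Q := fun s' => ∀ u : Fin n, s'.nat a u = 0) ?_ ?_ (by omega)
  · refine runs_forLoop n 20 (fun k s' => ∀ u : Fin n, (u : ℕ) < k → s'.nat a u = 0)
      (by simp [Program.writesNat, a24]) ?_ ?_ (fun u hu => absurd hu (Nat.not_lt_zero _)) ?_
      (fun s' _ h u => h u u.2) (by simp only [reg_cost]; omega)
    · intro s' hf
      rw [reg_eval, hf.nat 0 (by simp [forLoop, Program.writesNat, a0]), h0]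
    · intro k s' x h u hu
      rw [← h u hu]
      simp [Memory.setReg, write_apply, a24]
    · intro k hk s' hf hr' hI
      refine Runs.of_wp ?_ (by simp [Program.maxCost, NatExp.cost])
      simp only [Program.wp, NatExp.eval, reg_eval, hr', write_apply, if_true,
        Function.update_apply]
      intro u hu
      by_cases h : (u : ℕ) = k
      · rw [if_pos h]
      · rw [if_neg h, hI u (by omega)]
  · intro s₁ hf₁ h₁
    have w : ∀ b, b ≠ 24 → b ≠ a →
        (forLoop 24 (reg 0) (.setNat a (reg 24) (.const 0))).writesNat b = false := by
      intro b h1 h2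
      simp [forLoop, Program.writesNat, h1.symm, h2.symm]
    have w' : ∀ b, b ≠ 24 → b ≠ 25 → b ≠ a →
        (forBag 24 25 (reg r) (.setNat a (reg 25) (.const 1))).writesNat b = false := by
      intro b h1 h2 h3
      simp [forBag, forLoop, Program.writesNat, h1.symm, h2.symm, h3.symm]
    refine runs_forBag 10 (fun A s' => ∀ u : Fin n, s'.nat a u = if u ∈ A then 1 else 0)
      (hX.congr (hf₁.nat 4 (w 4 (by decide) (Ne.symm a4)))
        (hf₁.nat 5 (w 5 (by decide) (Ne.symm a5)))
        (hf₁.nat 6 (w 6 (by decide) (Ne.symm a6))))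
      (by simp [Program.writesNat, a24])
      (w' 4 (by decide) (by decide) (Ne.symm a4)) (w' 5 (by decide) (by decide) (Ne.symm a5))
      (w' 6 (by decide) (by decide) (Ne.symm a6)) ?_ ?_ ?_ (by simpa using h₁) ?_
      (fun _ _ h => h) ?_
    · intro s' hf
      rw [reg_eval, hf.nat r (w' r r24 r25 ra), hf₁.nat r (w r r24 ra), hi]
    · intro A s' x h u
      rw [← h u]
      simp [Memory.setReg, write_apply, a24]
    · intro A s' x h u
      rw [← h u]
      simp [Memory.setReg, write_apply, a25]
    · intro A hA u hu huA s' hf hr' hI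
      refine Runs.of_wp ?_ (by simp [Program.maxCost, NatExp.cost])
      simp only [Program.wp, NatExp.eval, reg_eval, hr', write_apply, if_true,
        Function.update_apply, Fin.val_inj]
      intro v
      by_cases h : v = u
      · simp [h]
      · simp [h, hI v]
    · simp only [reg_cost]
      omega

lemma HasTable.frame {n : ℕ} {up : Bool} {G : WDigraph (Fin n)} {s s' : Memory} {i : ℕ}
    {X F : Finset (Fin n)} {P : Program} (h : HasTable up G s i X F) (hf : Frame P s s')
    (hn : P.writesNat 12 = false) (hr : P.writesRat 3 = false) : HasTable up G s' i X F := by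
  rw [HasTable, hf.nat 12 hn, hf.rat 3 hr]
  exact h

namespace ElimTree

variable {n m : ℕ} {G : WDigraph (Fin n)} (E : ElimTree m G)

/-- The vertices that are forgotten in the table of `i` when the tables of the nodes in `A` have
been merged into those of their parents. -/
def merged (A : Finset ℕ) (i : ℕ) : Finset (Fin n) := (A.filter (E.par · = i)).biUnion E.Z

/-- With every node, `A` contains all nodes below it. -/
def IsLower (A : Finset ℕ) : Prop := A ⊆ Finset.range m ∧ ∀ k < m, E.par k ∈ A → k ∈ A

/-- A bound, up to a factor, on the time for eliminating the nodes in `A`. The term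
`|merged A i| ^ 2` pays for the pairs of forgotten vertices that have met at `i`, and the terms with
the factor `n + 1` pay for every single forgotten vertex and for every node. -/
def potential (A : Finset ℕ) : ℕ :=
  ∑ i ∈ Finset.range (m + 1) \ A, ((E.merged A i).card ^ 2 + 2 * (n + 1) * (E.merged A i).card) +
    (n + 1) * A.card

variable {E}

lemma mem_merged {A : Finset ℕ} {i : ℕ} {u : Fin n} :
    u ∈ E.merged A i ↔ ∃ k ∈ A, E.par k = i ∧ u ∈ E.Z k := by
  simp only [merged, Finset.mem_biUnion, Finset.mem_filter, and_assoc]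

lemma merged_insert_self (A : Finset ℕ) (j : ℕ) :
    E.merged (insert j A) (E.par j) = E.merged A (E.par j) ∪ E.Z j := by
  rw [merged, Finset.filter_insert, if_pos rfl, Finset.biUnion_insert, Finset.union_comm, merged]

lemma merged_insert_of_ne {A : Finset ℕ} {i j : ℕ} (h : i ≠ E.par j) :
    E.merged (insert j A) i = E.merged A i := by
  rw [merged, Finset.filter_insert, if_neg (Ne.symm h), merged]

lemma par_ne {j : ℕ} (hj : j < m) : E.par j ≠ j := fun h => by
  have := E.dep_par j hj
  rw [h] at this
  omega

lemma merged_disjoint {A : Finset ℕ} {j : ℕ} (hA : A ⊆ Finset.range m) (hj : j < m) (hjA : j ∉ A) :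
    Disjoint (E.merged A (E.par j)) (E.Z j) := by
  refine (Finset.disjoint_biUnion_left _ _ _).2 fun k hk => ?_
  obtain ⟨hk, e⟩ := Finset.mem_filter.1 hk
  exact E.Z_disjoint k (Finset.mem_range.1 (hA hk)) j hj (fun h => hjA (h ▸ hk)) e

/-- When all children of `j` have been eliminated, `j` has to forget the vertices of its bag that
are not in the bag of its parent. -/
lemma Z_eq_merged {A : Finset ℕ} {j : ℕ} (hA : E.IsLower (insert j A)) :
    E.Z j = E.merged A j ∪ (E.bag j \ E.bag (E.par j)) := by
  have hj : j < m := Finset.mem_range.1 (hA.1 (Finset.mem_insert_self _ _))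
  rw [E.Z_eq j hj]
  congr 1
  ext u
  simp only [mem_merged, Finset.mem_biUnion, Finset.mem_filter, Finset.mem_range]
  constructor
  · rintro ⟨k, ⟨hk, e⟩, hu⟩
    refine ⟨k, (Finset.mem_insert.1 (hA.2 k hk (e ▸ Finset.mem_insert_self _ _))).resolve_left ?_,
      e, hu⟩
    rintro rfl
    exact par_ne hk e
  · rintro ⟨k, hk, e, hu⟩
    exact ⟨k, ⟨Finset.mem_range.1 (hA.1 (Finset.mem_insert_of_mem hk)), e⟩, hu⟩

lemma merged_disjoint_bag {A : Finset ℕ} {j : ℕ} (hA : A ⊆ Finset.range m) :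
    Disjoint (E.merged A j) (E.bag j) := by
  refine (Finset.disjoint_biUnion_left _ _ _).2 fun k hk => ?_
  obtain ⟨hkA, rfl⟩ := Finset.mem_filter.1 hk
  exact E.Z_disjoint_bag k (Finset.mem_range.1 (hA hkA))

lemma card_Z {A : Finset ℕ} {j : ℕ} (hA : E.IsLower (insert j A)) :
    (E.Z j).card = (E.merged A j).card + (E.bag j \ E.bag (E.par j)).card := by
  rw [Z_eq_merged hA, Finset.card_union_of_disjoint]
  exact (merged_disjoint_bag fun k hk => hA.1 (Finset.mem_insert_of_mem hk)).mono_right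
    Finset.sdiff_subset

/-- The potential grows by as much as the elimination of `j` costs, up to a factor: with the numbers
`a`, `b` and `f` of vertices that have been forgotten at `j`, at its parent, and that `j` has to forget,
the sum of squares grows by `(b + a + f) ^ 2 - b ^ 2 - a ^ 2`. -/
lemma potential_insert {A : Finset ℕ} {j : ℕ} (hA : E.IsLower A) (hjA : j ∉ A)
    (hA' : E.IsLower (insert j A)) :
    E.potential A + ((E.merged A (E.par j)).card * (E.Z j).card +
      (n + 1) * ((E.bag j \ E.bag (E.par j)).card + 1)) ≤ E.potential (insert j A) := by
  have hj : j < m := Finset.mem_range.1 (hA'.1 (Finset.mem_insert_self _ _))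
  have hi : E.par j ∉ A := fun h => hjA (hA.2 j hj h)
  have him : E.par j ∈ (Finset.range (m + 1) \ A).erase j := by
    simp [par_ne hj, hi, E.par_le j hj]
  have hjm : j ∈ Finset.range (m + 1) \ A := by
    simp [hjA]; omega
  have e : Finset.range (m + 1) \ insert j A = (Finset.range (m + 1) \ A).erase j := by
    ext k
    simp only [Finset.mem_sdiff, Finset.mem_insert, Finset.mem_erase]
    tauto
  rw [potential, potential, e, ← Finset.add_sum_erase _ _ hjm, ← Finset.add_sum_erase _ _ him,
    ← Finset.add_sum_erase _ _ him, merged_insert_self,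
    Finset.card_union_of_disjoint (merged_disjoint hA.1 hj hjA), Finset.card_insert_of_notMem hjA]
  have hrest : ∑ i ∈ ((Finset.range (m + 1) \ A).erase j).erase (E.par j),
      ((E.merged (insert j A) i).card ^ 2 + 2 * (n + 1) * (E.merged (insert j A) i).card) =
      ∑ i ∈ ((Finset.range (m + 1) \ A).erase j).erase (E.par j),
      ((E.merged A i).card ^ 2 + 2 * (n + 1) * (E.merged A i).card) :=
    Finset.sum_congr rfl fun i hi => by rw [merged_insert_of_ne (Finset.ne_of_mem_erase hi)]
  rw [hrest, card_Z hA']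
  obtain ⟨a, ha⟩ : ∃ a, a = (E.merged A j).card := ⟨_, rfl⟩
  obtain ⟨b, hb⟩ : ∃ b, b = (E.merged A (E.par j)).card := ⟨_, rfl⟩
  obtain ⟨f, hf⟩ : ∃ f, f = (E.bag j \ E.bag (E.par j)).card := ⟨_, rfl⟩
  rw [← ha, ← hb, ← hf]
  nlinarith [Nat.zero_le (b * a), Nat.zero_le (b * f), Nat.zero_le (a * f), Nat.zero_le (f * f),
    Nat.zero_le (n * f)]

end ElimTree

/-- Forgets, in the table of the node held by the variable `22`, the vertices that are not in the
bag of its parent, and merges the table into that of the parent. -/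
def processNode (up : Bool) : Program :=
  .seq (.setNat 23 (.const 0) (.read 3 (reg 22)))
  (.seq (markBag 13 22)
  (.seq (markBag 14 23)
  (.seq (forBag 26 27 (reg 22)
    (.ite (.natLe (.const 1) (.read 14 (reg 27))) .skip (forgetVertex up)))
  (mergeTables up))))

lemma runs_processNode {O : Oracles} {up : Bool} {n m j K : ℕ} {G : WDigraph (Fin n)}
    {E : ElimTree m G} {s : Memory} {A : Finset ℕ} (hE : Prepared E s)
    (hK : ∀ i ≤ m, 2 ^ (E.bag i).card ≤ K) (hA : E.IsLower A) (hjA : j ∉ A)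
    (hA' : E.IsLower (insert j A)) (h22 : s.nat 22 0 = j)
    (hT : ∀ i ≤ m, i ∉ A → HasTable up G s i (E.bag i) (E.merged A i)) :
    Runs O (processNode up) s (2000 * K * ((E.merged A (E.par j)).card * (E.Z j).card +
      (n + 1) * ((E.bag j \ E.bag (E.par j)).card + 1))) fun s' =>
        ∀ i ≤ m, i ∉ insert j A → HasTable up G s' i (E.bag i) (E.merged (insert j A) i) := by
  have hj : j < m := Finset.mem_range.1 (hA'.1 (Finset.mem_insert_self _ _))
  obtain ⟨i, hi⟩ : ∃ i, i = E.par j := ⟨_, rfl⟩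
  have him : i ≤ m := hi ▸ E.par_le j hj
  have hij : i ≠ j := hi ▸ ElimTree.par_ne hj
  have hiA : i ∉ A := fun h => hjA (hA.2 j hj (hi ▸ h))
  have hKpos : 1 ≤ K := Nat.one_le_two_pow.trans (hK j hj.le)
  obtain ⟨f, hfdef⟩ : ∃ f, f = (E.bag j \ E.bag i).card := ⟨_, rfl⟩
  obtain ⟨b, hb⟩ : ∃ b, b = (E.merged A i).card := ⟨_, rfl⟩
  obtain ⟨c, hc⟩ : ∃ c, c = (E.Z j).card := ⟨_, rfl⟩
  rw [← hi, ← hfdef, ← hb, ← hc]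
  have hbagn : (E.bag j).card ≤ n := by simpa using Finset.card_le_univ (E.bag j)
  refine Runs.seq (B := 10) (B' := 200 * (n + 1) + (f * (1000 * (n + 1) * K) +
      (E.bag j).card * 40 + 20) + 1000 * K * ((n + 1) + b * c))
    (Q := fun s' => s'.nat 23 0 = i) (Runs.of_wp ?_ (by decide)) ?_ ?_
  · simp only [Program.wp, NatExp.eval, reg_eval, h22, hE.parent j hj, write_apply, reduceIte,
      Function.update_apply, hi]
  swap
  · nlinarith [Nat.mul_le_mul hKpos (le_refl (n + 1)), Nat.zero_le (K * (b * c)),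
      Nat.mul_le_mul hKpos (le_refl ((n + 1) * f)), Nat.zero_le (K * n * f)]
  intro s₁ hf₁ h23
  have hE₁ := hE.frame hf₁ (by decide) rfl
  refine Runs.seq (B := 100 * (n + 1)) (B' := 100 * (n + 1) + ((f * (1000 * (n + 1) * K) +
      (E.bag j).card * 40 + 20) + 1000 * K * ((n + 1) + b * c)))
    (runs_markBag (by decide) (by decide) hE₁.vertices (by rw [hf₁.nat 22 rfl, h22])
      (hE₁.bags j hj.le)) ?_ (by omega)
  intro s₂ hf₂ h13
  have hE₂ := hE₁.frame hf₂ (by decide) rfl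
  refine Runs.seq (B := 100 * (n + 1)) (B' := (f * (1000 * (n + 1) * K) +
      (E.bag j).card * 40 + 20) + 1000 * K * ((n + 1) + b * c))
    (runs_markBag (by decide) (by decide) hE₂.vertices (by rw [hf₂.nat 23 rfl, h23])
      (hE₂.bags i him)) ?_ le_rfl
  intro s₃ hf₃ h14
  have hE₃ := hE₂.frame hf₃ (by decide) rfl
  have h22₃ : s₃.nat 22 0 = j := by
    rw [hf₃.nat 22 rfl, hf₂.nat 22 rfl, hf₁.nat 22 rfl, h22]
  have h23₃ : s₃.nat 23 0 = i := by rw [hf₃.nat 23 rfl, hf₂.nat 23 rfl, h23]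
  have hT₃ : ∀ i ≤ m, i ∉ A → HasTable up G s₃ i (E.bag i) (E.merged A i) := fun i hi hiA =>
    (((hT i hi hiA).frame hf₁ rfl rfl).frame hf₂ rfl rfl).frame hf₃ rfl rfl
  refine Runs.seq (Q := fun s' =>
    HasTable up G s' j (E.bag j \ (E.bag j \ E.bag i)) (E.merged A j ∪ (E.bag j \ E.bag i)) ∧
    SameTables n j s₃ s' ∧
    ∀ u : Fin n, s'.nat 13 u = if u ∈ E.bag j \ (E.bag j \ E.bag i) then 1 else 0) ?_ ?_ le_rfl
  · -- only the vertices outside of the bag of `i` take much time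
    refine runs_forBag_potential (Inv := fun D s' =>
      HasTable up G s' j (E.bag j \ (D \ E.bag i)) (E.merged A j ∪ (D \ E.bag i)) ∧
      SameTables n j s₃ s' ∧
      ∀ u : Fin n, s'.nat 13 u = if u ∈ E.bag j \ (D \ E.bag i) then 1 else 0)
      (Φ := fun D => (D \ E.bag i).card * (1000 * (n + 1) * K) + D.card * 40)
      (hE₃.bags j hj.le) (by cases up <;> rfl) (by cases up <;> rfl) (by cases up <;> rfl)
      (by cases up <;> rfl) ?_ (fun _ _ _ h => h) (fun _ _ _ h => h) ?_ ?_ (fun _ _ h => h) ?_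
    · intro s' hf
      rw [reg_eval, hf.nat 22 (by cases up <;> rfl), h22₃]
    · refine ⟨?_, fun _ _ => ⟨rfl, fun _ _ _ => rfl⟩, ?_⟩
      · simpa using hT₃ j hj.le hjA
      · simpa [hf₃.nat 13 rfl] using h13
    · rintro D hD v hv hvD s' hf h27 ⟨hI1, hI2, hI3⟩
      have h22' : s'.nat 22 0 = j := by rw [hf.nat 22 (by cases up <;> rfl), h22₃]
      have hE' := hE₃.frame hf (by cases up <;> decide) rfl
      have htest : (Test.natLe (.const 1) (.read 14 (reg 27))).holds O s' ↔ v ∈ E.bag i := by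
        simp only [Test.holds, NatExp.eval, reg_eval, h27, hf.nat 14 (by cases up <;> rfl), h14]
        split_ifs with h <;> simp [h]
      by_cases hvi : v ∈ E.bag i
      · refine ⟨10, ?_, Runs.ite (B := 1) (fun _ => Runs.of_wp ?_ le_rfl)
          (fun h => absurd (htest.2 hvi) h) (by simp [Test.cost, NatExp.cost])⟩
        · simp only [Finset.insert_sdiff_of_mem _ hvi, Finset.card_insert_of_notMem hvD, reg_cost]
          omega
        · simp only [Program.wp, Finset.insert_sdiff_of_mem _ hvi]
          exact ⟨hI1, hI2, hI3⟩
      · have hvD' : v ∉ D \ E.bag i := fun h => hvD (Finset.mem_sdiff.1 h).1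
        have hX : E.bag j \ insert v (D \ E.bag i) = (E.bag j \ (D \ E.bag i)).erase v := by
          ext u
          simp only [Finset.mem_sdiff, Finset.mem_insert, Finset.mem_erase]
          tauto
        refine ⟨1000 * (n + 1) * K + 10, ?_, Runs.ite (B := 1000 * (n + 1) * K)
          (fun h => absurd (htest.1 h) hvi) (fun _ => ?_)
          (by simp only [Test.cost, NatExp.cost, reg_cost]; omega)⟩
        · rw [Finset.insert_sdiff_of_notMem _ hvi, Finset.card_insert_of_notMem hvD,
            Finset.card_insert_of_notMem hvD', reg_cost, Nat.add_mul (D \ E.bag i).card 1]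
          omega
        · simp only [Finset.insert_sdiff_of_notMem _ hvi, Finset.union_insert, hX]
          refine (runs_forgetVertex hE' hj.le h22' h27 Finset.sdiff_subset
            (Finset.mem_sdiff.2 ⟨hv, hvD'⟩) ?_ hI3 hI1).mono
              (Nat.mul_le_mul_left _ (hK j hj.le)) ?_
          · intro h
            rcases Finset.mem_union.1 h with h | h
            · exact Finset.disjoint_left.1 (ElimTree.merged_disjoint_bag hA.1) h hv
            · exact hvD' h
          · rintro s'' - ⟨h1, h2, h3⟩
            exact ⟨h1, hI2.trans h2, h3⟩
    · simp only [reg_cost, ← hfdef, Finset.empty_sdiff, Finset.card_empty]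
      omega
  · rintro s₄ hf₄ ⟨hTj, hsame, h13'⟩
    have hE₄ := hE₃.frame hf₄ (by cases up <;> decide) rfl
    rw [sdiff_sdiff_right_self, Finset.inf_eq_inter] at hTj
    simp only [sdiff_sdiff_right_self, Finset.inf_eq_inter] at h13'
    rw [hi, ← ElimTree.Z_eq_merged hA', ← hi] at hTj
    refine (runs_mergeTables hE₄ him hj.le hij (by rw [hf₄.nat 22 (by cases up <;> rfl), h22₃])
      (by rw [hf₄.nat 23 (by cases up <;> rfl), h23₃]) Finset.inter_subset_right h13'
      ((hT₃ i him hiA).congr hsame hij) hTj (hi ▸ ElimTree.merged_disjoint hA.1 hj hjA) ?_ ?_).mono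
      ?_ ?_
    · intro u hu w hw
      obtain ⟨k, hk, e, hu⟩ := ElimTree.mem_merged.1 hu
      exact E.no_edge k (Finset.mem_range.1 (hA.1 hk)) j hj (fun h => hjA (h ▸ hk)) (e.trans hi)
        u hu w hw
    · intro u hu w hw
      refine E.no_edge_bag j hj u hu w ?_
      rw [← hi]
      simp only [Finset.mem_sdiff, Finset.mem_inter] at hw ⊢
      tauto
    · rw [← hb, ← hc]
      exact Nat.mul_le_mul_right _ (Nat.mul_le_mul_left _ (hK i him))
    · rintro s₅ - ⟨h1, h2⟩ i' hi' hi'A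
      by_cases e : i' = i
      · rw [e, hi, ElimTree.merged_insert_self, ← hi]
        exact h1
      · have hne : i' ≠ j := fun h => hi'A (h ▸ Finset.mem_insert_self _ _)
        rw [ElimTree.merged_insert_of_ne (hi ▸ e)]
        exact ((hT₃ i' hi' fun h => hi'A (Finset.mem_insert_of_mem h)).congr hsame hne).congr h2 e

/-- Fills in the tables for empty sets of forgotten vertices. -/
def initTables : Program :=
  .seq (forLoop 24 (reg 0) (.setNat 15 (reg 24) (.const 1)))
  (forLoop 21 (.add (.read 0 (.const 2)) (.const 1))
    (.seq listSubsets
    (.seq (forLoop 32 (reg 20) (.setRat 3 (.add (.read 9 (reg 21)) (.read 17 (reg 32))) .zero))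
      (.setNat 12 (reg 21) (.const 0)))))

lemma runs_initTables {O : Oracles} {up : Bool} {n m K : ℕ} {G : WDigraph (Fin n)}
    {E : ElimTree m G} {s : Memory} (hE : Prepared E s) (hK : ∀ i ≤ m, 2 ^ (E.bag i).card ≤ K) :
    Runs O initTables s (400 * K * (n + 1) * (m + 2)) fun s' =>
      ∀ i ≤ m, HasTable up G s' i (E.bag i) ∅ := by
  have hKpos : 1 ≤ K := Nat.one_le_two_pow.trans (hK m le_rfl)
  have hKn : 1 ≤ K * (n + 1) := Nat.mul_pos hKpos (Nat.succ_pos n)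
  refine Runs.seq (B := n * 20 + 20)
    (B' := (m + 1) * (200 * ((n + 1) * K) + K * 30 + 60) + 20)
    (Q := fun s' => ∀ u : Fin n, s'.nat 15 u = 1) ?_ ?_ (by
      nlinarith [Nat.mul_le_mul hKpos (le_refl (n + 1)), Nat.zero_le (m * K * n),
        Nat.mul_le_mul (le_refl m) hKn, Nat.zero_le (m * K), Nat.zero_le (K * n)])
  · refine runs_forLoop n 6 (fun k s' => ∀ u : Fin n, (u : ℕ) < k → s'.nat 15 u = 1) rfl ?_
      (fun _ _ _ h => h) (fun u hu => absurd hu (Nat.not_lt_zero _)) ?_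
      (fun s' _ h u => h u u.2) (by simp only [reg_cost]; omega)
    · intro s' hf
      rw [reg_eval, hf.nat 0 rfl, hE.vertices]
    · intro k hk s' hf hr hI
      refine Runs.of_wp ?_ (by decide)
      simp only [Program.wp, NatExp.eval, reg_eval, hr, write_apply, reduceIte,
        Function.update_apply]
      intro u hu
      by_cases h : (u : ℕ) = k
      · rw [if_pos h]
      · rw [if_neg h, hI u (by omega)]
  intro s₁ hf₁ h15
  have hE₁ := hE.frame hf₁ (by decide) rfl
  refine runs_forLoop (m + 1) (200 * ((n + 1) * K) + K * 30 + 40)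
    (fun k s' => ∀ i < k, HasTable up G s' i (E.bag i) ∅) rfl ?_ (fun _ _ _ h => h)
    (fun i hi => absurd hi (Nat.not_lt_zero _)) ?_
    (fun s' _ h i hi => h i (Nat.lt_succ_of_le hi)) ?_
  · intro s' hf
    simp only [NatExp.eval]
    rw [hf.nat 0 rfl, hE₁.nodes]
  · intro i hi s₂ hf₂ hr hI
    have hE₂ := hE₁.frame hf₂ (by decide) rfl
    have him : i ≤ m := by omega
    let w : SubsetWeights n :=
      ⟨fun u => 2 ^ (u : ℕ) * (n + 1), fun u => s₂.nat 16 u, fun u => s₂.rat 4 u,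
        fun u => s₂.rat 5 u⟩
    refine Runs.seq (B := 200 * ((n + 1) * K)) (B' := K * 30 + 40)
      (Q := fun s' => ∃ g, w.Listed (E.bag i) g s')
      ((runs_listSubsets ⟨hE₂.weight, fun _ => rfl, fun _ => rfl, fun _ => rfl⟩ (hE₂.bags i him) hr
        subset_rfl fun u hu => ?_).mono ?_ fun _ _ h => h) ?_ (by omega)
    · rw [hf₂.nat 15 rfl, h15]
      simpa using hu
    · rw [Nat.mul_assoc]
      exact Nat.mul_le_mul_left _ (Nat.mul_le_mul_left _ (hK i him))
    rintro s₃ hf₃ ⟨g, hg⟩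
    have hE₃ := hE₂.frame hf₃ (by decide) rfl
    have h21 : s₃.nat 21 0 = i := by rw [hf₃.nat 21 rfl, hr]
    refine Runs.seq (B := K * 30 + 20) (B' := 10) (Q := fun s' =>
      (∀ S ⊆ E.bag i, s'.rat 3 (rowAddr n i S + 0) = 0) ∧
      ∀ i' < i, ∀ (S : Finset (Fin n)) l, l ≤ n →
        s'.rat 3 (rowAddr n i' S + l) = s₂.rat 3 (rowAddr n i' S + l)) ?_ ?_ (by omega)
    · refine runs_forLoop (2 ^ (E.bag i).card) 15 (fun k s' =>
        (∀ x < k, s'.rat 3 (rowAddr n i (g x) + 0) = 0) ∧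
        ∀ i' < i, ∀ (S : Finset (Fin n)) l, l ≤ n →
          s'.rat 3 (rowAddr n i' S + l) = s₂.rat 3 (rowAddr n i' S + l)) rfl ?_
        (fun _ _ _ h => h) ?_ ?_ ?_ ?_
      · intro s' hf
        rw [reg_eval, hf.nat 20 rfl, hg.card]
      · exact ⟨fun x hx => absurd hx (Nat.not_lt_zero _), fun _ _ _ _ _ => by rw [hf₃.rat 3 rfl]⟩
      · rintro k hk s' hf hr' ⟨hI1, hI2⟩
        have e17 : s'.nat 17 k = ∑ u ∈ g k, 2 ^ (u : ℕ) * (n + 1) := by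
          rw [hf.nat 17 rfl, hg.W k hk]
        have e9 : s'.nat 9 i = i * 2 ^ n * (n + 1) := by rw [hf.nat 9 rfl, hE₃.base i him]
        have e21 : s'.nat 21 0 = i := by rw [hf.nat 21 rfl, h21]
        refine Runs.of_wp ?_ (by decide)
        have eaddr : i * 2 ^ n * (n + 1) + ∑ u ∈ g k, 2 ^ (u : ℕ) * (n + 1) =
          rowAddr n i (g k) + 0 := rfl
        simp only [Program.wp, NatExp.eval, RatExp.eval, reg_eval, hr', e17, e9, e21, write_apply,
          reduceIte, Function.update_apply, eaddr]
        constructor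
        · intro x hx
          split_ifs with h
          · rfl
          · refine hI1 x (lt_of_le_of_ne (Nat.lt_succ_iff.1 hx) ?_)
            rintro rfl
            exact h rfl
        · intro i' hi' S l hl
          rw [if_neg (fun h => by
            have := (rowAddr_injective hl (Nat.zero_le n) h).1
            omega)]
          exact hI2 i' hi' S l hl
      · rintro s' - ⟨hI1, hI2⟩
        refine ⟨fun S hS => ?_, hI2⟩
        obtain ⟨x, hx, rfl⟩ := hg.bijOn.2.2 hS
        exact hI1 x hx
      · have := hK i him
        simp only [reg_cost]
        omega
    · rintro s₄ hf₄ ⟨h1, h2⟩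
      have h21' : s₄.nat 21 0 = i := by rw [hf₄.nat 21 rfl, h21]
      have h12 : s₄.nat 12 = s₂.nat 12 := by rw [hf₄.nat 12 rfl, hf₃.nat 12 rfl]
      refine Runs.of_wp ?_ (by decide)
      simp only [Program.wp, NatExp.eval, reg_eval, h21']
      intro i' hi'
      rcases Nat.lt_succ_iff_lt_or_eq.1 hi' with hlt | rfl
      · refine ⟨?_, fun S hS l hl => ?_⟩
        · simp only [write_apply, reduceIte, Function.update_apply, if_neg hlt.ne, h12]
          exact (hI i' hlt).1
        · show IsBest up _ (s₄.rat 3 _)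
          rw [h2 i' hlt S l (hl.trans (by simp))]
          exact (hI i' hlt).2 S hS l hl
      · refine ⟨by simp [write_apply], fun S hS l hl => ?_⟩
        obtain rfl : l = 0 := by simpa using hl
        show IsBest up _ (s₄.rat 3 _)
        rw [h1 S hS, cutValues_empty]
        refine ⟨rfl, ?_⟩
        rintro _ rfl
        exact .refl _ _
  · simp only [NatExp.cost]
    have : (m + 1) * (200 * ((n + 1) * K) + K * 30 + 40 + (1 + 1 + 1 + 1) + 11) ≤
      (m + 1) * (200 * ((n + 1) * K) + K * 30 + 60) := Nat.mul_le_mul_left _ (by omega)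
    omega

/-- The whole dynamic program: the nodes are eliminated in the order of decreasing depth. -/
def dynamicProgram (up : Bool) : Program :=
  .seq initTables
  (forLoop 41 (.read 0 (.const 2)) (forLoop 22 (.read 0 (.const 2))
    (.ite (.and (.natLe (.read 11 (reg 22)) (.sub (.read 0 (.const 2)) (reg 41)))
        (.natLe (.sub (.read 0 (.const 2)) (reg 41)) (.read 11 (reg 22))))
      (processNode up) .skip)))

namespace ElimTree

variable {n m : ℕ} {G : WDigraph (Fin n)} {E : ElimTree m G}

/-- The nodes that have been eliminated when, among those of depth `m - e`, the nodes up to `j` have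
been eliminated. -/
def eliminated (E : ElimTree m G) (e j : ℕ) : Finset ℕ :=
  (Finset.range m).filter fun k => m - e < E.dep k ∨ E.dep k = m - e ∧ k < j

lemma mem_eliminated {e j k : ℕ} :
    k ∈ E.eliminated e j ↔ k < m ∧ (m - e < E.dep k ∨ E.dep k = m - e ∧ k < j) := by
  rw [eliminated, Finset.mem_filter, Finset.mem_range]

lemma isLower_eliminated (e j : ℕ) : E.IsLower (E.eliminated e j) := by
  refine ⟨Finset.filter_subset _ _, fun k hk h => ?_⟩
  have := E.dep_par k hk
  rw [mem_eliminated] at h ⊢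
  omega

lemma eliminated_zero : E.eliminated 0 0 = ∅ := by
  refine Finset.eq_empty_of_forall_notMem fun k hk => ?_
  rw [mem_eliminated] at hk
  have := E.dep_le k hk.1.le
  omega

lemma eliminated_next_depth {e : ℕ} (he : e < m) :
    E.eliminated e m = E.eliminated (e + 1) 0 := by
  ext k
  rw [mem_eliminated, mem_eliminated]
  omega

lemma eliminated_succ_of_eq {e j : ℕ} (hj : j < m) (h : E.dep j = m - e) :
    E.eliminated e (j + 1) = insert j (E.eliminated e j) := by
  ext k
  rw [Finset.mem_insert, mem_eliminated, mem_eliminated]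
  rcases eq_or_ne k j with rfl | hne <;> omega

lemma eliminated_succ_of_ne {e j : ℕ} (h : E.dep j ≠ m - e) :
    E.eliminated e (j + 1) = E.eliminated e j := by
  ext k
  rw [mem_eliminated, mem_eliminated]
  rcases eq_or_ne k j with rfl | hne <;> omega

lemma potential_eliminated_le {e j : ℕ} (hj : j ≤ m) :
    E.potential (E.eliminated e 0) ≤ E.potential (E.eliminated e j) := by
  induction j with
  | zero => exact le_rfl
  | succ j ih =>
    refine (ih (by omega)).trans ?_
    by_cases hd : E.dep j = m - e
    · have hlow := isLower_eliminated (E := E) e (j + 1)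
      rw [eliminated_succ_of_eq hj hd] at hlow ⊢
      refine (Nat.le_add_right _ _).trans
        (potential_insert (isLower_eliminated e j) (fun h => ?_) hlow)
      rw [mem_eliminated] at h
      omega
    · rw [eliminated_succ_of_ne hd]

lemma eliminated_last : E.eliminated m 0 = Finset.range m := by
  ext k
  rw [mem_eliminated, Finset.mem_range]
  refine ⟨And.left, fun hk => ⟨hk, ?_⟩⟩
  have := E.dep_par k hk
  omega

lemma merged_last : E.merged (Finset.range m) m = Finset.univ := E.cover

lemma potential_last :
    E.potential (Finset.range m) = n ^ 2 + 2 * (n + 1) * n + (n + 1) * m := by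
  have e : Finset.range (m + 1) \ Finset.range m = {m} := by
    ext k
    simp only [Finset.mem_sdiff, Finset.mem_range, Finset.mem_singleton]
    omega
  rw [potential, e, Finset.sum_singleton, merged_last, Finset.card_univ, Fintype.card_fin,
    Finset.card_range]

end ElimTree

lemma runs_dynamicProgram {O : Oracles} {up : Bool} {n m K : ℕ} {G : WDigraph (Fin n)}
    {E : ElimTree m G} {s : Memory} (hE : Prepared E s) (hK : ∀ i ≤ m, 2 ^ (E.bag i).card ≤ K) :
    Runs O (dynamicProgram up) s
      (10000 * K * ((n + 1) * (m + 2) + n ^ 2) + 100 * (m + 1) ^ 2) fun s' =>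
        HasTable up G s' m ∅ Finset.univ := by
  refine Runs.seq (B := 400 * K * (n + 1) * (m + 2)) (B' := 2000 * K *
    (n ^ 2 + 2 * (n + 1) * n + (n + 1) * m) + m * (m * 40 + 50) + 20)
    (runs_initTables (up := up) hE hK) ?_ ?_
  · intro s₁ hf₁ hT₁
    have hE₁ := hE.frame hf₁ (by decide) rfl
    have hm : ∀ s', s'.nat 0 = s₁.nat 0 → NatExp.eval s' (.read 0 (.const 2)) = m := by
      intro s' h
      rw [NatExp.eval, h, NatExp.eval, hE₁.nodes]
    let T : Finset ℕ → Memory → Prop := fun A s' =>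
      ∀ i ≤ m, i ∉ A → HasTable up G s' i (E.bag i) (E.merged A i)
    refine runs_forLoop_potential (N := m) (Inv := fun e => T (E.eliminated e 0))
      (Φ := fun e => 2000 * K * E.potential (E.eliminated e 0) + e * (m * 40 + 50))
      (by cases up <;> rfl) (fun s' hf => hm s' (hf.nat 0 (by cases up <;> rfl)))
      (fun _ _ _ h => h) ?_ ?_ ?_ ?_
    · intro i hi _
      rw [ElimTree.eliminated_zero]
      exact hT₁ i hi
    · intro e he s₂ hf₂ hr₂ hI₂
      have hE₂ := hE₁.frame hf₂ (by cases up <;> decide) (by cases up <;> rfl)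
      have hm₂ : s₂.nat 0 = s₁.nat 0 := hf₂.nat 0 (by cases up <;> rfl)
      rw [← ElimTree.eliminated_next_depth he]
      have hle : 2000 * K * E.potential (E.eliminated e 0) ≤
          2000 * K * E.potential (E.eliminated e m) :=
        Nat.mul_le_mul_left _ (ElimTree.potential_eliminated_le le_rfl)
      obtain ⟨B, hB⟩ : ∃ B, 2000 * K * E.potential (E.eliminated e 0) + B =
        2000 * K * E.potential (E.eliminated e m) + m * 40 := ⟨_, Nat.add_sub_of_le (by omega)⟩
      refine ⟨B + 12, ?_, ?_⟩
      · simp only [NatExp.cost, Nat.add_mul e 1]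
        omega
      refine runs_forLoop_potential (N := m) (Inv := fun j => T (E.eliminated e j))
        (Φ := fun j => 2000 * K * E.potential (E.eliminated e j) + j * 40)
        (by cases up <;> rfl) (fun s' hf => hm s' ((hf.nat 0 (by cases up <;> rfl)).trans hm₂))
        (fun _ _ _ h => h) hI₂ ?_ (fun _ _ h => h)
        (by simp only [NatExp.cost]; omega)
      intro j hj s' hf hr hI
      have hE' := hE₂.frame hf (by cases up <;> decide) (by cases up <;> rfl)
      have htest : (Test.and (.natLe (.read 11 (reg 22)) (.sub (.read 0 (.const 2)) (reg 41)))
          (.natLe (.sub (.read 0 (.const 2)) (reg 41)) (.read 11 (reg 22)))).holds O s' ↔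
          E.dep j = m - e := by
        simp only [Test.holds, NatExp.eval, reg_eval, hr, hE'.depth j hj, hE'.nodes,
          hf.nat 41 (by cases up <;> rfl), hr₂]
        omega
      by_cases hd : E.dep j = m - e
      · have hnot : j ∉ E.eliminated e j := by
          rw [ElimTree.mem_eliminated]
          omega
        have hlow := ElimTree.isLower_eliminated (E := E) e (j + 1)
        rw [ElimTree.eliminated_succ_of_eq hj hd] at hlow ⊢
        have hpot := Nat.mul_le_mul_left (2000 * K)
          (ElimTree.potential_insert (ElimTree.isLower_eliminated e j) hnot hlow)
        rw [Nat.mul_add] at hpot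
        refine ⟨_, ?_, Runs.ite (fun _ => runs_processNode hE' hK
          (ElimTree.isLower_eliminated e j) hnot hlow hr hI) (fun h => absurd (htest.2 hd) h)
          le_rfl⟩
        simp only [Test.cost, NatExp.cost, reg_cost, Nat.add_mul j 1]
        omega
      · rw [ElimTree.eliminated_succ_of_ne hd]
        refine ⟨22, ?_, Runs.ite (B := 1) (fun h => absurd (htest.1 h) hd)
          (fun _ => Runs.of_wp hI le_rfl) (by simp [Test.cost, NatExp.cost])⟩
        simp only [NatExp.cost, Nat.add_mul j 1]
        omega
    · intro s' _ h
      have := h m le_rfl (by rw [ElimTree.eliminated_last]; simp)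
      rwa [ElimTree.eliminated_last, ElimTree.merged_last, E.bag_root] at this
    · rw [ElimTree.eliminated_last, ElimTree.potential_last]
      simp only [NatExp.cost]
      omega
  · nlinarith [Nat.zero_le (K * (n + 1) * m), Nat.zero_le (K * n), Nat.zero_le (K * n ^ 2)]

/-! ### Tree decompositions with numbered nodes -/

namespace TreeDecomposition

variable {n m : ℕ} {G : WDigraph (Fin n)} (D : TreeDecomposition G (Fin m))

open Classical in
/-- The parent of a node; the parent of the root is the additional node `m`. -/
noncomputable def parentOf (j : ℕ) : ℕ :=
  if h : ∃ (hj : j < m) (i : Fin m), D.tree.IsChild ⟨j, hj⟩ i then h.choose_spec.choose else m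

/-- The bag of a node; the bag of the additional node `m` is empty. -/
def bagOf (i : ℕ) : Finset (Fin n) := if h : i < m then D.bag ⟨i, h⟩ else ∅

/-- The number of vertices on the path from the root to a node; it is zero for the additional
node `m`. -/
noncomputable def depthOf (i : ℕ) : ℕ :=
  if h : i < m then D.tree.graph.dist D.tree.root ⟨i, h⟩ + 1 else 0

/-- The vertices that occur below `j`, but not in the bag of its parent. -/
noncomputable def droppedAt (j : ℕ) : Finset (Fin n) :=
  if h : j < m then D.vertsBelow ⟨j, h⟩ \ D.bagOf (D.parentOf j) else ∅

variable {D}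

lemma parentOf_eq {j i : Fin m} (h : D.tree.IsChild j i) : D.parentOf j = i := by
  have h' : ∃ (hj : (j : ℕ) < m) (i : Fin m), D.tree.IsChild ⟨j, hj⟩ i := ⟨j.2, i, h⟩
  rw [parentOf, dif_pos h']
  exact congrArg Fin.val (h'.choose_spec.choose_spec.parent_unique h)

lemma parentOf_root : D.parentOf D.tree.root = m := by
  rw [parentOf, dif_neg]
  rintro ⟨hj, i, h⟩
  have := h.2
  simp at this

lemma isChild_or_eq_root (j : Fin m) :
    (∃ i, D.tree.IsChild j i ∧ D.parentOf j = i) ∨ j = D.tree.root ∧ D.parentOf j = m := by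
  by_cases h : j = D.tree.root
  · exact Or.inr ⟨h, h ▸ parentOf_root⟩
  · obtain ⟨i, hi⟩ := D.tree.exists_isChild h
    exact Or.inl ⟨i, hi, parentOf_eq hi⟩

lemma isChild_of_parentOf_eq {j i : Fin m} (h : D.parentOf j = i) : D.tree.IsChild j i := by
  rcases D.isChild_or_eq_root j with ⟨i', hi', e⟩ | ⟨-, e⟩
  · rwa [← Fin.ext (e.symm.trans h)]
  · have := i.2
    omega

lemma eq_root_of_parentOf_eq {j : Fin m} (h : D.parentOf j = m) : j = D.tree.root := by
  rcases D.isChild_or_eq_root j with ⟨i', -, e⟩ | ⟨e, -⟩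
  · have := i'.2
    omega
  · exact e

@[simp] lemma bagOf_val (i : Fin m) : D.bagOf i = D.bag i := by simp [bagOf]

@[simp] lemma bagOf_self : D.bagOf m = ∅ := by simp [bagOf]

@[simp] lemma depthOf_val (i : Fin m) :
    D.depthOf i = D.tree.graph.dist D.tree.root i + 1 := by simp [depthOf]

@[simp] lemma depthOf_self : D.depthOf m = 0 := by simp [depthOf]

lemma droppedAt_val (j : Fin m) :
    D.droppedAt j = D.vertsBelow j \ D.bagOf (D.parentOf j) := by simp [droppedAt]

lemma parentOf_le (j : ℕ) : D.parentOf j ≤ m := by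
  rw [parentOf]
  split_ifs with h
  · exact h.choose_spec.choose.2.le
  · exact le_rfl

lemma depthOf_eq (j : Fin m) : D.depthOf j = D.depthOf (D.parentOf j) + 1 := by
  rcases D.isChild_or_eq_root j with ⟨i, hi, e⟩ | ⟨rfl, e⟩
  · rw [e, depthOf_val, depthOf_val, hi.2]
  · rw [e, depthOf_self, depthOf_val, SimpleGraph.dist_self]

lemma depthOf_le (i : ℕ) : D.depthOf i ≤ m := by
  rw [depthOf]
  split_ifs with h
  · have := D.tree.dist_root_lt ⟨i, h⟩
    rw [Fintype.card_fin] at this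
    omega
  · exact Nat.zero_le _

lemma droppedAt_eq (j : Fin m) : D.droppedAt j =
    ((Finset.range m).filter (D.parentOf · = j)).biUnion D.droppedAt ∪
      (D.bagOf j \ D.bagOf (D.parentOf j)) := by
  have hcoh : ∀ v ∈ D.vertsBelow j, v ∉ D.bag j → v ∉ D.bagOf (D.parentOf j) := by
    intro v hv hvj
    rcases D.isChild_or_eq_root j with ⟨i, hi, e⟩ | ⟨-, e⟩
    · rw [e, bagOf_val]
      exact fun h => hvj (mem_bag_child hi hv h)
    · simp [e]
  ext v
  simp only [droppedAt_val, bagOf_val, Finset.mem_union, Finset.mem_biUnion, Finset.mem_filter,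
    Finset.mem_range, Finset.mem_sdiff]
  constructor
  · rintro ⟨hv, hvp⟩
    by_cases hvj : v ∈ D.bag j
    · exact Or.inr ⟨hvj, hvp⟩
    · obtain ⟨k, hk, hvk⟩ := (mem_vertsBelow_iff.1 hv).resolve_left hvj
      refine Or.inl ⟨k, ⟨k.2, parentOf_eq hk⟩, ?_⟩
      rw [droppedAt_val, parentOf_eq hk, bagOf_val]
      exact Finset.mem_sdiff.2 ⟨hvk, hvj⟩
  · rintro (⟨k, ⟨hk, e⟩, hv⟩ | ⟨hvj, hvp⟩)
    · lift k to Fin m using hk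
      rw [droppedAt_val, e, bagOf_val, Finset.mem_sdiff] at hv
      have hvb := vertsBelow_subset (isChild_of_parentOf_eq e) hv.1
      exact ⟨hvb, hcoh v hvb hv.2⟩
    · exact ⟨bag_subset_vertsBelow j hvj, hvp⟩

/-- By coherence, no vertex is dropped at `j` that also occurs below a sibling of `j`. -/
lemma droppedAt_separated {j k : Fin m} (hjk : j ≠ k) (h : D.parentOf j = D.parentOf k) :
    Disjoint (D.droppedAt j) (D.vertsBelow k) := by
  rcases D.isChild_or_eq_root j with ⟨i, hi, e⟩ | ⟨e, e'⟩
  · rw [Finset.disjoint_left]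
    intro v hv hv'
    rw [droppedAt_val, e, bagOf_val, Finset.mem_sdiff] at hv
    exact hv.2 (mem_bag_parent hi (isChild_of_parentOf_eq (h.symm.trans e)) hjk hv.1 hv')
  · exact absurd (e.trans (eq_root_of_parentOf_eq (h.symm.trans e')).symm) hjk

/-- The edges at a vertex that is dropped at `j` stay below `j`. -/
lemma mem_vertsBelow_of_mem_droppedAt {j : Fin m} {u w : Fin n} (hu : u ∈ D.droppedAt j)
    (h : (u, w) ∈ G.edges ∨ (w, u) ∈ G.edges) : w ∈ D.vertsBelow j := by
  rw [droppedAt_val, Finset.mem_sdiff] at hu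
  rcases D.isChild_or_eq_root j with ⟨i, hi, e⟩ | ⟨e, -⟩
  · rw [e, bagOf_val] at hu
    exact mem_vertsBelow_of_edge hi hu.1 hu.2 h
  · rw [e, vertsBelow_root]
    exact Finset.mem_univ w

variable (D) in
/-- The data of the tree decomposition that the dynamic program uses. It need not be nice. -/
noncomputable def toElimTree : ElimTree m G where
  par := D.parentOf
  dep := D.depthOf
  bag := D.bagOf
  Z := D.droppedAt
  par_le j _ := parentOf_le j
  dep_par j hj := depthOf_eq ⟨j, hj⟩
  dep_root := depthOf_self
  dep_le i _ := depthOf_le i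
  bag_root := bagOf_self
  Z_eq j hj := droppedAt_eq ⟨j, hj⟩
  Z_disjoint_bag j hj := by
    lift j to Fin m using hj
    rw [droppedAt_val]
    exact Finset.sdiff_disjoint
  Z_disjoint j hj k hk hjk h := by
    lift j to Fin m using hj
    lift k to Fin m using hk
    refine (droppedAt_separated (fun e => hjk (congrArg _ e)) h).mono_right ?_
    rw [droppedAt_val]
    exact Finset.sdiff_subset
  no_edge_bag j hj u hu w hw := by
    lift j to Fin m using hj
    rw [← not_or]
    intro h
    have hwj := mem_vertsBelow_of_mem_droppedAt hu h
    rw [Finset.mem_sdiff, bagOf_val] at hw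
    rcases D.isChild_or_eq_root j with ⟨i, hi, e⟩ | ⟨-, e⟩
    · rw [e, bagOf_val] at hw
      exact hw.2 (mem_bag_child hi hwj hw.1)
    · rw [e, bagOf_self] at hw
      simp at hw
  no_edge j hj k hk hjk h u hu w hw := by
    lift j to Fin m using hj
    lift k to Fin m using hk
    rw [← not_or]
    intro h'
    exact Finset.disjoint_left.1 (droppedAt_separated (fun e => hjk (congrArg _ e.symm)) h.symm) hw
      (mem_vertsBelow_of_mem_droppedAt hu h')
  cover := by
    refine Finset.eq_univ_of_forall fun v => Finset.mem_biUnion.2 ⟨D.tree.root, ?_, ?_⟩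
    · exact Finset.mem_filter.2 ⟨Finset.mem_range.2 D.tree.root.2, parentOf_root⟩
    · rw [droppedAt_val, parentOf_root, bagOf_self, vertsBelow_root]
      simp

lemma two_pow_card_bagOf_le (i : ℕ) : 2 ^ (D.bagOf i).card ≤ 2 * 2 ^ D.width := by
  rw [← pow_succ']
  refine Nat.pow_le_pow_right (by norm_num) ?_
  rw [bagOf]
  split_ifs with h
  · have : (D.bag ⟨i, h⟩).card ≤ Finset.univ.sup fun i => (D.bag i).card :=
      Finset.le_sup (f := fun i => (D.bag i).card) (Finset.mem_univ _)
    rw [width]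
    omega
  · simp

end TreeDecomposition

/-! ### Preparing the input -/

/-- Makes the additional node the root. -/
def addRoot : Program :=
  .seq (.setNat 3 (.read 0 (.const 3)) (.read 0 (.const 2)))
  (.seq (.setNat 4 (.read 0 (.const 2)) (.const 0)) (.setNat 7 (.const 0) (.const 0)))

/-- Fills the array `8` with the numbers `2 ^ u * (n + 1)`. -/
def fillWeights : Program :=
  .seq (.setNat 43 (.const 0) (.add (reg 0) (.const 1)))
  (forLoop 42 (reg 0) (.seq (.setNat 8 (reg 42) (reg 43))
    (.setNat 43 (.const 0) (.add (reg 43) (reg 43)))))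

/-- Fills the array `9` with the addresses of the tables. -/
def fillBases : Program :=
  .seq (.setNat 44 (.const 0) (.const 0))
  (forLoop 42 (.add (.read 0 (.const 2)) (.const 1)) (.seq (.setNat 9 (reg 42) (reg 44))
    (.setNat 44 (.const 0) (.add (reg 44) (reg 43)))))

/-- Fills the array `10` with the addresses of the rows of the adjacency matrix. -/
def fillRows : Program :=
  .seq (.setNat 44 (.const 0) (.const 0))
  (forLoop 42 (reg 0) (.seq (.setNat 10 (reg 42) (reg 44))
    (.setNat 44 (.const 0) (.add (reg 44) (reg 0)))))

/-- Computes the adjacency matrix from the list of edges. -/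
def fillMatrix : Program :=
  .seq (forLoop 42 (reg 44) (.setRat 2 (reg 42) .zero))
  (forLoop 42 (.read 0 (.const 1))
    (.setRat 2 (.add (.read 10 (.read 1 (reg 42))) (.read 2 (reg 42))) (.read 0 (reg 42))))

/-- Computes the depths of the nodes; after `e` rounds, those of the nodes of depth at most `e` are
correct. -/
def fillDepths : Program :=
  .seq (.setNat 11 (.read 0 (.const 2)) (.const 0))
  (forLoop 42 (.read 0 (.const 2)) (forLoop 45 (.read 0 (.const 2))
    (.setNat 11 (reg 45) (.add (.read 11 (.read 3 (reg 45))) (.const 1)))))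

/-- Computes from the input what the dynamic program needs, and sets the output to `⊥`. -/
def setup : Program :=
  .seq addRoot (.seq fillWeights (.seq fillBases (.seq fillRows (.seq fillMatrix fillDepths))))

section Setup

variable {O : Oracles} {n m : ℕ} {G : WDigraph (Fin n)} {s : Memory}

lemma runs_fillWeights (h0 : s.nat 0 0 = n) :
    Runs O fillWeights s (100 * (n + 1)) fun s' =>
      (∀ k < n, s'.nat 8 k = 2 ^ k * (n + 1)) ∧ s'.nat 43 0 = 2 ^ n * (n + 1) := by
  refine Runs.seq (B := 10) (B' := n * 60 + 20) (Q := fun s' => s'.nat 43 0 = n + 1)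
    (Runs.of_wp (by simp [Program.wp, NatExp.eval, write_apply, h0]) (by decide)) ?_ (by omega)
  intro s₁ hf₁ h₁
  refine runs_forLoop n 20 (fun k s' => (∀ k' < k, s'.nat 8 k' = 2 ^ k' * (n + 1)) ∧
    s'.nat 43 0 = 2 ^ k * (n + 1)) rfl ?_ (fun _ _ _ h => h) (by simpa using h₁) ?_
    (fun _ _ h => h) (by simp only [reg_cost]; omega)
  · intro s' hf
    rw [reg_eval, hf.nat 0 rfl, hf₁.nat 0 rfl, h0]
  · rintro k hk s' hf hr ⟨h1, h2⟩
    refine Runs.of_wp ?_ (by decide)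
    simp only [Program.wp, NatExp.eval, reg_eval, hr, h2, write_apply, reduceIte, Nat.reduceEqDiff,
      Function.update_apply]
    refine ⟨fun k' hk' => ?_, by ring⟩
    split_ifs with h
    · rw [h]
    · exact h1 k' (by omega)

lemma runs_fillBases (h2 : s.nat 0 2 = m) (h43 : s.nat 43 0 = 2 ^ n * (n + 1)) :
    Runs O fillBases s (100 * (m + 2)) fun s' => ∀ i ≤ m, s'.nat 9 i = i * 2 ^ n * (n + 1) := by
  refine Runs.seq (B := 10) (B' := (m + 1) * 60 + 20) (Q := fun s' => s'.nat 44 0 = 0)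
    (Runs.of_wp (by simp [Program.wp, NatExp.eval, write_apply]) (by decide)) ?_ (by omega)
  intro s₁ hf₁ h₁
  refine runs_forLoop (m + 1) 20 (fun k s' => (∀ k' < k, s'.nat 9 k' = k' * 2 ^ n * (n + 1)) ∧
    s'.nat 44 0 = k * 2 ^ n * (n + 1)) rfl ?_ (fun _ _ _ h => h) (by simpa using h₁) ?_
    (fun s' _ h i hi => h.1 i (Nat.lt_succ_of_le hi)) (by simp only [NatExp.cost]; omega)
  · intro s' hf
    simp only [NatExp.eval]
    rw [hf.nat 0 rfl, hf₁.nat 0 rfl, h2]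
  · rintro k hk s' hf hr ⟨h1, h3⟩
    have e43 : s'.nat 43 0 = 2 ^ n * (n + 1) := by rw [hf.nat 43 rfl, hf₁.nat 43 rfl, h43]
    refine Runs.of_wp ?_ (by decide)
    simp only [Program.wp, NatExp.eval, reg_eval, hr, h3, e43, write_apply, reduceIte,
      Nat.reduceEqDiff, Function.update_apply]
    refine ⟨fun k' hk' => ?_, by ring⟩
    split_ifs with h
    · rw [h]
    · exact h1 k' (by omega)

lemma runs_fillRows (h0 : s.nat 0 0 = n) :
    Runs O fillRows s (100 * (n + 1)) fun s' =>
      (∀ k < n, s'.nat 10 k = k * n) ∧ s'.nat 44 0 = n * n := by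
  refine Runs.seq (B := 10) (B' := n * 60 + 20) (Q := fun s' => s'.nat 44 0 = 0)
    (Runs.of_wp (by simp [Program.wp, NatExp.eval, write_apply]) (by decide)) ?_ (by omega)
  intro s₁ hf₁ h₁
  have e0 : ∀ s' : Memory, s'.nat 0 = s₁.nat 0 → s'.nat 0 0 = n := fun s' h => by
    rw [h, hf₁.nat 0 rfl, h0]
  refine runs_forLoop n 20 (fun k s' => (∀ k' < k, s'.nat 10 k' = k' * n) ∧
    s'.nat 44 0 = k * n) rfl (fun s' hf => e0 s' (hf.nat 0 rfl)) (fun _ _ _ h => h)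
    (by simpa using h₁) ?_ (fun _ _ h => h) (by simp only [reg_cost]; omega)
  rintro k hk s' hf hr ⟨h1, h2⟩
  refine Runs.of_wp ?_ (by decide)
  simp only [Program.wp, NatExp.eval, reg_eval, hr, h2, e0 s' (hf.nat 0 rfl), write_apply,
    reduceIte, Nat.reduceEqDiff, Function.update_apply]
  refine ⟨fun k' hk' => ?_, by ring⟩
  split_ifs with h
  · rw [h]
  · exact h1 k' (by omega)

lemma cell_eq_iff {u u' v v' : Fin n} :
    (u : ℕ) * n + v = u' * n + v' ↔ u = u' ∧ v = v' := by
  refine ⟨fun h => ?_, by rintro ⟨rfl, rfl⟩; rfl⟩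
  have hn : 0 < n := u.pos
  have h1 := congrArg (· % n) h
  have h2 := congrArg (· / n) h
  simp only [Nat.mul_add_mod_self_right, Nat.mod_eq_of_lt v.2, Nat.mod_eq_of_lt v'.2] at h1
  simp only [Nat.add_comm (_ * n), Nat.add_mul_div_right _ _ hn, Nat.div_eq_of_lt v.2,
    Nat.div_eq_of_lt v'.2, zero_add] at h2
  exact ⟨Fin.ext h2, Fin.ext h1⟩

lemma runs_fillMatrix (h1 : s.nat 0 1 = G.edges.card) (e : Fin G.edges.card ≃ G.edges)
    (he : ∀ k : Fin G.edges.card,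
      s.nat 1 k = (e k).1.1 ∧ s.nat 2 k = (e k).1.2 ∧ s.rat 0 k = G.weight (e k))
    (h10 : ∀ k < n, s.nat 10 k = k * n) (h44 : s.nat 44 0 = n * n) :
    Runs O fillMatrix s (100 * (n * n + 1)) fun s' =>
      ∀ u v : Fin n, s'.rat 2 (u * n + v) = G.arc u v := by
  have hcard : G.edges.card ≤ n * n := by
    simpa using Finset.card_le_univ G.edges
  refine Runs.seq (B := n * n * 30 + 20) (B' := n * n * 40 + 30)
    (Q := fun s' => ∀ a < n * n, s'.rat 2 a = 0) ?_ ?_ (by omega)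
  · refine runs_forLoop (n * n) 10 (fun k s' => ∀ a < k, s'.rat 2 a = 0) rfl ?_
      (fun _ _ _ h => h) (fun a ha => absurd ha (Nat.not_lt_zero _)) ?_ (fun _ _ h => h)
      (by simp only [reg_cost]; omega)
    · intro s' hf
      rw [reg_eval, hf.nat 44 rfl, h44]
    · intro k hk s' hf hr hI
      refine Runs.of_wp ?_ (by decide)
      simp only [Program.wp, RatExp.eval, reg_eval, hr, write_apply, reduceIte,
        Function.update_apply]
      intro a ha
      split_ifs with h
      · rfl
      · exact hI a (by omega)
  intro s₁ hf₁ hz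
  refine runs_forLoop G.edges.card 20 (fun k s' => ∀ u v : Fin n, s'.rat 2 (u * n + v) =
    if ∃ k' : Fin G.edges.card, (k' : ℕ) < k ∧ (e k').1 = (u, v) then G.weight (u, v) else 0) rfl ?_
    (fun _ _ _ h => h) ?_ ?_ ?_ ?_
  · intro s' hf
    simp only [NatExp.eval]
    rw [hf.nat 0 rfl, hf₁.nat 0 rfl, h1]
  · intro u v
    rw [if_neg (by simp)]
    refine hz _ ?_
    calc (u : ℕ) * n + v < u * n + n := by omega
      _ = (u + 1) * n := by ring
      _ ≤ n * n := Nat.mul_le_mul_right _ u.2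
  · intro k hk s' hf hr hI
    obtain ⟨k, rfl⟩ : ∃ k' : Fin G.edges.card, k = k' := ⟨⟨k, hk⟩, rfl⟩
    obtain ⟨a1, a2, a3⟩ := he k
    have e1 : s'.nat 1 k = (e k).1.1 := by rw [hf.nat 1 rfl, hf₁.nat 1 rfl, a1]
    have e2 : s'.nat 2 k = (e k).1.2 := by rw [hf.nat 2 rfl, hf₁.nat 2 rfl, a2]
    have e3 : s'.rat 0 k = G.weight (e k) := by rw [hf.rat 0 rfl, hf₁.rat 0 rfl, a3]
    have e10 : s'.nat 10 (e k).1.1 = (e k).1.1 * n := by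
      rw [hf.nat 10 rfl, hf₁.nat 10 rfl, h10 _ (e k).1.1.2]
    refine Runs.of_wp ?_ (by decide)
    simp only [Program.wp, NatExp.eval, RatExp.eval, reg_eval, hr, e1, e2, e3, e10, write_apply,
      reduceIte, Function.update_apply, cell_eq_iff]
    intro u v
    by_cases h : (e k).1 = (u, v)
    · rw [if_pos (by simp [h]), if_pos ⟨k, Nat.lt_succ_self _, h⟩, h]
    · rw [if_neg (fun h' => h (Prod.ext h'.1.symm h'.2.symm)), hI u v]
      refine if_congr ⟨fun ⟨k', hk', h'⟩ => ⟨k', by omega, h'⟩, fun ⟨k', hk', h'⟩ => ⟨k', ?_, h'⟩⟩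
        rfl rfl
      refine lt_of_le_of_ne (Nat.lt_succ_iff.1 hk') fun hkk => h ?_
      rw [← Fin.ext hkk, h']
  · intro s' _ hI u v
    rw [hI u v, WDigraph.arc]
    refine if_congr ⟨?_, fun h => ?_⟩ rfl rfl
    · rintro ⟨k, -, h⟩
      rw [← h]
      exact (e k).2
    · exact ⟨e.symm ⟨(u, v), h⟩, Fin.is_lt _, by simp⟩
  · simp only [NatExp.cost]
    omega

lemma runs_fillDepths (E : ElimTree m G) (h2 : s.nat 0 2 = m) (h3 : ∀ j < m, s.nat 3 j = E.par j) :
    Runs O fillDepths s (100 * (m + 1) ^ 2) fun s' => ∀ j < m, s'.nat 11 j = E.dep j := by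
  refine Runs.seq (B := 10) (B' := m * (m * 30 + 40) + 20) (Q := fun s' => s'.nat 11 m = 0)
    (Runs.of_wp (by simp [Program.wp, NatExp.eval, write_apply, h2]) (by decide)) ?_ (by nlinarith)
  intro s₁ hf₁ h₁
  have e2 : ∀ s' : Memory, s'.nat 0 = s₁.nat 0 → NatExp.eval s' (.read 0 (.const 2)) = m := by
    intro s' h
    rw [NatExp.eval, h, NatExp.eval, hf₁.nat 0 rfl, h2]
  refine runs_forLoop m (m * 30 + 20) (fun e s' => ∀ j ≤ m, E.dep j ≤ e → s'.nat 11 j = E.dep j)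
    rfl (fun s' hf => e2 s' (hf.nat 0 rfl)) (fun _ _ _ h => h) ?_ ?_
    (fun s' _ h j hj => h j hj.le (E.dep_le j hj.le)) ?_
  · intro j hj hd
    rcases Nat.lt_or_eq_of_le hj with h | rfl
    · have := E.dep_par j h
      omega
    · rw [h₁, E.dep_root]
  · intro e he s₂ hf₂ hr₂ hI₂
    refine runs_forLoop m 10 (fun k s' => ∀ j ≤ m, E.dep j ≤ e ∨ E.dep j = e + 1 ∧ j < k →
      s'.nat 11 j = E.dep j) rfl (fun s' hf => e2 s' ((hf.nat 0 rfl).trans (hf₂.nat 0 rfl)))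
      (fun _ _ _ h => h) (fun j hj h => hI₂ j hj (by omega)) ?_ ?_ ?_
    · intro k hk s' hf hr hI
      have e3 : s'.nat 3 k = E.par k := by
        rw [hf.nat 3 rfl, hf₂.nat 3 rfl, hf₁.nat 3 rfl, h3 k hk]
      have hdep := E.dep_par k hk
      refine Runs.of_wp ?_ (by decide)
      simp only [Program.wp, NatExp.eval, reg_eval, hr, e3, write_apply, reduceIte,
        Function.update_apply]
      intro j hj h
      split_ifs with hjk
      · subst hjk
        rw [hI _ (E.par_le j hk) (by omega), hdep]
      · exact hI j hj (by omega)
    · intro s' _ h j hj hd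
      refine h j hj ?_
      rcases Nat.lt_or_eq_of_le hj with h' | rfl
      · omega
      · exact Or.inl (by rw [E.dep_root]; omega)
    · simp only [NatExp.cost]
      omega
  · have := Nat.mul_le_mul_left m (show m * 30 + 33 ≤ m * 30 + 40 by omega)
    simp only [NatExp.cost, Nat.add_assoc, Nat.reduceAdd]
    omega

lemma isBagList_of_isInput {D : TreeDecomposition G (Fin m)} (hs : IsInput D s) (i : Fin m) :
    IsBagList s i (D.bag i) := by
  obtain ⟨b, hb⟩ := hs.bags i
  refine ⟨List.ofFn fun k => (b k).1, ?_, ?_, ?_, ?_⟩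
  · exact List.nodup_ofFn.2 fun x y h => b.injective (Subtype.ext h)
  · ext v
    simp only [List.mem_toFinset, List.mem_ofFn]
    constructor
    · rintro ⟨k, rfl⟩
      exact (b k).2
    · intro hv
      exact ⟨b.symm ⟨v, hv⟩, by simp⟩
  · rw [List.length_ofFn, hs.bagCard]
  · intro k hk
    rw [List.length_ofFn] at hk
    simpa using hb ⟨k, hk⟩

lemma runs_setup {D : TreeDecomposition G (Fin m)} (hs : IsInput D s) :
    Runs O setup s (1000 * ((n + 1) ^ 2 + (m + 2) ^ 2)) fun s' =>
      Prepared D.toElimTree s' ∧ output s' = none := by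
  refine Runs.seq (B := 30) (B' := 200 * (n + 1) + 100 * (m + 2) + 100 * (n * n + 1) +
    100 * (m + 1) ^ 2)
    (Q := fun s' => (∀ j < m, s'.nat 3 j = D.parentOf j) ∧ (∀ i ≤ m, IsBagList s' i (D.bagOf i)) ∧
      s'.nat 7 0 = 0) (Runs.of_wp ?_ (by decide)) ?_ (by nlinarith)
  · simp only [addRoot, Program.wp, NatExp.eval, hs.nodes, hs.root, write_apply, reduceIte,
      Nat.reduceEqDiff, Function.update_apply, and_true]
    refine ⟨fun j hj => ?_, fun i hi => ?_⟩
    · lift j to Fin m using hj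
      rcases D.isChild_or_eq_root j with ⟨i, hi, e⟩ | ⟨rfl, e⟩
      · have hne : (j : ℕ) ≠ D.tree.root := by
          intro h
          have := hi.2
          rw [Fin.ext h, SimpleGraph.dist_self] at this
          omega
        rw [if_neg hne, hs.parent j i hi, e]
      · rw [if_pos rfl, e]
    · rcases Nat.lt_or_eq_of_le hi with hi | rfl
      · lift i to Fin m using hi
        obtain ⟨L, hL1, hL2, hL3, hL4⟩ := isBagList_of_isInput hs i
        have hne : (i : ℕ) ≠ m := i.2.ne
        refine ⟨L, hL1, by simpa using hL2, ?_, ?_⟩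
        · simp [write_apply, hne, hL3]
        · intro k hk
          simp [write_apply, hL4 k hk]
      · exact ⟨[], List.nodup_nil, by simp, by simp [write_apply], fun k hk => absurd hk (by simp)⟩
  rintro s₁ hf₁ ⟨h3, hbag, h7⟩
  have h0 : s₁.nat 0 0 = n := by rw [hf₁.nat 0 rfl, hs.vertices]
  have h01 : s₁.nat 0 1 = G.edges.card := by rw [hf₁.nat 0 rfl, hs.numEdges]
  have h02 : s₁.nat 0 2 = m := by rw [hf₁.nat 0 rfl, hs.nodes]
  refine Runs.seq (B := 100 * (n + 1)) (B' := 100 * (n + 1) + 100 * (m + 2) + 100 * (n * n + 1) +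
    100 * (m + 1) ^ 2) (runs_fillWeights h0) ?_ (by omega)
  rintro s₂ hf₂ ⟨h8, h43⟩
  refine Runs.seq (B := 100 * (m + 2)) (B' := 100 * (n + 1) + 100 * (n * n + 1) +
    100 * (m + 1) ^ 2) (runs_fillBases (by rw [hf₂.nat 0 rfl, h02]) h43) ?_ (by omega)
  intro s₃ hf₃ h9
  refine Runs.seq (B := 100 * (n + 1)) (B' := 100 * (n * n + 1) + 100 * (m + 1) ^ 2)
    (runs_fillRows (by rw [hf₃.nat 0 rfl, hf₂.nat 0 rfl, h0])) ?_ (by omega)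
  rintro s₄ hf₄ ⟨h10, h44⟩
  obtain ⟨e, he⟩ := hs.edges
  refine Runs.seq (B := 100 * (n * n + 1)) (B' := 100 * (m + 1) ^ 2)
    (runs_fillMatrix (by rw [hf₄.nat 0 rfl, hf₃.nat 0 rfl, hf₂.nat 0 rfl, h01]) e ?_ h10 h44) ?_
    le_rfl
  · rw [hf₄.nat 1 rfl, hf₃.nat 1 rfl, hf₂.nat 1 rfl, hf₁.nat 1 rfl, hf₄.nat 2 rfl, hf₃.nat 2 rfl,
      hf₂.nat 2 rfl, hf₁.nat 2 rfl, hf₄.rat 0 rfl, hf₃.rat 0 rfl, hf₂.rat 0 rfl, hf₁.rat 0 rfl]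
    exact he
  intro s₅ hf₅ harc
  have e0 : s₅.nat 0 = s₁.nat 0 := by
    rw [hf₅.nat 0 rfl, hf₄.nat 0 rfl, hf₃.nat 0 rfl, hf₂.nat 0 rfl]
  have e3 : s₅.nat 3 = s₁.nat 3 := by
    rw [hf₅.nat 3 rfl, hf₄.nat 3 rfl, hf₃.nat 3 rfl, hf₂.nat 3 rfl]
  refine (runs_fillDepths D.toElimTree (by rw [e0, h02]) (by rw [e3]; exact h3)).mono le_rfl ?_
  intro s₆ hf₆ h11
  refine ⟨⟨?_, ?_, ?_, fun i hi => (hbag i hi).congr ?_ ?_ ?_, fun u => ?_, ?_, fun u => ?_, h11,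
    ?_⟩, ?_⟩
  · rw [hf₆.nat 0 rfl, e0, h0]
  · rw [hf₆.nat 0 rfl, e0, h02]
  · rw [hf₆.nat 3 rfl, e3]; exact h3
  · rw [hf₆.nat 4 rfl, hf₅.nat 4 rfl, hf₄.nat 4 rfl, hf₃.nat 4 rfl, hf₂.nat 4 rfl]
  · rw [hf₆.nat 5 rfl, hf₅.nat 5 rfl, hf₄.nat 5 rfl, hf₃.nat 5 rfl, hf₂.nat 5 rfl]
  · rw [hf₆.nat 6 rfl, hf₅.nat 6 rfl, hf₄.nat 6 rfl, hf₃.nat 6 rfl, hf₂.nat 6 rfl]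
  · rw [hf₆.nat 8 rfl, hf₅.nat 8 rfl, hf₄.nat 8 rfl, hf₃.nat 8 rfl, h8 u u.2]
  · rw [hf₆.nat 9 rfl, hf₅.nat 9 rfl, hf₄.nat 9 rfl]; exact h9
  · rw [hf₆.nat 10 rfl, hf₅.nat 10 rfl, h10 u u.2]
  · rw [hf₆.rat 2 rfl]; exact harc
  · have : s₆.nat 7 0 = 0 := by
      rw [hf₆.nat 7 rfl, hf₅.nat 7 rfl, hf₄.nat 7 rfl, hf₃.nat 7 rfl, hf₂.nat 7 rfl, h7]
    simp [output, this]

end Setup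

/-! ### The output -/

/-- Improves the output by the admissible pairs from the table of the additional root. -/
def report : Program :=
  forLoop 42 (.add (reg 0) (.const 1))
    (.ite (.and (.isValid (reg 42)) (.not (.and (.not (.natLe (reg 7) (.const 0)))
        (.not (.objLe (.read 7 (.const 1)) (.read 1 (.const 0)) (reg 42)
          (.read 3 (.add (.read 9 (.read 0 (.const 2))) (reg 42))))))))
      (.seq (.setNat 7 (.const 0) (.const 1)) (.seq (.setNat 7 (.const 1) (reg 42))
        (.setRat 1 (.const 0) (.read 3 (.add (.read 9 (.read 0 (.const 2))) (reg 42))))))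
      .skip)

/-- The pairs `(l, v l)` with `l < k` that are admissible. -/
def candidates (valid : ℕ → Bool) (v : ℕ → ℚ) (k : ℕ) : Set (ℕ × ℚ) :=
  {p | p.1 < k ∧ valid p.1 = true ∧ p.2 = v p.1}

lemma candidates_zero (valid : ℕ → Bool) (v : ℕ → ℚ) : candidates valid v 0 = ∅ := by
  ext p
  simp [candidates]

lemma candidates_succ_of_valid {valid : ℕ → Bool} {v : ℕ → ℚ} {k : ℕ} (h : valid k = true) :
    candidates valid v (k + 1) = insert (k, v k) (candidates valid v k) := by
  ext ⟨l, x⟩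
  simp only [candidates, Set.mem_ofPred_eq, Set.mem_insert_iff, Prod.mk.injEq]
  constructor
  · rintro ⟨h1, h2, rfl⟩
    rcases Nat.lt_succ_iff_lt_or_eq.1 h1 with h3 | rfl
    · exact Or.inr ⟨h3, h2, rfl⟩
    · exact Or.inl ⟨rfl, rfl⟩
  · rintro (⟨rfl, rfl⟩ | ⟨h1, h2, rfl⟩)
    · exact ⟨Nat.lt_succ_self _, h, rfl⟩
    · exact ⟨Nat.lt_succ_of_lt h1, h2, rfl⟩

lemma candidates_succ_of_not_valid {valid : ℕ → Bool} {v : ℕ → ℚ} {k : ℕ} (h : valid k ≠ true) :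
    candidates valid v (k + 1) = candidates valid v k := by
  ext ⟨l, x⟩
  simp only [candidates, Set.mem_ofPred_eq]
  constructor
  · rintro ⟨h1, h2, h3⟩
    refine ⟨lt_of_le_of_ne (Nat.lt_succ_iff.1 h1) ?_, h2, h3⟩
    rintro rfl
    exact h h2
  · rintro ⟨h1, h2⟩
    exact ⟨Nat.lt_succ_of_lt h1, h2⟩

section IsSup

variable {f : Objective} {M : Set (ℕ × ℚ)} {q : ℕ × ℚ}

lemma IsSup.insert_of_none (h : IsSup f M none) : IsSup f (insert q M) (some q) := by
  refine ⟨Or.inr ⟨q, Set.mem_insert _ _, rfl⟩, fun p hp => ?_⟩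
  rcases Set.mem_insert_iff.1 hp with rfl | hp
  · exact Or.inr ⟨_, _, rfl, rfl, le_rfl⟩
  · rcases h.2 p hp with h' | ⟨_, _, _, h', _⟩ <;> cases h'

lemma IsSup.insert_of_le {p : ℕ × ℚ} (h : IsSup f M (some p)) (hle : f p.1 p.2 ≤ f q.1 q.2) :
    IsSup f (insert q M) (some q) := by
  refine ⟨Or.inr ⟨q, Set.mem_insert _ _, rfl⟩, fun r hr => ?_⟩
  rcases Set.mem_insert_iff.1 hr with rfl | hr
  · exact Or.inr ⟨_, _, rfl, rfl, le_rfl⟩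
  · rcases h.2 r hr with h' | ⟨a, b, ha, hb, hab⟩
    · cases h'
    · cases ha
      cases hb
      exact Or.inr ⟨_, _, rfl, rfl, hab.trans hle⟩

lemma IsSup.insert_of_ge {p : ℕ × ℚ} (h : IsSup f M (some p)) (hle : f q.1 q.2 ≤ f p.1 p.2) :
    IsSup f (insert q M) (some p) := by
  refine ⟨h.1.imp_right fun ⟨r, hr, e⟩ => ⟨r, Set.mem_insert_of_mem _ hr, e⟩, fun r hr => ?_⟩
  rcases Set.mem_insert_iff.1 hr with rfl | hr
  · exact Or.inr ⟨_, _, rfl, rfl, hle⟩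
  · exact h.2 r hr

end IsSup

lemma runs_report {O : Oracles} {n m : ℕ} {G : WDigraph (Fin n)} {E : ElimTree m G} {s : Memory}
    {M : Set (ℕ × ℚ)} {v : ℕ → ℚ} (hE : Prepared E s)
    (hv : ∀ l ≤ n, s.rat 3 (rowAddr n m (∅ : Finset (Fin n)) + l) = v l)
    (hM : IsSup O.f M (output s)) :
    Runs O report s (100 * (n + 2)) fun s' =>
      IsSup O.f (M ∪ candidates O.valid v (n + 1)) (output s') := by
  refine runs_forLoop (n + 1) 60 (fun k s' => IsSup O.f (M ∪ candidates O.valid v k) (output s'))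
    rfl ?_ (fun _ _ _ h => h) (by simpa [candidates_zero] using hM) ?_ (fun _ _ h => h)
    (by simp only [NatExp.cost, reg_cost]; omega)
  · intro s' hf
    rw [NatExp.eval, reg_eval, hf.nat 0 rfl, hE.vertices, NatExp.eval]
  · intro k hk s' hf hr hI
    have e0 : s'.nat 0 2 = m := by rw [hf.nat 0 rfl, hE.nodes]
    have e9 : s'.nat 9 m = m * 2 ^ n * (n + 1) := by rw [hf.nat 9 rfl, hE.base m le_rfl]
    have e3 : s'.rat 3 (m * 2 ^ n * (n + 1) + k) = v k := by
      rw [← hv k (by omega), hf.rat 3 rfl, rowAddr, Finset.sum_empty, add_zero]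
    refine Runs.of_wp ?_ (by decide)
    simp only [Program.wp, NatExp.eval, RatExp.eval, Test.holds, reg_eval, hr, e0, e9, e3,
      write_apply, reduceIte, Nat.reduceEqDiff]
    constructor
    · rintro ⟨hvalid, hbest⟩
      rw [candidates_succ_of_valid hvalid, Set.union_insert]
      have hout : output (⟨write (write s'.nat 7 0 1) 7 1 k, write s'.rat 1 0 (v k)⟩ : Memory) =
          some (k, v k) := by
        simp [output, write_apply]
      refine (iff_of_eq (congrArg (IsSup O.f _) ?_)).2 (?_ : IsSup O.f _ (some (k, v k)))
      · exact hout
      by_cases h7 : s'.nat 7 0 = 0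
      · rw [output, if_pos h7] at hI
        exact hI.insert_of_none
      · rw [output, if_neg h7] at hI
        refine hI.insert_of_le ?_
        by_contra hcon
        exact hbest ⟨by omega, hcon⟩
    · intro hcon
      by_cases hvalid : O.valid k = true
      · rw [not_and, not_not] at hcon
        obtain ⟨h7, hle⟩ := hcon hvalid
        rw [candidates_succ_of_valid hvalid, Set.union_insert]
        have hI' := hI
        rw [output, if_neg (by omega)] at hI' ⊢
        exact hI'.insert_of_ge (le_of_not_ge hle)
      · rw [candidates_succ_of_not_valid hvalid]
        exact hI

/-- Since the program does not know whether the objective function is monotone or antitone, it runs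
the dynamic program for both directions. -/
def solve : Program :=
  .seq setup (.seq (dynamicProgram true) (.seq report (.seq (dynamicProgram false) report)))

lemma forgottenCut_univ {n : ℕ} (G : WDigraph (Fin n)) (R : Finset (Fin n)) :
    forgottenCut G ∅ Finset.univ ∅ R = G.alpha (G.cut R) := by
  have h := G.alpha_cut_inter R Finset.univ (Finset.subset_univ R)
  rw [Finset.univ_product_univ, Finset.inter_univ] at h
  rw [h]
  simp [forgottenCut]

/-- The candidates from the two tables of the root contain a representative of `Φ`. -/
lemma IsSup.feasible_of_candidates {n : ℕ} {G : WDigraph (Fin n)} {f : Objective}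
    {valid : ℕ → Bool} {v v' : ℕ → ℚ} {x : Option (ℕ × ℚ)}
    (hf : (∀ a, Monotone (f a)) ∨ ∀ a, Antitone (f a))
    (hv : ∀ l ≤ n, IsBest true (cutValues G ∅ Finset.univ l ∅) (v l))
    (hv' : ∀ l ≤ n, IsBest false (cutValues G ∅ Finset.univ l ∅) (v' l))
    (hx : IsSup f (candidates valid v (n + 1) ∪ candidates valid v' (n + 1)) x) :
    IsSup f (feasible G valid) x := by
  refine hx.of_cofinal ?_ ?_
  · have key : ∀ l x, valid l = true → x ∈ cutValues G ∅ Finset.univ l ∅ →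
        (l, x) ∈ feasible G valid := by
      rintro _ _ hl ⟨R, -, rfl, rfl⟩
      exact ⟨R, hl, by rw [forgottenCut_univ]⟩
    rintro ⟨l, x⟩ (⟨hl, h, e⟩ | ⟨hl, h, e⟩)
    · obtain rfl : x = v l := e
      exact key l _ h (hv l (Nat.lt_succ_iff.1 hl)).1
    · obtain rfl : x = v' l := e
      exact key l _ h (hv' l (Nat.lt_succ_iff.1 hl)).1
  · rintro _ ⟨R, hR, rfl⟩
    have hcard : R.card ≤ n := by simpa using Finset.card_le_univ R
    have hmem : G.alpha (G.cut R) ∈ cutValues G ∅ Finset.univ R.card ∅ :=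
      ⟨R, Finset.subset_univ R, rfl, (forgottenCut_univ G R).symm⟩
    rcases hf with hf | hf
    · exact ⟨(R.card, v R.card), Or.inl ⟨Nat.lt_succ_of_le hcard, hR, rfl⟩,
        hf _ ((hv _ hcard).2 _ hmem)⟩
    · exact ⟨(R.card, v' R.card), Or.inr ⟨Nat.lt_succ_of_le hcard, hR, rfl⟩,
        hf _ ((hv' _ hcard).2 _ hmem)⟩

lemma runs_solve {n m : ℕ} {G : WDigraph (Fin n)} {D : TreeDecomposition G (Fin m)}
    {f : Objective} {valid : ℕ → Bool} {s : Memory}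
    (hf : (∀ a, Monotone (f a)) ∨ ∀ a, Antitone (f a)) (hs : IsInput D s) :
    Runs ⟨f, valid⟩ solve s
      (50000 * (2 ^ D.width * ((n + 1) * (m + 2) + (n + 1) ^ 2 + (m + 2) ^ 2)))
      fun s' => IsSup f (feasible G valid) (output s') := by
  obtain ⟨K, hK⟩ : ∃ K, K = 2 ^ D.width := ⟨_, rfl⟩
  have hKpos : 1 ≤ K := hK ▸ Nat.one_le_two_pow
  have hbag : ∀ i ≤ m, 2 ^ (D.toElimTree.bag i).card ≤ 2 * K := fun i _ =>
    hK ▸ D.two_pow_card_bagOf_le i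
  rw [← hK]
  obtain ⟨B, hB⟩ : ∃ B, B = 10000 * (2 * K) * ((n + 1) * (m + 2) + n ^ 2) + 100 * (m + 1) ^ 2 :=
    ⟨_, rfl⟩
  refine Runs.seq (B' := 2 * B + 200 * (n + 2)) (runs_setup hs) ?_ ?_
  · rintro s₁ hf₁ ⟨hE₁, hout₁⟩
    refine Runs.seq (B := B) (B' := B + 200 * (n + 2))
      ((runs_dynamicProgram (up := true) hE₁ hbag).mono hB.ge fun _ _ h => h) ?_ (by omega)
    intro s₂ hf₂ hT₂
    have hE₂ := hE₁.frame hf₂ (by decide) rfl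
    have hout₂ : output s₂ = none := by
      rw [output, hf₂.nat 7 rfl, hf₂.rat 1 rfl]
      exact hout₁
    refine Runs.seq (B := 100 * (n + 2)) (B' := B + 100 * (n + 2))
      (runs_report (M := ∅) hE₂ (fun _ _ => rfl) (by rw [hout₂]; exact ⟨Or.inl rfl, by simp⟩)) ?_
      (by omega)
    intro s₃ hf₃ hM₃
    have hE₃ := hE₂.frame hf₃ (by decide) rfl
    rw [Set.empty_union] at hM₃
    refine Runs.seq (B := B) (B' := 100 * (n + 2))
      ((runs_dynamicProgram (up := false) hE₃ hbag).mono hB.ge fun _ _ h => h) ?_ (by omega)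
    intro s₄ hf₄ hT₄
    have hE₄ := hE₃.frame hf₄ (by decide) rfl
    refine (runs_report hE₄ (fun _ _ => rfl) (M := candidates valid
      (fun l => s₂.rat 3 (rowAddr n m (∅ : Finset (Fin n)) + l)) (n + 1)) ?_).mono le_rfl ?_
    · rw [output, hf₄.nat 7 rfl, hf₄.rat 1 rfl]
      exact hM₃
    · intro s₅ _ h
      exact h.feasible_of_candidates hf (fun l hl => hT₂.2 ∅ subset_rfl l (by simpa using hl))
        (fun l hl => hT₄.2 ∅ subset_rfl l (by simpa using hl))
  · have h1 := Nat.mul_le_mul hKpos (le_refl ((n + 1) ^ 2))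
    have h2 := Nat.mul_le_mul hKpos (le_refl ((m + 2) ^ 2))
    have h3 : K * n ^ 2 ≤ K * (n + 1) ^ 2 :=
      Nat.mul_le_mul_left _ (Nat.pow_le_pow_left (Nat.le_succ n) 2)
    have h4 : (m + 1) ^ 2 ≤ (m + 2) ^ 2 := Nat.pow_le_pow_left (by omega) 2
    have h5 : n + 2 ≤ 2 * (n + 1) ^ 2 := by nlinarith
    have h6 : 50000 * (K * ((n + 1) * (m + 2) + (n + 1) ^ 2 + (m + 2) ^ 2)) =
      50000 * (K * ((n + 1) * (m + 2))) + 50000 * (K * (n + 1) ^ 2) +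
        50000 * (K * (m + 2) ^ 2) := by ring
    have h7 : B = 20000 * (K * ((n + 1) * (m + 2))) + 20000 * (K * n ^ 2) +
        100 * (m + 1) ^ 2 := by rw [hB]; ring
    omega

end CutFramework

theorem mainTheorem1 :
    -- one program computes `Φ` in time `O(2^t n^2)`
    (∃ (P : Program) (C : ℕ),
      ∀ (n m : ℕ) (G : WDigraph (Fin n)) (D : TreeDecomposition G (Fin m))
        (f : Objective) (valid : ℕ → Bool) (s : Memory),
        0 < n → D.IsNice → D.IsSmall →
        ((∀ a, Monotone (f a)) ∨ (∀ a, Antitone (f a))) →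
        IsInput D s →
        ∃ (s' : Memory) (T : ℕ), Exec ⟨f, valid⟩ P s s' T ∧
          T ≤ C * (2 ^ D.width * n ^ 2) ∧
          IsSup f (feasible G valid) (output s')) ∧
    -- the tables exist, are characterized by the recurrences, and yield `Φ` at the root
    (∀ (n m : ℕ) (G : WDigraph (Fin n)) (D : TreeDecomposition G (Fin m))
      (up : Bool) (f : Objective) (valid : ℕ → Bool),
      D.IsNice → MonotoneDir up f →
      (∃ Γ, IsTable up f D Γ) ∧
      (∀ Γ, IsTable up f D Γ ↔ Recurrences up f D Γ) ∧
      (∀ Γ, IsTable up f D Γ →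
        ∀ x, IsSup f (rootSet D valid Γ) x → IsSup f (feasible G valid) x)) := by
  -- `(n + 1) * (m + 2) + (n + 1) ^ 2 + (m + 2) ^ 2 ≤ 124 * n ^ 2` if `0 < n` and `m ≤ 4 * (n + 1)`
  refine ⟨⟨solve, 50000 * 124, ?_⟩, ?_⟩
  · intro n m G D f valid s hn _ hsmall hf hs
    obtain ⟨s', T, hexec, hT, hout⟩ := runs_solve (valid := valid) hf hs
    refine ⟨s', T, hexec, hT.trans ?_, hout⟩
    have hm : m ≤ 4 * (n + 1) := by
      simpa [TreeDecomposition.IsSmall] using hsmall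
    have hbound : (n + 1) * (m + 2) + (n + 1) ^ 2 + (m + 2) ^ 2 ≤ 124 * n ^ 2 := by
      have h1 : n + 1 ≤ 2 * n := by omega
      have h2 : m + 2 ≤ 10 * n := by omega
      calc (n + 1) * (m + 2) + (n + 1) ^ 2 + (m + 2) ^ 2
          ≤ 2 * n * (10 * n) + (2 * n) ^ 2 + (10 * n) ^ 2 := by gcongr
        _ = 124 * n ^ 2 := by ring
    calc 50000 * (2 ^ D.width * ((n + 1) * (m + 2) + (n + 1) ^ 2 + (m + 2) ^ 2))
        ≤ 50000 * (2 ^ D.width * (124 * n ^ 2)) := by gcongr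
      _ = 50000 * 124 * (2 ^ D.width * n ^ 2) := by ring
  · intro n m G D up f valid hD hf
    exact ⟨exists_isTable up hf, fun Γ => isTable_iff_recurrences hD hf,
      fun Γ hΓ x hx => isSup_feasible_of_isSup_rootSet hΓ hx⟩
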